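/- Let $k$ be an algebraically closed field, $m>1$ an integer which is not divisible by the characteristic of $k$, $\mu\in k$ a primitive $m$-th root of unity, $Y$ a smooth projective (connected) curve over $k$, and $S\subset Y$ a finite set of closed points. Let $\mathbb Z[S]$ be the group of divisors supported in $S$, and let $$P_m=\frac{\{([L],D)\in \mathrm{Pic}(Y)\oplus\mathbb Z[S] : L^{\otimes m}\cong\mathcal O_Y(-D)\}}{\{([\mathcal O_Y(-F)],mF) : F\in\mathbb Z[S]\}}.$$ A representative of an element of $P_m$ is a triple consisting of an invertible sheaf $L$, a divisor $D\in\mathbb Z[S]$ and an isomorphism $\varphi: L^{\otimes m}\cong\mathcal O_Y(-D)$. For $0\le i<m$ put $L^{(i,D)}=L^{\otimes i}\otimes\mathcal O_Y([\tfrac im D])$, where $[\cdot]$ is the integral part, taken coefficientwise. The isomorphism $\varphi$ makes $\bigoplus_{i=0}^{m-1}L^{(i,D)}$ an $\mathcal O_Y$-algebra; let $V_{L,D,\varphi}=\mathbf{Spec}\big(\bigoplus_{i=0}^{m-1}L^{(i,D)}\big)\to Y$ be its relative spectrum, and let $h_\mu$ be the automorphism of $V_{L,D,\varphi}$ over $Y$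 given by multiplication by $\mu^i$ on the sections of $L^{(i,D)}$. For $\lambda\in P_m$ we write $V_\lambda$ for the cover given by a representative of $\lambda$; everything below holds for every choice of representatives. A cover of $Y$ is a finite, generically étale morphism $W\to Y$ from a smooth, possibly disconnected, curve; a $G$-Galois cover is a cover with a homomorphism $G\to\mathrm{Aut}(W/Y)$ through which $G$ acts simply transitively on the generic geometric fibres. Covers of $Y$ are mutually linearly disjoint if their fibre product over $Y$ is an integral scheme. A subset $B$ of an abelian group is of type T1 if the subgroups generated by any two disjoint subsets of $B$ intersect trivially. (i) Every element of $P_m$ has a representative in which $D$ has all its coefficients in $\{0,\dots,m-1\}$. For every representative, $V_{L,D,\varphi}\to Y$ is a $\mathbb Z/m\mathbb Z$-Galois cover, étale over $Y\setminus S$, in which $1\in\mathbb Z/m\mathbb Z$ acts by $h_\mu$; it is connected if and only if the class of $([L],D)$ in $P_m$ has order $m$. Two representatives have the same class in $P_m$ if and only if there is an isomorphism of their covers over $Y$ which commutes with the automorphisms $h_\mu$. Every connected $\mathbb Z/m\mathbb Z$-Galois cover $W\to Y$ which is étale over $Y\setminus S$ is isomorphic over $Y$ to $V_\lambda$ for some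 $\lambda\in P_m$ of order $m$, by an isomorphism that takes the action of $1\in\mathbb Z/m\mathbb Z$ to $h_\mu$. Now let $B\subset P_m$ be a finite subset all of whose elements have order $m$. (ii) $B$ is of type T1 if and only if the covers $V_\lambda\to Y$, $\lambda\in B$, are mutually linearly disjoint. Suppose that $B$ is of type T1, and let $W\to Y$ be the normalization of the (integral) fibre product over $Y$ of the covers $V_\lambda$, $\lambda\in B$, with its projections $p_\lambda:W\to V_\lambda$. (iii) For every $\zeta$ in the subgroup $\langle B\rangle$ generated by $B$, each connected component of $V_\zeta$ is dominated by $W$: it is the image of some $Y$-morphism $W\to V_\zeta$. (iv) There is a unique homomorphism $\rho:\langle B\rangle\to\mathrm{Aut}(W/Y)$ such that, for every $\lambda\in B$, $\rho(\lambda)$ extends the automorphism $h_\mu$ of $V_\lambda$ and acts trivially on the other factors: $p_\lambda\circ\rho(\lambda)=h_\mu\circ p_\lambda$ and $p_{\lambda'}\circ\rho(\lambda)=p_{\lambda'}$ for $\lambda'\in B$, $\lambda'\ne\lambda$. -/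

import Mathlib

open AlgebraicGeometry CategoryTheory Limits
universe u

namespace CyclicCovers

/-- The local rings at all points of codimension one are discrete valuation rings. -/
class RegularInCodimOne (X : Scheme.{u}) [AlgebraicGeometry.IsIntegral X] : Prop where
  isDVR_stalk : ∀ x : X, Order.coheight x = 1 → IsDiscreteValuationRing (X.presheaf.stalk x)

/-- Prime divisors, given by their generic points: the points of codimension one. On a curve these are
the closed points. -/
abbrev PrimeDivisor (X : Scheme.{u}) : Type u := {x : X // Order.coheight x = 1}

/-- Divisors: integral combinations of prime divisors. -/
abbrev Divisor (X : Scheme.{u}) : Type u := PrimeDivisor X →₀ ℤ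

theorem dvr_of_unramified {A B L : Type*} [CommRing A] [IsDomain A] [IsPrincipalIdealRing A]
    [CommRing B] [IsDomain B] [IsNoetherianRing B] [Algebra A B] [Algebra.FormallyUnramified A B]
    [Algebra.FiniteType A B] (q : Ideal B) [q.IsPrime] [CommRing L] [IsDomain L] [Algebra B L]
    [IsLocalization.AtPrime L q] (hL : ¬ IsField L) : IsDiscreteValuationRing L := by
  have : IsLocalRing L := IsLocalization.AtPrime.isLocalRing L q
  have : IsNoetherianRing L := IsLocalization.isNoetherianRing q.primeCompl L inferInstance
  let p := q.under A
  let e := IsLocalization.algEquiv q.primeCompl (Localization.AtPrime q) L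
  have hle : Submonoid.map (algebraMap A B) p.primeCompl ≤ q.primeCompl := by
    rintro _ ⟨a, ha, rfl⟩; exact ha
  let : Algebra A L := ((algebraMap B L).comp (algebraMap A B)).toAlgebra
  have : IsScalarTower A B L := .of_algebraMap_eq' rfl
  let : Algebra (Localization.AtPrime p) L :=
    (IsLocalization.lift (M := p.primeCompl) (S := Localization.AtPrime p)
      (g := algebraMap A L) (fun y => by
        rw [IsScalarTower.algebraMap_apply A B L]
        exact IsLocalization.map_units L (⟨_, hle ⟨_, y.2, rfl⟩⟩ : q.primeCompl))).toAlgebra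
  have : IsScalarTower A (Localization.AtPrime p) L := .of_algebraMap_eq' (by
    ext a; simp [RingHom.algebraMap_toAlgebra])
  have : Algebra.FormallyUnramified B L := .of_isLocalization q.primeCompl
  have : Algebra.FormallyUnramified A L := .comp A B L
  have : Algebra.FormallyUnramified (Localization.AtPrime p) L :=
    .of_restrictScalars A _ _
  have : Algebra.EssFiniteType B L := .of_isLocalization L q.primeCompl
  have : Algebra.EssFiniteType A L := .comp A B L
  have : Algebra.EssFiniteType (Localization.AtPrime p) L := .of_comp A _ _
  have : IsLocalHom (algebraMap (Localization.AtPrime p) L) := by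
    constructor
    intro a ha
    obtain ⟨a, s, rfl⟩ := IsLocalization.exists_mk'_eq p.primeCompl a
    rw [IsLocalization.AtPrime.isUnit_mk'_iff (Localization.AtPrime p) p]
    have h2 : IsUnit (algebraMap A L a) := by
      rw [IsScalarTower.algebraMap_apply A (Localization.AtPrime p) L,
        ← IsLocalization.mk'_spec' (Localization.AtPrime p) a s, map_mul]
      exact ((IsLocalization.map_units (Localization.AtPrime p) s).map _).mul ha
    rw [IsScalarTower.algebraMap_apply A B L,
      IsLocalization.AtPrime.isUnit_to_map_iff L q] at h2
    exact h2
  have hmax := Algebra.FormallyUnramified.map_maximalIdeal (R := Localization.AtPrime p) (S := L)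
  refine ((IsDiscreteValuationRing.TFAE L hL).out 4 0).mp ?_
  rw [← hmax, ← Localization.AtPrime.map_eq_maximalIdeal]
  infer_instance

open KaehlerDifferential in
theorem exists_unramified_polynomial {K B : Type*} [CommRing K] [CommRing B] [Algebra K B]
    [Algebra.IsStandardSmoothOfRelativeDimension 1 K B] :
    ∃ b : B, (let := (Polynomial.aeval (R := K) b).toRingHom.toAlgebra;
      Algebra.FormallyUnramified (Polynomial K) B) := by
  obtain ⟨ι, σ, _, _, P, hP⟩ :=
    ‹Algebra.IsStandardSmoothOfRelativeDimension 1 K B›.out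
  have hc : Nat.card ((Set.range P.map)ᶜ : Set ι) = 1 := by
    have h1 := Set.ncard_add_ncard_compl (Set.range P.map)
    have h2 : (Set.range P.map).ncard = Nat.card σ := by
      rw [← Nat.card_coe_set_eq, Nat.card_range_of_injective P.map_inj]
    rw [Algebra.Presentation.dimension] at hP
    rw [Nat.card_coe_set_eq]
    omega
  obtain ⟨hs, ⟨i0⟩⟩ := Nat.card_eq_one_iff_unique.mp hc
  refine ⟨P.val i0, ?_⟩
  let := (Polynomial.aeval (R := K) (P.val i0)).toRingHom.toAlgebra
  have : IsScalarTower K (Polynomial K) B := .of_algebraMap_eq' (by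
    ext a; simp [RingHom.algebraMap_toAlgebra])
  refine ⟨?_⟩
  have hsurj := KaehlerDifferential.map_surjective K (Polynomial K) B
  refine subsingleton_of_forall_eq 0 fun y => ?_
  obtain ⟨w, rfl⟩ := hsurj y
  have hz : KaehlerDifferential.map K (Polynomial K) B B = 0 := by
    refine P.basisKaehler.ext fun i => ?_
    obtain rfl : i0 = i := Subsingleton.elim _ _
    have : P.val i0 = algebraMap (Polynomial K) B Polynomial.X := by
      simp [RingHom.algebraMap_toAlgebra]
    simp [this]
  simp [hz]

theorem field_case {F B L : Type*} [CommRing F] (hF : IsField F) [CommRing B] [IsDomain B]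
    [Algebra F B] [Algebra.IsStandardSmoothOfRelativeDimension 1 F B]
    (q : Ideal B) [q.IsPrime] [CommRing L] [IsDomain L] [Algebra B L]
    [IsLocalization.AtPrime L q] (hL : ¬ IsField L) : IsDiscreteValuationRing L := by
  let := hF.toField
  obtain ⟨b, hb⟩ := exists_unramified_polynomial (K := F) (B := B)
  have : Algebra.IsStandardSmooth F B :=
    Algebra.IsStandardSmoothOfRelativeDimension.isStandardSmooth (n := 1)
  have : Algebra.FiniteType F B := inferInstance
  have : IsNoetherianRing B := Algebra.FiniteType.isNoetherianRing F B
  let := (Polynomial.aeval (R := F) b).toRingHom.toAlgebra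
  have : IsScalarTower F (Polynomial F) B := .of_algebraMap_eq' (by
    ext a; simp [RingHom.algebraMap_toAlgebra])
  have : Algebra.FiniteType (Polynomial F) B := .of_restrictScalars_finiteType F _ _
  exact dvr_of_unramified (A := Polynomial F) q hL

theorem isDVR_stalk {k : Type u} [Field k] {X : Scheme.{u}} [AlgebraicGeometry.IsIntegral X]
    (f : X ⟶ Spec (.of k)) [SmoothOfRelativeDimension 1 f] (x : X)
    (hx : Order.coheight x = 1) : IsDiscreteValuationRing (X.presheaf.stalk x) := by
  obtain ⟨U, hU, V, hV, hxV, e, h⟩ :=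
    SmoothOfRelativeDimension.exists_isStandardSmoothOfRelativeDimension (n := 1) (f := f) x
  have hUt : U = ⊤ := by
    ext y
    simp only [SetLike.mem_coe, TopologicalSpace.Opens.coe_top, Set.mem_univ, iff_true]
    rw [Subsingleton.elim y (f x)]
    exact e hxV
  subst hUt
  have hF : IsField Γ(Spec (.of k), ⊤) := 
    (Scheme.ΓSpecIso (.of k)).commRingCatIsoToRingEquiv.toMulEquiv.isField (Field.toIsField k)
  have : Nonempty V := ⟨⟨x, hxV⟩⟩
  let := (f.appLE ⊤ V e).hom.toAlgebra
  have : Algebra.IsStandardSmoothOfRelativeDimension 1 Γ(Spec (.of k), ⊤) Γ(X, V) := h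
  let := X.presheaf.algebra_section_stalk ⟨x, hxV⟩
  have := hV.isLocalization_stalk ⟨x, hxV⟩
  refine field_case hF (hV.primeIdealOf ⟨x, hxV⟩).asIdeal (L := X.presheaf.stalk x) fun h => ?_
  have h1 := ringKrullDim_stalk_eq_coheight x
  rw [ringKrullDim_eq_zero_of_isField h, hx] at h1
  simp at h1

section Order
variable {X : Scheme.{u}} [AlgebraicGeometry.IsIntegral X] 

theorem ord_inv [IsLocallyNoetherian X] {f : X.functionField} (hf : f ≠ 0) (x : X) :
    Scheme.ord f⁻¹ x = - Scheme.ord f x := by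
  have h := Scheme.ord_mul (x := x) hf (inv_ne_zero hf)
  have h1 : Scheme.ord (1 : X.functionField) x = 0 := by
    have := Scheme.ord_mul (x := x) (one_ne_zero (α := X.functionField)) one_ne_zero
    rw [mul_one] at this; omega
  rw [mul_inv_cancel₀ hf, h1] at h
  omega

theorem ord_one [IsLocallyNoetherian X] (x : X) : Scheme.ord (1 : X.functionField) x = 0 := by
  have := Scheme.ord_mul (x := x) (one_ne_zero (α := X.functionField)) one_ne_zero
  rw [mul_one] at this; omega

theorem ord_pow [IsLocallyNoetherian X] {f : X.functionField} (hf : f ≠ 0) (n : ℕ) (x : X) :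
    Scheme.ord (f ^ n) x = n * Scheme.ord f x := by
  induction n with
  | zero => simp [ord_one]
  | succ n ih => rw [pow_succ, Scheme.ord_mul (pow_ne_zero n hf) hf, ih]; push_cast; ring

theorem ord_neg [IsLocallyNoetherian X] (f : X.functionField) (x : X) :
    Scheme.ord (-f) x = Scheme.ord f x := by
  by_cases hf : f = 0
  · simp [hf]
  have h1 := Scheme.ord_mul (x := x) (neg_ne_zero.mpr hf) (neg_ne_zero.mpr hf)
  rw [neg_mul_neg, Scheme.ord_mul hf hf] at h1
  omega

theorem finite_ord_ne_zero [IsNoetherian X] (f : X.functionField) :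
    {x : PrimeDivisor X | Scheme.ord f x.1 ≠ 0}.Finite := by
  by_cases hf : f = 0
  · simp [hf]
  obtain ⟨U, hU, f', hne, rfl, hu⟩ := exists_isUnit_germ_eq X f hf
  let Z : Set X := (U : Set X)ᶜ
  have hZ : IsClosed Z := U.isOpen.isClosed_compl
  have hfin : (irreducibleComponents Z).Finite :=
    TopologicalSpace.NoetherianSpace.finite_irreducibleComponents
  refine Set.Finite.of_finite_image (f := fun x : PrimeDivisor X => closure {x.1})
    ((hfin.image (fun C : Set Z => closure (Subtype.val '' C))).subset ?_) ?_
  · rintro _ ⟨x, hx, rfl⟩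
    have hxZ : x.1 ∈ Z := fun h => hx (Scheme.ord_of_isUnit hu h)
    let C := irreducibleComponent (⟨x.1, hxZ⟩ : Z)
    refine ⟨C, irreducibleComponent_mem_irreducibleComponents _, ?_⟩
    have hirr : IsIrreducible (closure (Subtype.val '' C)) :=
      (isIrreducible_irreducibleComponent.image _ continuous_subtype_val.continuousOn).closure
    obtain ⟨η, hη⟩ := QuasiSober.sober hirr isClosed_closure
    have hηZ : η ∈ Z := by
      have h1 : η ∈ closure (Subtype.val '' C) := hη.mem
      exact hZ.closure_subset_iff.mpr (by rintro _ ⟨y, _, rfl⟩; exact y.2) h1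
    have hxη : η ⤳ x.1 := by
      rw [specializes_iff_mem_closure, hη.def]
      exact subset_closure ⟨_, mem_irreducibleComponent, rfl⟩
    have hle : x.1 ≤ η := hxη
    have hηtop : η ≠ ⊤ := by
      rintro rfl
      have := ((genericPoint_spec X).mem_open_set_iff U.isOpen).mpr (by simpa using hne)
      exact hηZ this
    have : x.1 = η := by
      by_contra hne
      have hlt : x.1 < η := lt_of_le_not_ge hle fun h => hne
        (Specializes.antisymm (show η ⤳ x.1 from hle) (show x.1 ⤳ η from h)).eq.symm
      have hlt2 : η < ⊤ := lt_of_le_not_ge le_top fun h => hηtop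
        (Specializes.antisymm (show η ⤳ ⊤ from h) (show ⊤ ⤳ η from le_top (a := η))).eq
      have h1 := Order.coheight_add_one_le hlt
      have h2 := Order.coheight_add_one_le hlt2
      rw [x.2] at h1
      have h3 : (1 : ℕ∞) ≤ Order.coheight η := le_trans (by simp) h2
      have := le_trans (add_le_add_left h3 1) h1
      norm_num at this
    simp only []
    rw [this, ← hη.def]
  · intro x _ y _ h
    exact Subtype.ext ((isGenericPoint_closure (x := x.1)).eq (by simpa [IsGenericPoint] using h.symm))

end Order

section Divisors
variable (Y : Scheme.{u}) [AlgebraicGeometry.IsIntegral Y] [IsNoetherian Y]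

/-- The group of principal divisors `div f`, for non-zero rational functions `f`. -/
noncomputable def principalDivisors : AddSubgroup (Divisor Y) where
  carrier := {E | ∃ f : Y.functionField, f ≠ 0 ∧ ∀ x : PrimeDivisor Y, E x = Scheme.ord f x.1}
  zero_mem' := ⟨1, one_ne_zero, fun x => by simp [ord_one]⟩
  add_mem' := by
    rintro E F ⟨f, hf, hE⟩ ⟨g, hg, hF⟩
    exact ⟨f * g, mul_ne_zero hf hg, fun x => by simp [Scheme.ord_mul hf hg, hE, hF]⟩
  neg_mem' := by
    rintro E ⟨f, hf, hE⟩
    exact ⟨f⁻¹, inv_ne_zero hf, fun x => by simp [ord_inv hf, hE]⟩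

/-- The Picard group of a smooth curve, as the group of divisors modulo principal divisors: the class
of `E` is the class of the invertible sheaf `𝒪(E)`. -/
abbrev Pic : Type u := Divisor Y ⧸ principalDivisors Y

variable {Y}

variable (m : ℕ) (S : Finset (PrimeDivisor Y))

/-- The group of the pairs `([L], D)` in `Pic Y ⊕ ℤ[S]` with `L ^ m ≅ 𝒪(-D)`. -/
noncomputable def markedPairs : AddSubgroup (Pic Y × Divisor Y) where
  carrier := {p | p.2.support ⊆ S ∧ m • p.1 = QuotientAddGroup.mk (-p.2)}
  zero_mem' := by simp
  add_mem' := by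
    classical
    rintro p q ⟨hp, hp'⟩ ⟨hq, hq'⟩
    refine ⟨Finsupp.support_add.trans (Finset.union_subset hp hq), ?_⟩
    simp only [Prod.fst_add, Prod.snd_add, nsmul_add, hp', hq', neg_add, QuotientAddGroup.mk_add]
  neg_mem' := by
    rintro p ⟨hp, hp'⟩
    refine ⟨by simpa using hp, ?_⟩
    simp [hp']

/-- The group of the pairs `([𝒪(-F)], m F)` with `F ∈ ℤ[S]`. -/
noncomputable def trivialPairs : AddSubgroup (Pic Y × Divisor Y) where
  carrier := {p | ∃ F : Divisor Y, F.support ⊆ S ∧ p = (QuotientAddGroup.mk (-F), m • F)}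
  zero_mem' := ⟨0, by simp, by simp; rfl⟩
  add_mem' := by
    classical
    rintro _ _ ⟨F, hF, rfl⟩ ⟨G, hG, rfl⟩
    refine ⟨F + G, Finsupp.support_add.trans (Finset.union_subset hF hG), ?_⟩
    simp only [Prod.mk_add_mk, smul_add, neg_add, QuotientAddGroup.mk_add]
  neg_mem' := by
    rintro _ ⟨F, hF, rfl⟩
    refine ⟨-F, by simpa using hF, ?_⟩
    simp

/-- The group `P_m(Y ∖ S)`: pairs `([L], D)` with `L ^ m ≅ 𝒪(-D)`, modulo the pairs
`([𝒪(-F)], m F)`. -/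
abbrev GenPic : Type u := markedPairs m S ⧸ (trivialPairs m S).addSubgroupOf (markedPairs m S)

/-- A representative of an element of `P_m(Y ∖ S)`: an invertible sheaf `L = 𝒪(E)`, a divisor `D`
supported in `S`, and an isomorphism `L ^ m ≅ 𝒪(-D)`. Such an isomorphism is the multiplication by a
non-zero rational function `f` with `div f = m E + D`. -/
structure KummerDatum where
  /-- the divisor of the invertible sheaf `L = 𝒪(E)` -/
  E : Divisor Y
  /-- the divisor `D` -/
  D : Divisor Y
  support_subset : D.support ⊆ S
  /-- the isomorphism `L ^ m ≅ 𝒪(-D)` -/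
  f : Y.functionField
  f_ne_zero : f ≠ 0
  ord_f : ∀ x : PrimeDivisor Y, Scheme.ord f x.1 = m * E x + D x

variable {m S}

/-- The class of `([L], D)` in `P_m(Y ∖ S)`. -/
noncomputable def KummerDatum.toGenPic (d : KummerDatum m S) : GenPic m S :=
  QuotientAddGroup.mk ⟨(QuotientAddGroup.mk d.E, d.D), d.support_subset, by
    rw [← QuotientAddGroup.mk_nsmul, QuotientAddGroup.eq]
    refine ⟨d.f⁻¹, inv_ne_zero d.f_ne_zero, fun x => ?_⟩
    rw [ord_inv d.f_ne_zero, d.ord_f]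
    simp; ring⟩

end Divisors

section Algebra
open Polynomial
variable {Y : Scheme.{u}} [AlgebraicGeometry.IsIntegral Y] [IsNoetherian Y]

/-- The rational function `c` is a section of `𝒪(E)` at `x`. -/
def IsSectionAt (E : Divisor Y) (x : PrimeDivisor Y) (c : Y.functionField) : Prop :=
  c = 0 ∨ - E x ≤ Scheme.ord c x.1

theorem IsSectionAt.mul {E F G : Divisor Y} {x : PrimeDivisor Y} {c c' : Y.functionField}
    (h : IsSectionAt E x c) (h' : IsSectionAt F x c') (hG : E x + F x ≤ G x) :
    IsSectionAt G x (c * c') := by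
  by_cases hc : c = 0
  · simp [IsSectionAt, hc]
  by_cases hc' : c' = 0
  · simp [IsSectionAt, hc']
  refine .inr ?_
  rw [Scheme.ord_mul hc hc']
  have := h.resolve_left hc
  have := h'.resolve_left hc'
  omega

theorem IsSectionAt.neg {E : Divisor Y} {x : PrimeDivisor Y}
    {c : Y.functionField} (h : IsSectionAt E x c) : IsSectionAt E x (-c) := by
  rcases h with rfl | h
  · exact .inl neg_zero
  · exact .inr (by rwa [ord_neg])

theorem IsSectionAt.add [RegularInCodimOne Y] {E : Divisor Y} {x : PrimeDivisor Y} {c c' : Y.functionField}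
    (h : IsSectionAt E x c) (h' : IsSectionAt E x c') : IsSectionAt E x (c + c') := by
  by_cases h0 : c + c' = 0
  · exact .inl h0
  rcases h with rfl | h
  · simpa using h'
  rcases h' with rfl | h'
  · rw [add_zero]; exact .inr h
  have := RegularInCodimOne.isDVR_stalk x.1 x.2
  exact .inr ((le_min h h').trans (Scheme.ord_add h0))

variable {m : ℕ} {S : Finset (PrimeDivisor Y)}

namespace KummerDatum
variable (d : KummerDatum m S)

/-- The divisor of the invertible sheaf `L^{(i,D)} = L ^ i ⊗ 𝒪([(i / m) D])`. -/
noncomputable def twist (i : ℕ) : Divisor Y :=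
  (i : ℤ) • d.E + d.D.mapRange (fun a : ℤ => ⌊(i * a : ℚ) / m⌋) (by simp)

theorem twist_apply (i : ℕ) (x : PrimeDivisor Y) :
    d.twist i x = i * d.E x + ⌊(i * d.D x : ℚ) / m⌋ := by simp [twist]

theorem twist_add_le (i j : ℕ) (x : PrimeDivisor Y) :
    d.twist i x + d.twist j x ≤ d.twist (i + j) x := by
  simp only [twist_apply]
  have : ⌊(i * d.D x : ℚ) / m⌋ + ⌊(j * d.D x : ℚ) / m⌋ ≤ ⌊(((i + j : ℕ) : ℚ) * d.D x : ℚ) / m⌋ := by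
    convert Int.le_floor_add ((i * d.D x : ℚ) / m) ((j * d.D x : ℚ) / m) using 2
    push_cast; ring
  push_cast at this ⊢
  linarith

theorem twist_add_mul [NeZero m] (i q : ℕ) (x : PrimeDivisor Y) :
    d.twist (i + q * m) x = d.twist i x + q * Scheme.ord d.f x.1 := by
  simp only [twist_apply, d.ord_f]
  have : ⌊(((i + q * m : ℕ) : ℚ) * d.D x : ℚ) / m⌋ = ⌊(i * d.D x : ℚ) / m⌋ + q * d.D x := by
    rw [← Int.floor_add_intCast]
    congr 1
    have : (m : ℚ) ≠ 0 := by exact_mod_cast NeZero.ne m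
    push_cast; field_simp
  rw [this]; push_cast; ring

/-- The generic fibre `K[z] / (z ^ m - f)` of the algebra `⊕ L^{(i,D)}`. Sections of `L^{(i,D)}` are
embedded in it as `c z ^ i`, for a section `c` of `𝒪(i E + [(i / m) D])`, so that the product of
sections of index `i` and `j` is their tensor product, followed by the isomorphism
`L ^ m ≅ 𝒪(-D)` when `i + j ≥ m`. -/
abbrev Alg : Type u := AdjoinRoot (X ^ m - C d.f : Polynomial Y.functionField)

variable [NeZero m]

theorem monic : (X ^ m - C d.f : Polynomial Y.functionField).Monic :=
  monic_X_pow_sub_C _ (NeZero.ne m)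

/-- The coefficient of `z ^ i` in the basis `1, z, …, z ^ (m - 1)`. -/
noncomputable def coeff (i : ℕ) : d.Alg →ₗ[Y.functionField] Y.functionField :=
  (Polynomial.lcoeff _ i).comp (AdjoinRoot.modByMonicHom d.monic)


theorem root_pow_m : AdjoinRoot.root (X ^ m - C d.f : Polynomial Y.functionField) ^ m =
    algebraMap Y.functionField d.Alg d.f := by
  have := AdjoinRoot.eval₂_root (X ^ m - C d.f : Polynomial Y.functionField)
  rw [eval₂_sub, eval₂_X_pow, eval₂_C, sub_eq_zero] at this
  exact this

theorem coeff_root_pow {r : ℕ} (hr : r < m) (j : ℕ) :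
    d.coeff j (AdjoinRoot.root _ ^ r) = if j = r then 1 else 0 := by
  have h : AdjoinRoot.root (X ^ m - C d.f : Polynomial Y.functionField) ^ r =
      AdjoinRoot.mk _ (X ^ r) := by simp
  have hd : (X ^ m - C d.f : Polynomial Y.functionField).degree = m :=
    degree_X_pow_sub_C (Nat.pos_of_ne_zero (NeZero.ne m)) _
  rw [coeff, LinearMap.comp_apply, h, AdjoinRoot.modByMonicHom_mk,
    (modByMonic_eq_self_iff d.monic).mpr (by rw [hd, degree_X_pow]; exact_mod_cast hr),
    lcoeff_apply, coeff_X_pow]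

theorem eq_sum_coeff (s : d.Alg) :
    s = ∑ i ∈ Finset.range m, d.coeff i s • AdjoinRoot.root _ ^ i := by
  have hd : (X ^ m - C d.f : Polynomial Y.functionField).degree = m :=
    degree_X_pow_sub_C (Nat.pos_of_ne_zero (NeZero.ne m)) _
  obtain ⟨p, rfl⟩ := AdjoinRoot.mk_surjective s
  have h1 : p %ₘ (X ^ m - C d.f) = ∑ i ∈ Finset.range m, C ((p %ₘ (X ^ m - C d.f)).coeff i) * X ^ i := by
    refine as_sum_range_C_mul_X_pow' _ ?_
    refine (natDegree_modByMonic_lt _ d.monic fun h => ?_).trans_eq (natDegree_X_pow_sub_C)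
    rw [h, degree_one] at hd
    exact NeZero.ne m (by exact_mod_cast hd.symm)
  have h2 := congrArg (AdjoinRoot.mk (X ^ m - C d.f)) h1
  rw [← AdjoinRoot.modByMonicHom_mk d.monic, AdjoinRoot.mk_leftInverse d.monic] at h2
  refine h2.trans ?_
  rw [map_sum]
  refine Finset.sum_congr rfl fun i _ => ?_
  rw [map_mul, map_pow, AdjoinRoot.mk_X, AdjoinRoot.mk_C, Algebra.smul_def]
  rfl

variable [RegularInCodimOne Y]

/-- The elements `∑ c_i z ^ i` (`0 ≤ i < m`) such that each `c_i` is a section of `L^{(i,D)}` at `x`. -/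
noncomputable def localSections (x : PrimeDivisor Y) : AddSubgroup d.Alg where
  carrier := {s | ∀ i < m, IsSectionAt (d.twist i) x (d.coeff i s)}
  zero_mem' i _ := .inl (map_zero _)
  add_mem' {s t} hs ht i hi := by rw [map_add]; exact (hs i hi).add (ht i hi)
  neg_mem' {s} hs i hi := by rw [map_neg]; exact (hs i hi).neg

theorem smul_root_pow_mem {x : PrimeDivisor Y} {i : ℕ} {c : Y.functionField}
    (h : IsSectionAt (d.twist i) x c) :
    (c • AdjoinRoot.root _ ^ i : d.Alg) ∈ d.localSections x := by
  rcases h with rfl | h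
  · rw [zero_smul]; exact zero_mem _
  by_cases hc : c = 0
  · rw [hc, zero_smul]; exact zero_mem _
  intro j hj
  obtain ⟨q, r, hr, rfl⟩ : ∃ q r, r < m ∧ i = r + q * m :=
    ⟨i / m, i % m, Nat.mod_lt _ (Nat.pos_of_ne_zero (NeZero.ne m)), (Nat.mod_add_div' i m).symm⟩
  have : (c • AdjoinRoot.root _ ^ (r + q * m) : d.Alg) = (c * d.f ^ q) • AdjoinRoot.root _ ^ r := by
    rw [pow_add, mul_comm q m, pow_mul, d.root_pow_m, ← map_pow, mul_comm (_ ^ r), mul_smul,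
      Algebra.smul_def (d.f ^ q)]
  rw [this, map_smul, d.coeff_root_pow hr]
  split_ifs with hjr
  · subst hjr
    refine .inr ?_
    rw [smul_eq_mul, mul_one, Scheme.ord_mul hc (pow_ne_zero _ d.f_ne_zero),
      ord_pow d.f_ne_zero]
    have := d.twist_add_mul j q x
    omega
  · simp [IsSectionAt]

/-- The same as a ring: the `𝒪_{Y, x}`-algebra `⊕ L^{(i,D)}_x`, for `0 ≤ i < m`. -/
noncomputable def localSubring (x : PrimeDivisor Y) : Subring d.Alg where
  __ := d.localSections x
  one_mem' := by
    have := d.smul_root_pow_mem (x := x) (i := 0) (c := 1) (.inr (by simp [ord_one, twist_apply]))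
    simpa using this
  mul_mem' {s t} hs ht := by
    rw [d.eq_sum_coeff s, d.eq_sum_coeff t, Finset.sum_mul_sum]
    refine (d.localSections x).sum_mem fun i hi => (d.localSections x).sum_mem fun j hj => ?_
    rw [smul_mul_smul_comm, ← pow_add]
    exact d.smul_root_pow_mem ((hs i (by simpa using hi)).mul (ht j (by simpa using hj))
      (d.twist_add_le i j x))


/-- The sections of the sheaf `⊕ L^{(i,D)}` over `U`, for `0 ≤ i < m`: they are the elements of the generic fibre all
of whose coefficients are sections of `L^{(i,D)}` at all points of `U`. An element of the generic
fibre is seen as a constant function on `U`, so that there is only one section over `∅`. -/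
noncomputable def sections (U : Y.Opens) : Subring (U → d.Alg) where
  carrier := {s | (∀ x y, s x = s y) ∧
    ∀ (x : PrimeDivisor Y) (hx : x.1 ∈ U), s ⟨x.1, hx⟩ ∈ d.localSubring x}
  zero_mem' := ⟨fun _ _ => rfl, fun x _ => zero_mem _⟩
  one_mem' := ⟨fun _ _ => rfl, fun x _ => one_mem _⟩
  add_mem' hs ht := ⟨fun x y => by simp [hs.1 x y, ht.1 x y],
    fun x hx => add_mem (hs.2 x hx) (ht.2 x hx)⟩
  mul_mem' hs ht := ⟨fun x y => by simp [hs.1 x y, ht.1 x y],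
    fun x hx => mul_mem (hs.2 x hx) (ht.2 x hx)⟩
  neg_mem' hs := ⟨fun x y => by simp [hs.1 x y], fun x hx => neg_mem (hs.2 x hx)⟩

/-- The restriction of sections. -/
noncomputable def restrict {U V : Y.Opens} (h : V ≤ U) : d.sections U →+* d.sections V where
  toFun s := ⟨fun x => s.1 ⟨x.1, h x.2⟩, fun _ _ => s.2.1 _ _, fun x hx => s.2.2 x (h hx)⟩
  map_one' := rfl
  map_mul' _ _ := rfl
  map_zero' := rfl
  map_add' _ _ := rfl

theorem ord_germ_nonneg {U : Y.Opens} (x : PrimeDivisor Y) (hx : x.1 ∈ U) [Nonempty U]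
    (g : Γ(Y, U)) : IsSectionAt 0 x (Y.germToFunctionField U g) := by
  by_cases hg : g = 0
  · simp [IsSectionAt, hg]
  refine .inr ?_
  have := Scheme.ord_le_smul hx hg 1
  rw [ord_one, Algebra.smul_def, mul_one] at this
  simpa using! this

theorem algebraMap_mem {x : PrimeDivisor Y} {c : Y.functionField} (h : IsSectionAt 0 x c) :
    algebraMap Y.functionField d.Alg c ∈ d.localSubring x := by
  have := d.smul_root_pow_mem (x := x) (i := 0) (c := c) (by simpa [IsSectionAt, twist_apply] using h)
  rwa [pow_zero, ← Algebra.algebraMap_eq_smul_one] at this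

/-- The structure of an `𝒪_Y`-algebra on `⊕ L^{(i,D)}`. -/
noncomputable def structureMap (U : Y.Opens) : Γ(Y, U) →+* d.sections U :=
  RingHom.codRestrict (RingHom.pi fun x : U =>
    haveI : Nonempty U := ⟨x⟩
    (algebraMap Y.functionField d.Alg).comp (Y.germToFunctionField U).hom) _
  fun g => ⟨fun _ _ => rfl, fun x hx =>
    haveI : Nonempty U := ⟨⟨x.1, hx⟩⟩
    d.algebraMap_mem (ord_germ_nonneg x hx g)⟩

theorem structureMap_restrict {U V : Y.Opens} (h : V ≤ U) (g : Γ(Y, U)) :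
    d.restrict h (d.structureMap U g) = d.structureMap V (Y.presheaf.map (homOfLE h).op g) := by
  refine Subtype.ext (funext fun x => ?_)
  have : Nonempty V := ⟨x⟩
  have : Nonempty U := ⟨⟨x.1, h x.2⟩⟩
  change algebraMap _ _ (Y.germToFunctionField U g) =
    algebraMap _ _ (Y.germToFunctionField V (Y.presheaf.map (homOfLE h).op g))
  congr 1
  exact (Y.presheaf.germ_res_apply (homOfLE h) _ _ g).symm

open Scheme.AffineZariskiSite in
/-- The algebra `⊕ L^{(i,D)}` on the affine open subschemes. -/
noncomputable def presheaf : Y.AffineZariskiSiteᵒᵖ ⥤ CommRingCat.{u} where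
  obj U := .of (d.sections U.unop.1)
  map i := CommRingCat.ofHom (d.restrict (toOpens_mono i.unop.le))
  map_id _ := rfl
  map_comp _ _ := rfl

open Scheme.AffineZariskiSite in
/-- The structure of an `𝒪_Y`-algebra on `⊕ L^{(i,D)}`. -/
noncomputable def structureTrans : (toOpensFunctor Y).op ⋙ Y.presheaf ⟶ d.presheaf where
  app U := CommRingCat.ofHom (d.structureMap U.unop.1)
  naturality U V i := by
    ext g
    exact (d.structureMap_restrict (toOpens_mono i.unop.le) g).symm

theorem one_le_ord {U : Y.Opens} (g : Γ(Y, U)) (x : PrimeDivisor Y) (hx : x.1 ∈ U) [Nonempty U]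
    (hg : g ≠ 0) (hxg : x.1 ∉ Y.basicOpen g) : 1 ≤ Scheme.ord (Y.germToFunctionField U g) x.1 := by
  have hdvr := RegularInCodimOne.isDVR_stalk x.1 x.2
  have hg' : Y.germToFunctionField U g ≠ 0 := by
    simpa [map_ne_zero_iff, Scheme.germToFunctionField_injective] using hg
  have h0 : 0 ≤ Scheme.ord (Y.germToFunctionField U g) x.1 := by
    simpa using (ord_germ_nonneg x hx g).resolve_left hg'
  have h1 : Scheme.ord (Y.germToFunctionField U g) x.1 ≠ 0 := by
    intro h
    rw [Scheme.ord_eq_iff x.2 hg'] at h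
    rw [Scheme.mem_basicOpen Y g x.1 hx] at hxg
    apply hxg
    rw [Ring.isUnit_iff_ordFrac_one_of_isDiscreteValuationRing (K := Y.functionField),
      Scheme.algebraMap_germ_eq_germToFunctionField]
    exact h
  omega

theorem exists_pow_smul_mem (U : Y.Opens) (g : Γ(Y, U)) [Nonempty (Y.basicOpen g)] (v : d.Alg)
    (hv : ∀ x : PrimeDivisor Y, x.1 ∈ Y.basicOpen g → v ∈ d.localSubring x) :
    ∃ n : ℕ, ∀ (x : PrimeDivisor Y) (hx : x.1 ∈ U), haveI : Nonempty U := ⟨⟨x.1, hx⟩⟩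
      algebraMap _ d.Alg (Y.germToFunctionField U g) ^ n * v ∈ d.localSubring x := by
  have hgne : g ≠ 0 := by
    rintro rfl
    obtain ⟨y⟩ := ‹Nonempty (Y.basicOpen (0 : Γ(Y, U)))›
    exact (Scheme.basicOpen_zero Y U).le y.2
  have hfin : (⋃ i ∈ Finset.range m, ({x : PrimeDivisor Y | Scheme.ord (d.coeff i v) x.1 ≠ 0} ∪
      (d.twist i).support)).Finite :=
    Set.Finite.biUnion (Finset.finite_toSet _) fun i _ =>
      (finite_ord_ne_zero _).union (Finset.finite_toSet _)
  obtain ⟨N, hN⟩ : ∃ N : ℕ, ∀ i < m, ∀ x : PrimeDivisor Y,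
      -(N : ℤ) ≤ Scheme.ord (d.coeff i v) x.1 + d.twist i x := by
    have hb : ∀ i, ∃ N : ℕ, ∀ x : PrimeDivisor Y,
        -(N : ℤ) ≤ Scheme.ord (d.coeff i v) x.1 + d.twist i x := by
      intro i
      have hf := (finite_ord_ne_zero (d.coeff i v)).union (Finset.finite_toSet (d.twist i).support)
      obtain ⟨N, hN⟩ := (hf.image fun x =>
        (Scheme.ord (d.coeff i v) x.1 + d.twist i x).natAbs).bddAbove
      refine ⟨N, fun x => ?_⟩
      by_cases hx : x ∈ {x : PrimeDivisor Y | Scheme.ord (d.coeff i v) x.1 ≠ 0} ∪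
          ((d.twist i).support : Set (PrimeDivisor Y))
      · have := hN ⟨x, hx, rfl⟩
        simp only at this
        omega
      · simp only [Set.mem_union, Set.mem_ofPred_eq, Finset.mem_coe, Finsupp.mem_support_iff,
          not_or, not_not] at hx
        rw [hx.1, hx.2]; omega
    choose N hN using hb
    refine ⟨(Finset.range m).sup N, fun i hi x => ?_⟩
    have h1 := hN i x
    have h2 : N i ≤ (Finset.range m).sup N := Finset.le_sup (by simpa using hi)
    omega
  refine ⟨N, fun x hx => ?_⟩
  have : Nonempty U := ⟨⟨x.1, hx⟩⟩
  by_cases hxg : x.1 ∈ Y.basicOpen g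
  · exact mul_mem (pow_mem (d.algebraMap_mem (ord_germ_nonneg x hx g)) _) (hv x hxg)
  · intro i hi
    have h0 : Y.germToFunctionField U g ≠ 0 := by
      simpa [map_ne_zero_iff, Scheme.germToFunctionField_injective] using hgne
    have h1 := one_le_ord g x hx hgne hxg
    rw [← map_pow, ← Algebra.smul_def, map_smul, smul_eq_mul]
    by_cases hc : d.coeff i v = 0
    · simp [IsSectionAt, hc]
    refine .inr ?_
    rw [Scheme.ord_mul (pow_ne_zero _ h0) hc, ord_pow h0]
    have h2 := hN i hi x
    nlinarith

theorem isLocalization (U : Y.Opens) (g : Γ(Y, U)) :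
    letI := (d.restrict (Y.basicOpen_le g)).toAlgebra
    IsLocalization.Away (d.structureMap U g) (d.sections (Y.basicOpen g)) := by
  let := (d.restrict (Y.basicOpen_le g)).toAlgebra
  have hmap (s : d.sections U) : algebraMap (d.sections U) (d.sections (Y.basicOpen g)) s =
    d.restrict (Y.basicOpen_le g) s := rfl
  have hunit : IsUnit (algebraMap (d.sections U) (d.sections (Y.basicOpen g))
      (d.structureMap U g)) := by
    rw [hmap, structureMap_restrict]
    exact (Y.toRingedSpace.isUnit_res_basicOpen g).map (d.structureMap _)
  rcases isEmpty_or_nonempty (Y.basicOpen g) with hE | hne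
  · have hg : g = 0 := by
      rw [← basicOpen_eq_bot_iff]
      ext y
      exact ⟨fun hy => (hE.false ⟨y, hy⟩).elim, fun hy => hy.elim⟩
    have : Subsingleton (d.sections (Y.basicOpen g)) :=
      ⟨fun a b => Subtype.ext (funext fun y => (hE.false y).elim)⟩
    refine ⟨?_, ?_, ?_⟩
    · rintro ⟨_, n, rfl⟩
      rw [map_pow]; exact hunit.pow n
    · intro z
      exact ⟨(0, 1), Subsingleton.elim _ _⟩
    · intro a b _
      exact ⟨⟨_, 1, rfl⟩, by simp [hg]⟩
  · refine ⟨?_, ?_, ?_⟩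
    · rintro ⟨_, n, rfl⟩
      rw [map_pow]; exact hunit.pow n
    · intro t
      obtain ⟨y0⟩ := id hne
      obtain ⟨n, hn⟩ := d.exists_pow_smul_mem U g (t.1 y0) fun x hx => by
        rw [t.2.1 y0 ⟨x.1, hx⟩]; exact t.2.2 x hx
      have : Nonempty U := ⟨⟨y0.1, Y.basicOpen_le g y0.2⟩⟩
      refine ⟨(⟨fun _ => algebraMap _ d.Alg (Y.germToFunctionField U g) ^ n * t.1 y0,
        fun _ _ => rfl, fun x hx => hn x hx⟩, ⟨_, n, rfl⟩), ?_⟩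
      refine Subtype.ext (funext fun y => ?_)
      change t.1 y * _ = _ * t.1 y0
      rw [t.2.1 y y0, mul_comm]
      rfl
    · intro a b h
      refine ⟨1, ?_⟩
      obtain ⟨y0⟩ := id hne
      have h1 := congrFun (congrArg Subtype.val h) y0
      have : a = b := Subtype.ext (funext fun y => by
        rw [a.2.1 y ⟨y0.1, Y.basicOpen_le g y0.2⟩, b.2.1 y ⟨y0.1, Y.basicOpen_le g y0.2⟩]
        exact h1)
      rw [this]

open Scheme.AffineZariskiSite in
/-- The algebra `⊕ L^{(i,D)}` is quasi-coherent. -/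
theorem coequifibered : d.structureTrans.Coequifibered :=
  coequifibered_iff_forall_isLocalizationAway.mpr fun U g => d.isLocalization U.1 g

open Scheme.AffineZariskiSite in
/-- The gluing datum of the relative spectrum of `⊕ L^{(i,D)}`. -/
noncomputable def glueData : (directedCover Y).RelativeGluingData :=
  relativeGluingData d.coequifibered

instance : (d.glueData.functor ⋙ Scheme.forget).IsLocallyDirected :=
  Scheme.Cover.RelativeGluingData.instIsLocallyDirectedI₀CompFunctorForgetOfIsThin ..

/-- The cyclic cover `Spec (⊕ L^{(i,D)}) ⟶ Y`: the relative spectrum, glued from the spectra of the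
sections of `⊕ L^{(i,D)}` over the affine open subschemes of `Y`. -/
noncomputable def cover : Over Y := Over.mk d.glueData.toBase


section Action

variable (ζ : Y.functionField) (hζ : ζ ^ m = 1)

/-- The automorphism `z ↦ ζ z` of the generic fibre, for an `m`-th root of unity `ζ`. -/
noncomputable def scale : d.Alg →+* d.Alg :=
  AdjoinRoot.lift (algebraMap Y.functionField d.Alg) (ζ • AdjoinRoot.root _) (by
    rw [eval₂_sub, eval₂_X_pow, eval₂_C, _root_.smul_pow, hζ, one_smul, d.root_pow_m, sub_self])

theorem scale_smul_root_pow (c : Y.functionField) (i : ℕ) :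
    d.scale ζ hζ (c • AdjoinRoot.root _ ^ i) = (ζ ^ i * c) • AdjoinRoot.root _ ^ i := by
  have h1 : d.scale ζ hζ (AdjoinRoot.root _) = ζ • AdjoinRoot.root _ := AdjoinRoot.lift_root _
  have h2 : d.scale ζ hζ (algebraMap Y.functionField d.Alg c) = algebraMap Y.functionField d.Alg c :=
    AdjoinRoot.lift_of _
  rw [Algebra.smul_def, map_mul, map_pow, h1, h2, _root_.smul_pow, ← Algebra.smul_def, smul_smul, mul_comm]

/-- It is the multiplication by `ζ ^ i` on the summand of index `i`. -/
theorem coeff_scale (s : d.Alg) {i : ℕ} (hi : i < m) :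
    d.coeff i (d.scale ζ hζ s) = ζ ^ i * d.coeff i s := by
  conv_lhs => rw [d.eq_sum_coeff s]
  simp only [map_sum, scale_smul_root_pow]
  rw [Finset.sum_eq_single_of_mem i (by simpa using hi) fun j hj hji => by
    rw [map_smul, d.coeff_root_pow (by simpa using hj), if_neg hji.symm, smul_zero]]
  rw [map_smul, d.coeff_root_pow hi, if_pos rfl, smul_eq_mul, mul_one]

theorem scale_mem {x : PrimeDivisor Y} {s : d.Alg} (hs : s ∈ d.localSubring x) :
    d.scale ζ hζ s ∈ d.localSubring x := by
  intro i hi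
  rw [d.coeff_scale ζ hζ s hi]
  refine IsSectionAt.mul (E := 0) (F := d.twist i) ?_ (hs i hi) (by simp)
  have h0 : ζ ≠ 0 := by
    rintro rfl
    rw [zero_pow (NeZero.ne m)] at hζ
    exact zero_ne_one hζ
  have h1 := ord_pow h0 m x.1
  rw [hζ, ord_one] at h1
  have h2 : Scheme.ord ζ x.1 = 0 := by
    rcases mul_eq_zero.mp h1.symm with h | h
    · exact absurd (by exact_mod_cast h) (NeZero.ne m)
    · exact h
  exact .inr (by rw [ord_pow h0, h2]; simp)

/-- The multiplication by `ζ ^ i` on the sections of `L^{(i,D)}`. -/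
noncomputable def scaleSections (U : Y.Opens) : d.sections U →+* d.sections U where
  toFun s := ⟨fun x => d.scale ζ hζ (s.1 x), fun x y => congrArg _ (s.2.1 x y),
    fun x hx => d.scale_mem ζ hζ (s.2.2 x hx)⟩
  map_one' := Subtype.ext (funext fun _ => map_one _)
  map_mul' _ _ := Subtype.ext (funext fun _ => map_mul _ _ _)
  map_zero' := Subtype.ext (funext fun _ => map_zero _)
  map_add' _ _ := Subtype.ext (funext fun _ => map_add _ _ _)

/-- The multiplication by `ζ ^ i` on the sections of `L^{(i,D)}`. -/
noncomputable def scalePresheaf : d.presheaf ⟶ d.presheaf where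
  app U := CommRingCat.ofHom (d.scaleSections ζ hζ U.unop.1)
  naturality _ _ _ := rfl

theorem structureTrans_scalePresheaf :
    d.structureTrans ≫ d.scalePresheaf ζ hζ = d.structureTrans := by
  ext U g
  refine Subtype.ext (funext fun x => ?_)
  exact AdjoinRoot.lift_of _

/-- The automorphism of the gluing datum given by multiplication by `ζ ^ i` on `L^{(i,D)}`. -/
noncomputable def scaleGlueData : d.glueData.functor ⟶ d.glueData.functor :=
  Functor.whiskerRight (NatTrans.rightOp (d.scalePresheaf ζ hζ)) Scheme.Spec

theorem scaleGlueData_natTrans :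
    d.scaleGlueData ζ hζ ≫ d.glueData.natTrans = d.glueData.natTrans := by
  have h : d.scaleGlueData ζ hζ ≫ Functor.whiskerRight d.structureTrans.rightOp Scheme.Spec =
      Functor.whiskerRight d.structureTrans.rightOp Scheme.Spec :=
    NatTrans.ext (funext fun U => by
      change Spec.map ((d.scalePresheaf ζ hζ).app (Opposite.op U)) ≫
        Spec.map (d.structureTrans.app (Opposite.op U)) =
        Spec.map (d.structureTrans.app (Opposite.op U))
      rw [← Spec.map_comp, ← NatTrans.comp_app, structureTrans_scalePresheaf])
  exact (Category.assoc _ _ _).symm.trans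
    (congrArg (fun t => t ≫ (Scheme.AffineZariskiSite.restrictIsoSpec Y).inv) h)

/-- The automorphism of the cover given by multiplication by `ζ ^ i` on `L^{(i,D)}`. -/
noncomputable def rotation : d.cover ⟶ d.cover :=
  Over.homMk (colimMap (d.scaleGlueData ζ hζ)) (by
    refine colimit.hom_ext fun U => ?_
    have h := congrArg (fun t => t.app U) (d.scaleGlueData_natTrans ζ hζ)
    change colimit.ι d.glueData.functor U ≫ colimMap (d.scaleGlueData ζ hζ) ≫ d.glueData.toBase =
      colimit.ι d.glueData.functor U ≫ d.glueData.toBase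
    rw [ι_colimMap_assoc, Scheme.Cover.RelativeGluingData.ι_toBase]
    exact (Category.assoc _ _ _).symm.trans
      (congrArg (fun t => t ≫ (Scheme.AffineZariskiSite.directedCover Y).f U) h))

end Action

end KummerDatum
end Algebra


section Curves

/-- A smooth projective (connected) curve over a field `k`: an integral scheme, proper and smooth of
relative dimension one over `k`. (A proper curve over a field is projective.) -/
structure SmoothProjectiveCurve (k : Type u) [Field k] where
  /-- the underlying scheme -/
  scheme : Scheme.{u}
  /-- the structure morphism -/
  str : scheme ⟶ Spec (.of k)
  isIntegral : AlgebraicGeometry.IsIntegral scheme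
  isProper : IsProper str
  smooth : SmoothOfRelativeDimension 1 str

namespace SmoothProjectiveCurve
variable {k : Type u} [Field k] (C : SmoothProjectiveCurve k)

instance : AlgebraicGeometry.IsIntegral C.scheme := C.isIntegral
instance : IsProper C.str := C.isProper
instance : SmoothOfRelativeDimension 1 C.str := C.smooth

instance : IsNoetherian C.scheme where
  __ := LocallyOfFiniteType.isLocallyNoetherian C.str
  __ := QuasiCompact.compactSpace_of_compactSpace C.str

instance : RegularInCodimOne C.scheme := ⟨isDVR_stalk C.str⟩

/-- The inclusion of the constants in the function field. -/
noncomputable def const : k →+* C.scheme.functionField :=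
  (C.scheme.presheaf.germ ⊤ (genericPoint C.scheme) trivial).hom.comp
    ((C.str.appTop).hom.comp (Scheme.ΓSpecIso (.of k)).inv.hom)

/-- A cover of the curve: a finite, generically smooth (that is, generically étale)
morphism from a smooth, possibly disconnected, curve. -/
structure IsCover (W : Over C.scheme) : Prop where
  finite : IsFinite W.hom
  smooth : SmoothOfRelativeDimension 1 (W.hom ≫ C.str)
  generically_etale : ∃ U : C.scheme.Opens, (U : Set C.scheme).Nonempty ∧ Etale (W.hom ∣_ U)

/-- A `G`-Galois cover: a cover `W` with a homomorphism `G → Aut (W / Y)` through which `G` acts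
simply transitively on all generic geometric fibres. -/
structure IsGaloisCover {G : Type*} [Group G] (W : Over C.scheme) (ρ : G →* Aut W) : Prop where
  isCover : C.IsCover W
  simply_transitive : ∀ (Ω : Type u) [Field Ω] [IsAlgClosed Ω] (y : Spec (.of Ω) ⟶ C.scheme),
    (∀ t, y t = genericPoint C.scheme) →
      (∃ w : Spec (.of Ω) ⟶ W.left, w ≫ W.hom = y) ∧
      ∀ w w' : Spec (.of Ω) ⟶ W.left, w ≫ W.hom = y → w' ≫ W.hom = y →
        ∃! g : G, w ≫ (ρ g).hom.left = w'

/-- `W` is étale over the complement of `S`. -/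
def IsEtaleOutside (S : Finset (PrimeDivisor C.scheme)) (W : Over C.scheme) : Prop :=
  ∀ U : C.scheme.Opens, (∀ x ∈ S, x.1 ∉ U) → Etale (W.hom ∣_ U)

variable {C} {m : ℕ} [NeZero m] {S : Finset (PrimeDivisor C.scheme)}

/-- The automorphism of the cyclic cover `Spec (⊕ L^{(i,D)})` given by multiplication by `μ ^ i`
on the sections of `L^{(i,D)}`, for an `m`-th root of unity `μ ∈ k`. -/
noncomputable def muAut {μ : k} (hμ : IsPrimitiveRoot μ m) (d : KummerDatum m S) :
    d.cover ⟶ d.cover :=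
  d.rotation (C.const μ) (by rw [← map_pow, hμ.pow_eq_one, map_one])

end SmoothProjectiveCurve

/-- Type T1: the subgroups generated by any two disjoint subsets of `B` intersect trivially. -/
def IsTypeT1 {A : Type*} [AddGroup A] (B : Set A) : Prop :=
  ∀ B₁ ⊆ B, ∀ B₂ ⊆ B, Disjoint B₁ B₂ → AddSubgroup.closure B₁ ⊓ AddSubgroup.closure B₂ = ⊥

variable {Y : Scheme.{u}} {ι : Type u} [Finite ι] (V : ι → Over Y)

/-- The fibre product over `Y` of a finite family of `Y`-schemes. -/
noncomputable abbrev fibreProduct : Over Y := ∏ᶜ V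

/-- Covers are mutually linearly disjoint if their fibre product is an integral scheme. -/
def MutuallyLinearlyDisjoint : Prop := AlgebraicGeometry.IsIntegral (fibreProduct V).left

/-- The normalization `P' ⟶ P` of an integral scheme `P`: the relative normalization of `P` in the
spectrum of its function field. -/
noncomputable def normalizationMap (P : Scheme.{u}) [AlgebraicGeometry.IsIntegral P] :
    (P.fromSpecStalk (genericPoint P)).normalization ⟶ P :=
  (P.fromSpecStalk (genericPoint P)).fromNormalization

variable [AlgebraicGeometry.IsIntegral (fibreProduct V).left]

/-- The normalized fibre product, as a `Y`-scheme. -/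
noncomputable def normalizedFibreProduct : Over Y :=
  Over.mk (normalizationMap (fibreProduct V).left ≫ (fibreProduct V).hom)

/-- The projections of the normalized fibre product. -/
noncomputable def normalizedProj (i : ι) : normalizedFibreProduct V ⟶ V i :=
  Over.homMk (normalizationMap (fibreProduct V).left ≫ (Pi.π V i).left) (
    (Category.assoc _ _ _).trans
      (congrArg (fun t => normalizationMap (fibreProduct V).left ≫ t) (Over.w (Pi.π V i))))

end Curves


end CyclicCovers

open CyclicCovers SmoothProjectiveCurve

/-! Everything is read off on generic fibres, over the function field `K` of `Y`. A representative
is a function `f` with `div f = m E + D`, and its class in `P_m` is the class of `f` modulo `m`-th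
powers (`toGenPic_eq_iff`): the remaining ambiguity is a function without zeros or poles, which is a
constant by properness (`exists_const_eq`) and so an `m`-th power, `k` being algebraically closed.
Relations in `P_m` are thus multiplicative relations modulo `m`-th powers.

The cyclic cover is the normalization of `Y` in `K[z]/(z ^ m - f)` (`isNormalModel_genericFibre`).
The integral part in `L^{(i,D)}` is exactly what makes `c` a section if and only if `c ^ m f ^ i`,
the `m`-th power of `c z ^ i`, is regular (`isSectionAt_twist_iff`). That an integral element has
integral components follows by averaging over the conjugates `z ↦ μ ^ j z`, as `m` is invertible.

A normalization of `Y` in an algebra `A` (`IsNormalModel`) has a universal property: `Y`-morphisms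
from it to an integral `Y`-scheme with generic fibre `A'` are the `K`-algebra maps `A' → A`
(`existsUnique_hom`). For Artinian `A` its connected components correspond to the primes of `A`,
because idempotents are integral. Geometry over `Y` thereby becomes Kummer theory over `K`.

For finite separable `A` the normalization is finite over `Y` and smooth, normal curves over an
algebraically closed field being smooth. It is étale off `S` because, dividing `z` by a local
equation of `E`, one gets a root of `w ^ m = unit`. Conversely a connected Galois cover gives a
Galois extension of `K` with group `ℤ/m`; Hilbert 90 provides an eigenvector `z`, and `f = z ^ m`
has orders divisible by `m` off `S`, since uniformizers stay uniformizers in étale extensions.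

A fibre product of covers is flat over `Y`, hence controlled by its generic fibre: the algebra
generated by roots `z_i` of the `f_i` without further relations (`IsKummerAlgebra`). This is a
domain exactly when the `f_i` are independent modulo `m`-th powers (`IsKummerAlgebra.isDomain`,
`IsKummerAlgebra.independent`), which is type T1 (`isTypeT1_iff`). When it is, it is the function
field of `W`; it contains the roots `g ∏ z_i ^ a_i` attached to all elements of `⟨B⟩`, whence the
domination, and scaling the `z_i` separately by roots of unity, according to the coordinates of
`⟨B⟩` modulo `m`, gives the action. -/

namespace CyclicCovers

/-! ### Morphisms from affine schemes into affine opens, as ring maps -/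

section AffinePoints
variable {X X' : Scheme.{u}} {R R' : Type u} [CommRing R] [CommRing R']

/-- The ring map `Γ(X, V) → R` given by a morphism `Spec R ⟶ X` which factors through `V`. -/
noncomputable def pullSections (w : Spec (.of R) ⟶ X) (V : X.Opens) (h : ⊤ ≤ w ⁻¹ᵁ V) :
    Γ(X, V) →+* R :=
  (Scheme.ΓSpecIso (.of R)).hom.hom.comp (w.appLE V ⊤ h).hom

theorem ofHom_pullSections (w : Spec (.of R) ⟶ X) (V : X.Opens) (h : ⊤ ≤ w ⁻¹ᵁ V) :
    CommRingCat.ofHom (pullSections w V h) = w.appLE V ⊤ h ≫ (Scheme.ΓSpecIso (.of R)).hom := rfl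

theorem map_pullSections_fromSpec (w : Spec (.of R) ⟶ X) {V : X.Opens} (hV : IsAffineOpen V)
    (h : ⊤ ≤ w ⁻¹ᵁ V) :
    Spec.map (CommRingCat.ofHom (pullSections w V h)) ≫ hV.fromSpec = w := by
  rw [ofHom_pullSections, Spec.map_comp, Category.assoc,
    hV.SpecMap_appLE_fromSpec w (isAffineOpen_top (Spec (.of R))) h]
  simp [IsAffineOpen.fromSpec_top]

theorem eq_of_pullSections_eq {w w' : Spec (.of R) ⟶ X} {V : X.Opens} (hV : IsAffineOpen V)
    (h : ⊤ ≤ w ⁻¹ᵁ V) (h' : ⊤ ≤ w' ⁻¹ᵁ V) (e : pullSections w V h = pullSections w' V h') :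
    w = w' := by
  rw [← map_pullSections_fromSpec w hV h, ← map_pullSections_fromSpec w' hV h', e]

theorem pullSections_map_comp (w : Spec (.of R) ⟶ X) (V : X.Opens) (h : ⊤ ≤ w ⁻¹ᵁ V)
    (φ : R →+* R') (h' : ⊤ ≤ (Spec.map (CommRingCat.ofHom φ) ≫ w) ⁻¹ᵁ V) :
    pullSections (Spec.map (CommRingCat.ofHom φ) ≫ w) V h' = φ.comp (pullSections w V h) := by
  have : CommRingCat.ofHom (pullSections (Spec.map (CommRingCat.ofHom φ) ≫ w) V h') =
      CommRingCat.ofHom (pullSections w V h) ≫ CommRingCat.ofHom φ := by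
    rw [ofHom_pullSections, ofHom_pullSections, Category.assoc, ← Scheme.ΓSpecIso_naturality]
    refine Eq.trans ?_ (Category.assoc _ _ _)
    congr 1
  exact congrArg CommRingCat.Hom.hom this

theorem pullSections_comp (w : Spec (.of R) ⟶ X) (f : X ⟶ X') (V : X'.Opens)
    (h : ⊤ ≤ (w ≫ f) ⁻¹ᵁ V) :
    pullSections (w ≫ f) V h = (pullSections w (f ⁻¹ᵁ V) h).comp (f.app V).hom := by
  have : CommRingCat.ofHom (pullSections (w ≫ f) V h) =
      f.app V ≫ CommRingCat.ofHom (pullSections w (f ⁻¹ᵁ V) h) := by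
    rw [ofHom_pullSections]
    refine Eq.trans ?_ (Category.assoc _ _ _)
    congr 1
  exact congrArg CommRingCat.Hom.hom this

theorem pullSections_map_fromSpec {V : X.Opens} (hV : IsAffineOpen V) (ψ : Γ(X, V) →+* R)
    (h : ⊤ ≤ (Spec.map (CommRingCat.ofHom ψ) ≫ hV.fromSpec) ⁻¹ᵁ V) :
    pullSections (Spec.map (CommRingCat.ofHom ψ) ≫ hV.fromSpec) V h = ψ := by
  have := map_pullSections_fromSpec (Spec.map (CommRingCat.ofHom ψ) ≫ hV.fromSpec) hV h
  rw [cancel_mono, Spec.map_injective.eq_iff] at this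
  exact congrArg CommRingCat.Hom.hom this

theorem le_preimage_map_fromSpec {V : X.Opens} (hV : IsAffineOpen V) (ψ : Γ(X, V) →+* R) :
    ⊤ ≤ (Spec.map (CommRingCat.ofHom ψ) ≫ hV.fromSpec) ⁻¹ᵁ V := by
  rw [Scheme.Hom.comp_preimage, hV.fromSpec_preimage_self]
  exact le_rfl

end AffinePoints

theorem exists_affineOpen_mem {Y : Scheme.{u}} (y : Y) : ∃ U : Y.Opens, IsAffineOpen U ∧ y ∈ U := by
  obtain ⟨_, ⟨U, hU, rfl⟩, h, -⟩ := Y.isBasis_affineOpens.exists_subset_of_mem_open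
    (Set.mem_univ y) isOpen_univ
  exact ⟨U, hU, h⟩

/-! ### Morphisms through the generic point -/

section GenericMap
variable (Y : Scheme.{u}) [AlgebraicGeometry.IsIntegral Y]
  (R : Type u) [CommRing R] [Algebra Y.functionField R]

/-- The morphism `Spec R ⟶ Y` through the generic point, for an algebra `R` over the function
field of `Y`. -/
noncomputable def genericMap : Spec (.of R) ⟶ Y :=
  Spec.map (CommRingCat.ofHom (algebraMap Y.functionField R)) ≫ Y.fromSpecStalk (genericPoint Y)

variable {Y R}

theorem genericPoint_mem (U : Y.Opens) [hU : Nonempty U] : genericPoint Y ∈ U :=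
  ((genericPoint_spec Y).mem_open_set_iff U.isOpen).mpr (by simpa using hU)

/-- The morphism from the spectrum of the stalk at a point factors through any affine neighbourhood
of it; this lets the generic map be computed in whichever nonempty affine open is convenient. -/
theorem genericMap_eq {U : Y.Opens} (hU : IsAffineOpen U) [Nonempty U] :
    genericMap Y R = Spec.map (CommRingCat.ofHom
      ((algebraMap Y.functionField R).comp (Y.germToFunctionField U).hom)) ≫ hU.fromSpec := by
  rw [genericMap, ← hU.fromSpecStalk_eq_fromSpecStalk (genericPoint_mem U),
    IsAffineOpen.fromSpecStalk, ← Category.assoc, ← Spec.map_comp]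
  rfl

theorem le_preimage_genericMap (U : Y.Opens) [Nonempty U] : ⊤ ≤ genericMap Y R ⁻¹ᵁ U := by
  obtain ⟨_, ⟨V, hV, rfl⟩, h, hVU⟩ := Y.isBasis_affineOpens.exists_subset_of_mem_open
    (genericPoint_mem U) U.isOpen
  have : Nonempty V := ⟨⟨_, h⟩⟩
  rw [genericMap_eq hV]
  exact (le_preimage_map_fromSpec hV _).trans (Scheme.Hom.preimage_mono _ hVU)

theorem pullSections_genericMap {U : Y.Opens} (hU : IsAffineOpen U) [Nonempty U] :
    pullSections (genericMap Y R) U (le_preimage_genericMap U) =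
      (algebraMap Y.functionField R).comp (Y.germToFunctionField U).hom := by
  rw [← pullSections_map_fromSpec hU
    ((algebraMap Y.functionField R).comp (Y.germToFunctionField U).hom)
    (le_preimage_map_fromSpec hU _)]
  congr 1
  exact genericMap_eq hU

theorem map_genericMap {R' : Type u} [CommRing R'] [Algebra Y.functionField R']
    (φ : R →ₐ[Y.functionField] R') :
    Spec.map (CommRingCat.ofHom φ.toRingHom) ≫ genericMap Y R = genericMap Y R' := by
  rw [genericMap, ← Category.assoc, ← Spec.map_comp, ← CommRingCat.ofHom_comp,
    AlgHom.toRingHom_eq_coe, φ.comp_algebraMap]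
  rfl

instance [IsNoetherian Y] : QuasiCompact (genericMap Y R) := inferInstance
instance [IsNoetherian Y] : QuasiSeparated (genericMap Y R) := inferInstance

end GenericMap

/-! ### Integral `Y`-schemes controlled by their generic fibre -/

section Models
variable {Y : Scheme.{u}} [AlgebraicGeometry.IsIntegral Y] {W : Over Y}
  {A : Type u} [CommRing A] [Algebra Y.functionField A]

theorem le_preimage_of_comp_eq {R : Type u} [CommRing R] [Algebra Y.functionField R]
    {w : Spec (.of R) ⟶ W.left} (hw : w ≫ W.hom = genericMap Y R) (U : Y.Opens) [Nonempty U] :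
    ⊤ ≤ w ⁻¹ᵁ (W.hom ⁻¹ᵁ U) := by
  rw [← Scheme.Hom.comp_preimage, hw]
  exact le_preimage_genericMap U

/-- The generic fibre of the integral `Y`-scheme `W` is the spectrum of `A`, and the sections of `W`
embed in `A`. -/
structure IsModel (W : Over Y) (j : Spec (.of A) ⟶ W.left) : Prop where
  isIntegralHom : IsIntegralHom W.hom
  comp_hom : j ≫ W.hom = genericMap Y A
  injective : ∀ (U : Y.Opens) (_ : IsAffineOpen U) [Nonempty U],
    Function.Injective (pullSections j (W.hom ⁻¹ᵁ U) (le_preimage_of_comp_eq comp_hom U))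
  exists_mul : ∀ (U : Y.Opens) (_ : IsAffineOpen U) [Nonempty U] (a : A),
    ∃ g : Γ(Y, U), g ≠ 0 ∧ algebraMap Y.functionField A (Y.germToFunctionField U g) * a ∈
      (pullSections j (W.hom ⁻¹ᵁ U) (le_preimage_of_comp_eq comp_hom U)).range

/-- The integral `Y`-scheme `W` is the normalization of `Y` in `A`. -/
structure IsNormalModel (W : Over Y) (j : Spec (.of A) ⟶ W.left) : Prop extends IsModel W j where
  mem_range : ∀ (U : Y.Opens) (_ : IsAffineOpen U) [Nonempty U] (a : A),
    ((algebraMap Y.functionField A).comp (Y.germToFunctionField U).hom).IsIntegralElem a →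
      a ∈ (pullSections j (W.hom ⁻¹ᵁ U) (le_preimage_of_comp_eq comp_hom U)).range

/-- Since `w` lies over the generic map, functions pulled back from `Y` act through `K`. This is the
compatibility behind all the scalar towers `Γ(Y, U) → Γ(W) → A` below. -/
theorem pullSections_app {R : Type u} [CommRing R] [Algebra Y.functionField R]
    {w : Spec (.of R) ⟶ W.left} (hw : w ≫ W.hom = genericMap Y R) {U : Y.Opens}
    (hU : IsAffineOpen U) [Nonempty U] (g : Γ(Y, U)) :
    pullSections w (W.hom ⁻¹ᵁ U) (le_preimage_of_comp_eq hw U) (W.hom.app U g) =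
      algebraMap Y.functionField R (Y.germToFunctionField U g) := by
  have h1 := pullSections_comp w W.hom U (le_preimage_of_comp_eq hw U)
  have h2 : pullSections (w ≫ W.hom) U (le_preimage_of_comp_eq hw U) =
      pullSections (genericMap Y R) U (le_preimage_genericMap U) := by
    congr 1
  rw [h2, pullSections_genericMap hU] at h1
  exact (congrArg (fun f => f g) h1).symm

theorem isUnit_algebraMap_germ {R : Type u} [CommRing R] [Algebra Y.functionField R]
    {U : Y.Opens} [Nonempty U] {g : Γ(Y, U)} (hg : g ≠ 0) :
    IsUnit (algebraMap Y.functionField R (Y.germToFunctionField U g)) := by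
  refine IsUnit.map _ (Ne.isUnit ?_)
  rwa [map_ne_zero_iff _ (Scheme.germToFunctionField_injective Y U)]

namespace IsModel
variable {j : Spec (.of A) ⟶ W.left} (h : IsModel W j)
include h

/-- The inclusion of the sections. -/
noncomputable abbrev incl (U : Y.Opens) [Nonempty U] : Γ(W.left, W.hom ⁻¹ᵁ U) →+* A :=
  pullSections j (W.hom ⁻¹ᵁ U) (le_preimage_of_comp_eq h.comp_hom U)

theorem isAffineHom : IsAffineHom W.hom := have := h.isIntegralHom; inferInstance

theorem isAffineOpen {U : Y.Opens} (hU : IsAffineOpen U) : IsAffineOpen (W.hom ⁻¹ᵁ U) :=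
  have := h.isAffineHom; hU.preimage W.hom

/-- `exists_mul` supplies the denominators, which may be taken from `Y`, and injectivity of sections
settles equality. -/
theorem isLocalization {U : Y.Opens} (hU : IsAffineOpen U) [Nonempty U] :
    letI := (h.incl U).toAlgebra
    IsLocalization ((nonZeroDivisors Γ(Y, U)).map (W.hom.app U).hom) A := by
  let := (h.incl U).toAlgebra
  have hmap (b) : algebraMap Γ(W.left, W.hom ⁻¹ᵁ U) A b = h.incl U b := rfl
  refine ⟨?_, ?_, ?_⟩
  · rintro ⟨_, g, hg, rfl⟩
    rw [hmap]
    have := pullSections_app h.comp_hom hU g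
    exact this ▸ isUnit_algebraMap_germ (nonZeroDivisors.ne_zero hg)
  · intro a
    obtain ⟨g, hg, b, hb⟩ := h.exists_mul U hU a
    refine ⟨(b, ⟨_, g, mem_nonZeroDivisors_of_ne_zero hg, rfl⟩), ?_⟩
    rw [hmap, hmap, hb, mul_comm]
    congr 1
    exact pullSections_app h.comp_hom hU g
  · intro a b hab
    exact ⟨1, by rw [h.injective U hU hab]⟩

/-- A morphism from `Spec R` over the generic point is a ring map on the sections of `W` over an
affine `U`. It inverts the nonzero functions on `U` because `R` is a `K`-algebra, so it extends
uniquely to the localization `A`. -/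
theorem existsUnique_algHom {R : Type u} [CommRing R] [Algebra Y.functionField R]
    {w : Spec (.of R) ⟶ W.left} (hw : w ≫ W.hom = genericMap Y R) :
    ∃! φ : A →ₐ[Y.functionField] R, Spec.map (CommRingCat.ofHom φ.toRingHom) ≫ j = w := by
  obtain ⟨U, hU, hη⟩ := exists_affineOpen_mem (genericPoint Y)
  have : Nonempty U := ⟨⟨_, hη⟩⟩
  let := (h.incl U).toAlgebra
  have hloc := h.isLocalization hU
  let ψ := pullSections w (W.hom ⁻¹ᵁ U) (le_preimage_of_comp_eq hw U)
  have hψ (g : Γ(Y, U)) : ψ (W.hom.app U g) =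
      algebraMap Y.functionField R (Y.germToFunctionField U g) := pullSections_app hw hU g
  have hψu : ∀ y : (nonZeroDivisors Γ(Y, U)).map (W.hom.app U).hom, IsUnit (ψ y) := by
    rintro ⟨_, g, hg, rfl⟩
    exact (hψ g) ▸ isUnit_algebraMap_germ (nonZeroDivisors.ne_zero hg)
  have hfrac := functionField_isFractionRing_of_isAffineOpen Y U hU
  -- `K`-linearity is automatic: `K` is the fraction field of `Γ(Y, U)`, so two ring maps out of it
  -- agree once they agree there.
  have hlin (φ : A →+* R) (hφ : φ.comp (h.incl U) = ψ) (c : Y.functionField) :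
      φ (algebraMap _ A c) = algebraMap _ R c := by
    refine congrArg (fun f => f c) (IsLocalization.ringHom_ext (nonZeroDivisors Γ(Y, U))
      (j := φ.comp (algebraMap Y.functionField A)) (k := algebraMap Y.functionField R) ?_)
    ext g
    change φ (algebraMap _ A (Y.germToFunctionField U g)) =
      algebraMap _ R (Y.germToFunctionField U g)
    rw [← pullSections_app h.comp_hom hU g, ← hψ, ← hφ]
    rfl
  have hiff (φ : A →ₐ[Y.functionField] R) : Spec.map (CommRingCat.ofHom φ.toRingHom) ≫ j = w ↔
      φ.toRingHom.comp (h.incl U) = ψ := by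
    have h' : (Spec.map (CommRingCat.ofHom φ.toRingHom) ≫ j) ≫ W.hom = genericMap Y R := by
      rw [Category.assoc, h.comp_hom, map_genericMap]
    have e := pullSections_map_comp j (W.hom ⁻¹ᵁ U) (le_preimage_of_comp_eq h.comp_hom U)
      φ.toRingHom (le_preimage_of_comp_eq h' U)
    constructor
    · intro hφ
      rw [← e]
      congr 1
    · intro hφ
      refine eq_of_pullSections_eq (h.isAffineOpen hU) (le_preimage_of_comp_eq h' U)
        (le_preimage_of_comp_eq hw U) ?_
      rw [e, hφ]
  let φ₀ : A →+* R := IsLocalization.lift hψu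
  have hφ₀ : φ₀.comp (h.incl U) = ψ := IsLocalization.lift_comp hψu
  refine ⟨⟨φ₀, hlin φ₀ hφ₀⟩, (hiff _).mpr hφ₀, fun φ hφ => ?_⟩
  refine AlgHom.coe_ringHom_injective ?_
  exact IsLocalization.ringHom_ext ((nonZeroDivisors Γ(Y, U)).map (W.hom.app U).hom)
    (((hiff φ).mp hφ).trans hφ₀.symm)

end IsModel

end Models

theorem pullSections_injective {X : Scheme.{u}} {R : Type u} [CommRing R]
    (w : Spec (.of R) ⟶ X) (V : X.Opens) (h : ⊤ ≤ w ⁻¹ᵁ V)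
    (hw : Function.Injective (w.app V)) : Function.Injective (pullSections w V h) := by
  have e : w ⁻¹ᵁ V = ⊤ := top_le_iff.mp h
  have : IsIso (homOfLE h) := ⟨⟨homOfLE e.le, Subsingleton.elim _ _, Subsingleton.elim _ _⟩⟩
  have h1 : Function.Injective ((Spec (.of R)).presheaf.map (homOfLE h).op) :=
    (ConcreteCategory.bijective_of_isIso _).1
  have h2 : Function.Injective (Scheme.ΓSpecIso (.of R)).hom :=
    (ConcreteCategory.bijective_of_isIso _).1
  exact h2.comp (h1.comp hw)

/-! ### Normalizations and their universal property -/

section Models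
variable {Y : Scheme.{u}} [AlgebraicGeometry.IsIntegral Y] {W : Over Y}
  {A : Type u} [CommRing A] [Algebra Y.functionField A]

theorem isIntegralElem_pullSections {R : Type u} [CommRing R] [Algebra Y.functionField R]
    [IsIntegralHom W.hom]
    {w : Spec (.of R) ⟶ W.left} (hw : w ≫ W.hom = genericMap Y R) {U : Y.Opens}
    (hU : IsAffineOpen U) [Nonempty U] (b : Γ(W.left, W.hom ⁻¹ᵁ U)) :
    ((algebraMap Y.functionField R).comp (Y.germToFunctionField U).hom).IsIntegralElem
      (pullSections w (W.hom ⁻¹ᵁ U) (le_preimage_of_comp_eq hw U) b) := by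
  obtain ⟨p, hp, hb⟩ := W.hom.isIntegral_app U hU b
  refine ⟨p, hp, ?_⟩
  have : (algebraMap Y.functionField R).comp (Y.germToFunctionField U).hom =
      (pullSections w (W.hom ⁻¹ᵁ U) (le_preimage_of_comp_eq hw U)).comp (W.hom.app U).hom :=
    RingHom.ext fun g => (pullSections_app hw hU g).symm
  rw [this, ← Polynomial.hom_eval₂, hb, map_zero]

namespace IsNormalModel
variable {j : Spec (.of A) ⟶ W.left} (h : IsNormalModel W j)
include h

/-- Over an affine open of `Y` both section rings embed in `A`. Those of the relative normalization
are integral over `Γ(Y, U)`, so `mem_range` puts them into the sections of `W`. The universal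
property of relative normalization then becomes available for `W`. -/
theorem isIso_normalizationDesc [IsNoetherian Y] : haveI := h.isIntegralHom
    IsIso ((genericMap Y A).normalizationDesc j W.hom h.comp_hom.symm) := by
  have := h.isIntegralHom
  set δ := (genericMap Y A).normalizationDesc j W.hom h.comp_hom.symm with hδ
  have hδ1 : (genericMap Y A).toNormalization ≫ δ = j :=
    (genericMap Y A).toNormalization_normalizationDesc _ _ _
  have hδ2 : δ ≫ W.hom = (genericMap Y A).fromNormalization :=
    (genericMap Y A).normalizationDesc_comp _ _ _
  apply IsZariskiLocalAtTarget.of_forall_exists_morphismRestrict (P := .isomorphisms _) fun x ↦ ?_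
  obtain ⟨U, hU, hxU⟩ := exists_affineOpen_mem (W.hom x)
  have : Nonempty U := ⟨⟨_, hxU⟩⟩
  refine ⟨W.hom ⁻¹ᵁ U, hxU,
    (isIso_morphismRestrict_iff_isIso_app _ (U := W.hom ⁻¹ᵁ U) (h.isAffineOpen hU)).mpr ?_⟩
  let N : Over Y := Over.mk (genericMap Y A).fromNormalization
  have hN : (genericMap Y A).toNormalization ≫ N.hom = genericMap Y A :=
    (genericMap Y A).toNormalization_fromNormalization
  have : IsIntegralHom N.hom := by dsimp [N]; infer_instance
  have hNU : IsAffineOpen (N.hom ⁻¹ᵁ U) := hU.preimage N.hom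
  have hNinj : Function.Injective
      (pullSections (genericMap Y A).toNormalization (N.hom ⁻¹ᵁ U) (le_preimage_of_comp_eq hN U))
        := by
    refine pullSections_injective _ _ _ ?_
    have := (genericMap Y A).ker_toNormalization
    have h2 := congrArg (fun I => Scheme.IdealSheafData.ideal I ⟨N.hom ⁻¹ᵁ U, hNU⟩) this
    simp only [Scheme.Hom.ker_apply] at h2
    exact (RingHom.injective_iff_ker_eq_bot _).mpr h2
  have e : δ ⁻¹ᵁ (W.hom ⁻¹ᵁ U) = N.hom ⁻¹ᵁ U := by
    rw [← Scheme.Hom.comp_preimage, hδ2]; rfl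
  have hNle : ⊤ ≤ (genericMap Y A).toNormalization ⁻¹ᵁ (δ ⁻¹ᵁ (W.hom ⁻¹ᵁ U)) :=
    e ▸ le_preimage_of_comp_eq hN U
  have hNinj' : Function.Injective (pullSections (genericMap Y A).toNormalization
      (δ ⁻¹ᵁ (W.hom ⁻¹ᵁ U)) hNle) := by
    -- The preimages of `U` through `W` and through `N` are equal only propositionally, so facts
    -- about the latter are transported by generalizing over the factorization proof.
    revert hNle
    rw [e]
    exact fun _ => hNinj
  have hNint (n : Γ(N.left, δ ⁻¹ᵁ (W.hom ⁻¹ᵁ U))) :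
      ((algebraMap Y.functionField A).comp (Y.germToFunctionField U).hom).IsIntegralElem
      (pullSections (genericMap Y A).toNormalization (δ ⁻¹ᵁ (W.hom ⁻¹ᵁ U)) hNle n) := by
    revert hNle n
    rw [e]
    exact fun _ _ n => isIntegralElem_pullSections hN hU n
  have hcomp : (pullSections (genericMap Y A).toNormalization (δ ⁻¹ᵁ (W.hom ⁻¹ᵁ U)) hNle).comp
      (δ.app (W.hom ⁻¹ᵁ U)).hom = h.incl U := by
    refine (pullSections_comp (genericMap Y A).toNormalization δ (W.hom ⁻¹ᵁ U) hNle).symm.trans ?_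
    congr 1
  rw [ConcreteCategory.isIso_iff_bijective]
  constructor
  · refine Function.Injective.of_comp (f := pullSections (genericMap Y A).toNormalization
      (δ ⁻¹ᵁ (W.hom ⁻¹ᵁ U)) hNle) ?_
    have := h.injective U hU
    intro a b hab
    apply this
    have h3 := congrArg (fun f => f a) hcomp
    have h4 := congrArg (fun f => f b) hcomp
    exact h3.symm.trans (hab.trans h4)
  · intro n
    obtain ⟨b, hb⟩ := h.mem_range U hU _ (hNint n)
    refine ⟨b, hNinj' (Eq.trans ?_ hb)⟩
    exact congrArg (fun f => f b) hcomp

theorem hom_ext [IsNoetherian Y] {T : Over Y} [IsAffineHom T.hom] {f g : W ⟶ T}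
    (e : j ≫ f.left = j ≫ g.left) : f = g := by
  have := h.isIntegralHom
  have hi := h.isIso_normalizationDesc
  refine Over.OverMorphism.ext ?_
  rw [← cancel_epi ((genericMap Y A).normalizationDesc j W.hom h.comp_hom.symm)]
  refine Scheme.Hom.normalization.hom_ext _ _ _ T.hom ?_ ?_ ?_
  · rw [← Category.assoc, ← Category.assoc, Scheme.Hom.toNormalization_normalizationDesc, e]
  · rw [Category.assoc, Over.w, Scheme.Hom.normalizationDesc_comp]
  · rw [Category.assoc, Over.w, Scheme.Hom.normalizationDesc_comp]

/-- A rational map given on the generic fibre extends to all of `W`: the target is integral over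
`Y`, so its sections land among the integral elements of `A`. -/
theorem exists_hom [IsNoetherian Y] {T : Over Y} [IsIntegralHom T.hom]
    {t : Spec (.of A) ⟶ T.left} (ht : t ≫ T.hom = genericMap Y A) :
    ∃ f : W ⟶ T, j ≫ f.left = t := by
  have := h.isIntegralHom
  have hi := h.isIso_normalizationDesc
  refine ⟨Over.homMk (inv ((genericMap Y A).normalizationDesc j W.hom h.comp_hom.symm) ≫
    (genericMap Y A).normalizationDesc t T.hom ht.symm) ?_, ?_⟩
  · rw [Category.assoc, Scheme.Hom.normalizationDesc_comp, IsIso.inv_comp_eq,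
      Scheme.Hom.normalizationDesc_comp]
  · have : j ≫ inv ((genericMap Y A).normalizationDesc j W.hom h.comp_hom.symm) =
        (genericMap Y A).toNormalization := by
      rw [IsIso.comp_inv_eq, Scheme.Hom.toNormalization_normalizationDesc]
    change j ≫ inv _ ≫ _ = t
    rw [← Category.assoc, this, Scheme.Hom.toNormalization_normalizationDesc]

theorem existsUnique_hom [IsNoetherian Y] {W' : Over Y} {A' : Type u} [CommRing A']
    [Algebra Y.functionField A'] {j' : Spec (.of A') ⟶ W'.left} (h' : IsModel W' j')
    (φ : A' →ₐ[Y.functionField] A) :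
    ∃! f : W ⟶ W', j ≫ f.left = Spec.map (CommRingCat.ofHom φ.toRingHom) ≫ j' := by
  have := h'.isIntegralHom
  obtain ⟨f, hf⟩ := h.exists_hom (T := W')
    (t := Spec.map (CommRingCat.ofHom φ.toRingHom) ≫ j')
    (by rw [Category.assoc, h'.comp_hom, map_genericMap])
  exact ⟨f, hf, fun g hg => h.hom_ext (hg.trans hf.symm)⟩

/-- The morphism of normalizations given by a homomorphism of algebras. -/
noncomputable def homOfAlgHom [IsNoetherian Y] {W' : Over Y} {A' : Type u} [CommRing A']
    [Algebra Y.functionField A'] {j' : Spec (.of A') ⟶ W'.left} (h' : IsModel W' j')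
    (φ : A' →ₐ[Y.functionField] A) : W ⟶ W' :=
  (h.existsUnique_hom h' φ).choose

theorem comp_homOfAlgHom [IsNoetherian Y] {W' : Over Y} {A' : Type u} [CommRing A']
    [Algebra Y.functionField A'] {j' : Spec (.of A') ⟶ W'.left} (h' : IsModel W' j')
    (φ : A' →ₐ[Y.functionField] A) :
    j ≫ (h.homOfAlgHom h' φ).left = Spec.map (CommRingCat.ofHom φ.toRingHom) ≫ j' :=
  (h.existsUnique_hom h' φ).choose_spec.1

omit h in
theorem comp_homOfAlgHom_comp [IsNoetherian Y] {W' W'' : Over Y} {A' A'' : Type u} [CommRing A']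
    [CommRing A''] [Algebra Y.functionField A'] [Algebra Y.functionField A'']
    {j' : Spec (.of A') ⟶ W'.left} {j'' : Spec (.of A'') ⟶ W''.left}
    {f : W ⟶ W'} {g : W' ⟶ W''} {φ : A' →ₐ[Y.functionField] A} {ψ : A'' →ₐ[Y.functionField] A'}
    (hf : j ≫ f.left = Spec.map (CommRingCat.ofHom φ.toRingHom) ≫ j')
    (hg : j' ≫ g.left = Spec.map (CommRingCat.ofHom ψ.toRingHom) ≫ j'') :
    j ≫ (f ≫ g).left = Spec.map (CommRingCat.ofHom (φ.comp ψ).toRingHom) ≫ j'' := by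
  rw [Over.comp_left, ← Category.assoc, hf, Category.assoc, hg, ← Category.assoc, ← Spec.map_comp]
  rfl

omit h in
theorem comp_id_left : j ≫ (𝟙 W : W ⟶ W).left =
    Spec.map (CommRingCat.ofHom (AlgHom.id Y.functionField A).toRingHom) ≫ j := by
  rw [Over.id_left, Category.comp_id]
  exact ((congrArg (fun t => t ≫ j) (Spec.map_id (.of A))).trans (Category.id_comp _)).symm

/-- The isomorphism of normalizations given by an isomorphism of algebras. -/
noncomputable def isoOfAlgEquiv [IsNoetherian Y] {W' : Over Y} {A' : Type u} [CommRing A']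
    [Algebra Y.functionField A'] {j' : Spec (.of A') ⟶ W'.left} (h' : IsNormalModel W' j')
    (φ : A' ≃ₐ[Y.functionField] A) : W ≅ W' where
  hom := h.homOfAlgHom h'.toIsModel φ.toAlgHom
  inv := h'.homOfAlgHom h.toIsModel φ.symm.toAlgHom
  hom_inv_id := by
    have := h.isIntegralHom
    refine h.hom_ext ((comp_homOfAlgHom_comp (h.comp_homOfAlgHom _ _)
      (h'.comp_homOfAlgHom _ _)).trans (Eq.trans ?_ comp_id_left.symm))
    congr 3
    ext a
    exact φ.apply_symm_apply a
  inv_hom_id := by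
    have := h'.isIntegralHom
    refine h'.hom_ext ((comp_homOfAlgHom_comp (h'.comp_homOfAlgHom _ _)
      (h.comp_homOfAlgHom _ _)).trans (Eq.trans ?_ comp_id_left.symm))
    congr 3
    ext a
    exact φ.symm_apply_apply a

theorem comp_isoOfAlgEquiv [IsNoetherian Y] {W' : Over Y} {A' : Type u} [CommRing A']
    [Algebra Y.functionField A'] {j' : Spec (.of A') ⟶ W'.left} (h' : IsNormalModel W' j')
    (φ : A' ≃ₐ[Y.functionField] A) : j ≫ (h.isoOfAlgEquiv h' φ).hom.left =
      Spec.map (CommRingCat.ofHom φ.toAlgHom.toRingHom) ≫ j' :=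
  h.comp_homOfAlgHom h'.toIsModel _

/-- The action on the normalization given by a commutative group of automorphisms of the algebra. -/
noncomputable def autHom [IsNoetherian Y] {G : Type*} [CommGroup G]
    (ρ : G →* (A ≃ₐ[Y.functionField] A)) : G →* Aut W where
  toFun g := h.isoOfAlgEquiv h (ρ g)
  map_one' := by
    have := h.isIntegralHom
    refine Iso.ext (h.hom_ext ((h.comp_isoOfAlgEquiv _ _).trans (Eq.trans ?_ comp_id_left.symm)))
    rw [map_one]
    rfl
  map_mul' a b := by
    have := h.isIntegralHom
    refine Iso.ext (h.hom_ext ((h.comp_isoOfAlgEquiv _ _).trans ?_))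
    change _ = j ≫ ((h.isoOfAlgEquiv h (ρ b)).hom ≫ (h.isoOfAlgEquiv h (ρ a)).hom).left
    -- A product `a * b` in `Aut W` performs `b` first, and `Spec` is contravariant, so the algebra
    -- map is `ρ b ∘ ρ a = ρ (b * a)`; commutativity of `G` restores the order.
    rw [comp_homOfAlgHom_comp (h.comp_isoOfAlgEquiv _ _) (h.comp_isoOfAlgEquiv _ _), mul_comm,
      map_mul]
    rfl

theorem comp_autHom [IsNoetherian Y] {G : Type*} [CommGroup G]
    (ρ : G →* (A ≃ₐ[Y.functionField] A)) (g : G) : j ≫ (h.autHom ρ g).hom.left =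
      Spec.map (CommRingCat.ofHom (ρ g).toAlgHom.toRingHom) ≫ j :=
  h.comp_isoOfAlgEquiv _ _

end IsNormalModel
end Models

/-! ### Points, integrality and connected components of a model -/

section Topology
variable {Y : Scheme.{u}} [AlgebraicGeometry.IsIntegral Y] {W : Over Y}
  {A : Type u} [CommRing A] [Algebra Y.functionField A]

namespace IsModel
variable {j : Spec (.of A) ⟶ W.left} (h : IsModel W j)
include h

theorem apply_eq_fromSpec {U : Y.Opens} (hU : IsAffineOpen U) [Nonempty U] (P : PrimeSpectrum A) :
    j P = (h.isAffineOpen hU).fromSpec (PrimeSpectrum.comap (h.incl U) P) := by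
  have := map_pullSections_fromSpec j (h.isAffineOpen hU) (le_preimage_of_comp_eq h.comp_hom U)
  conv_lhs => rw [← this]
  rfl

theorem apply_mem_basicOpen {U : Y.Opens} (hU : IsAffineOpen U) [Nonempty U] (P : PrimeSpectrum A)
    (b : Γ(W.left, W.hom ⁻¹ᵁ U)) : j P ∈ W.left.basicOpen b ↔ h.incl U b ∉ P.asIdeal := by
  have h1 := (h.isAffineOpen hU).fromSpec_preimage_basicOpen b
  have h2 : PrimeSpectrum.comap (h.incl U) P ∈ (h.isAffineOpen hU).fromSpec ⁻¹ᵁ W.left.basicOpen b ↔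
      PrimeSpectrum.comap (h.incl U) P ∈ PrimeSpectrum.basicOpen b := by rw [h1]; exact Iff.rfl
  rw [h.apply_eq_fromSpec hU P]
  exact h2

/-- Below the prime of `v` in an affine chart there is a minimal prime, and minimal primes lift
along the injection of the sections into `A`. So the generic fibre is dense, with control on which
of its points specialize to `v`. -/
theorem exists_specializes (v : W.left) : ∃ P : PrimeSpectrum A, j P ⤳ v := by
  obtain ⟨U, hU, hvU⟩ := exists_affineOpen_mem (W.hom v)
  have : Nonempty U := ⟨⟨_, hvU⟩⟩
  let q := (h.isAffineOpen hU).primeIdealOf ⟨v, hvU⟩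
  have hq : (h.isAffineOpen hU).fromSpec q = v := (h.isAffineOpen hU).fromSpec_primeIdealOf ⟨v, hvU⟩
  obtain ⟨q₀, hq₀, hle⟩ := Ideal.exists_minimalPrimes_le (I := ⊥) (J := q.asIdeal) bot_le
  obtain ⟨P, hP, hPq⟩ := Ideal.exists_comap_eq_of_mem_minimalPrimes_of_injective
    (h.injective U hU) q₀ hq₀
  refine ⟨⟨P, hP⟩, ?_⟩
  rw [h.apply_eq_fromSpec hU, ← hq]
  refine Specializes.map ?_ (h.isAffineOpen hU).fromSpec.continuous
  refine (PrimeSpectrum.le_iff_specializes _ _).mp ?_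
  change P.comap _ ≤ _
  rwa [hPq]

/-- Any `a ∈ A` becomes a section after multiplication by a unit coming from `Y`, so an element of
`P` outside `Q` would give a basic open set containing `j Q` but not `j P`. -/
theorem le_of_specializes {P Q : PrimeSpectrum A} (hPQ : j P ⤳ j Q) : P ≤ Q := by
  obtain ⟨U, hU, hη⟩ := exists_affineOpen_mem (genericPoint Y)
  have : Nonempty U := ⟨⟨_, hη⟩⟩
  intro a ha
  obtain ⟨g, hg, b, hb⟩ := h.exists_mul U hU a
  have hu : IsUnit (algebraMap Y.functionField A (Y.germToFunctionField U g)) :=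
    isUnit_algebraMap_germ hg
  by_contra haQ
  have h1 : j Q ∈ W.left.basicOpen b := by
    rw [h.apply_mem_basicOpen hU]
    change pullSections _ _ _ b ∉ _
    rw [hb]
    intro hc
    rcases Q.2.mem_or_mem hc with hc | hc
    · exact Q.2.ne_top (Ideal.eq_top_of_isUnit_mem _ hc hu)
    · exact haQ hc
  have h2 : j P ∈ W.left.basicOpen b := hPQ.mem_open (W.left.basicOpen b).isOpen h1
  rw [h.apply_mem_basicOpen hU] at h2
  refine h2 ?_
  change pullSections _ _ _ b ∈ _
  rw [hb]
  exact Ideal.mul_mem_left _ _ ha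

/-- Irreducibility comes from the dense image of the irreducible space `Spec A`, reducedness from
the embedding of the section rings in `A`. -/
theorem isIntegral [IsDomain A] : AlgebraicGeometry.IsIntegral W.left := by
  have hdom (U : Y.Opens) (hU : IsAffineOpen U) [Nonempty U] : IsDomain Γ(W.left, W.hom ⁻¹ᵁ U) :=
    (h.injective U hU).isDomain
  have : IsDominant j := ⟨fun v => by
    obtain ⟨P, hP⟩ := h.exists_specializes v
    exact closure_mono (Set.singleton_subset_iff.mpr (Set.mem_range_self P)) hP.mem_closure⟩
  have : IrreducibleSpace W.left := by
    rw [irreducibleSpace_def]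
    convert! ((IrreducibleSpace.isIrreducible_univ (Spec (.of A))).image j
      j.continuous.continuousOn).closure
    simpa using j.denseRange.closure_range.symm
  have : IsReduced W.left := by
    have hc : (⨆ U : Y.affineOpens, W.hom ⁻¹ᵁ U.1) = ⊤ := by
      rw [← Scheme.Hom.preimage_iSup, AlgebraicGeometry.iSup_affineOpens_eq_top Y,
        Scheme.Hom.preimage_top]
    refine @IsReduced.of_openCover _ (W.left.openCoverOfIsOpenCover
      (fun U : Y.affineOpens => W.hom ⁻¹ᵁ U.1) hc) fun U => ?_
    have : IsAffine (W.hom ⁻¹ᵁ U.1).toScheme := h.isAffineOpen U.2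
    have : IsReduced Γ(W.left, W.hom ⁻¹ᵁ U.1) := by
      rcases isEmpty_or_nonempty U.1 with hE | hne
      · have : W.hom ⁻¹ᵁ U.1 = ⊥ := by
          ext y; exact ⟨fun hy => (hE.false ⟨_, hy⟩).elim, fun hy => hy.elim⟩
        rw [this]; infer_instance
      · have := hdom U.1 U.2; infer_instance
    have : IsReduced Γ((W.hom ⁻¹ᵁ U.1).toScheme, ⊤) := isReduced_of_injective
      (W.hom ⁻¹ᵁ U.1).topIso.hom.hom (ConcreteCategory.bijective_of_isIso _).1
    exact isReduced_of_isAffine_isReduced (W.hom ⁻¹ᵁ U.1).toScheme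
  exact isIntegral_of_irreducibleSpace_of_isReduced _

theorem isDomain [AlgebraicGeometry.IsIntegral W.left] : IsDomain A := by
  obtain ⟨U, hU, hη⟩ := exists_affineOpen_mem (genericPoint Y)
  have : Nonempty U := ⟨⟨_, hη⟩⟩
  have : Nonempty (W.hom ⁻¹ᵁ U) := by
    obtain ⟨P, -⟩ := h.exists_specializes (genericPoint W.left)
    exact ⟨⟨j P, le_preimage_of_comp_eq h.comp_hom U trivial⟩⟩
  let := (h.incl U).toAlgebra
  have := h.isLocalization hU
  refine IsLocalization.isDomain_of_le_nonZeroDivisors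
    (M := (nonZeroDivisors Γ(Y, U)).map (W.hom.app U).hom) (R := Γ(W.left, W.hom ⁻¹ᵁ U)) A ?_
  rintro _ ⟨g, hg, rfl⟩
  refine mem_nonZeroDivisors_of_ne_zero fun h0 => ?_
  have h1 := pullSections_app h.comp_hom hU g
  rw [h0, map_zero] at h1
  have : Nontrivial A := (h.injective U hU).nontrivial
  have h2 := isUnit_algebraMap_germ (R := A) (nonZeroDivisors.ne_zero hg)
  exact h2.ne_zero h1.symm

end IsModel

namespace IsNormalModel
variable {j : Spec (.of A) ⟶ W.left} (h : IsNormalModel W j)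
include h

/-- The idempotent `e` of the Artinian ring `A` that isolates `P` is a root of `X ^ 2 - X`, hence
integral, hence by normality a section over every affine open of `Y`. Its nonvanishing locus near a
point of the closure is open and meets only points that `j P` specializes to. -/
theorem isOpen_closure [IsArtinianRing A] (P : PrimeSpectrum A) : IsOpen (closure {j P}) := by
  obtain ⟨e, he, hPe⟩ := PrimeSpectrum.isClopen_iff.mp (isClopen_discrete {P})
  have hmem (Q : PrimeSpectrum A) : e ∉ Q.asIdeal ↔ Q = P := by
    have : Q ∈ ({P} : Set (PrimeSpectrum A)) ↔ Q ∈ (PrimeSpectrum.basicOpen e : Set _) :=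
      by rw [hPe]
    exact this.symm
  refine isOpen_iff_forall_mem_open.mpr fun v hv => ?_
  obtain ⟨U, hU, hvU⟩ := exists_affineOpen_mem (W.hom v)
  have : Nonempty U := ⟨⟨_, hvU⟩⟩
  obtain ⟨b, hb⟩ := h.mem_range U hU e ⟨Polynomial.X ^ 2 - Polynomial.X, by
    monicity!, by simp [pow_two, he.eq]⟩
  have hbi : b * b = b := h.injective U hU (by rw [map_mul, hb, he.eq])
  refine ⟨W.left.basicOpen b, fun y hy => ?_, (W.left.basicOpen b).isOpen, ?_⟩
  · obtain ⟨Q, hQ⟩ := h.exists_specializes y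
    have h1 := hQ.mem_open (W.left.basicOpen b).isOpen hy
    replace h1 := (h.apply_mem_basicOpen hU Q b).mp h1
    have h2 := (hmem Q).mp (by rw [← hb]; exact h1)
    exact h2 ▸ hQ.mem_closure
  -- In the local ring at `v` either `b` or `1 - b` is a unit. In the second case `1 - b` would also
  -- be nonzero at the generization `j P`, against `e (1 - e) = 0` and `e ∉ P`.
  · have hvb : v ∈ W.left.basicOpen b ∨ v ∈ W.left.basicOpen (1 - b) := by
      rw [W.left.mem_basicOpen b v hvU, W.left.mem_basicOpen (1 - b) v hvU, map_sub, map_one]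
      exact IsLocalRing.isUnit_or_isUnit_one_sub_self _
    refine hvb.resolve_right fun hv1 => ?_
    have h1 : j P ∈ W.left.basicOpen (1 - b) :=
      (specializes_iff_mem_closure.mpr hv).mem_open (W.left.basicOpen (1 - b)).isOpen hv1
    rw [h.apply_mem_basicOpen hU, map_sub, map_one] at h1
    have h2 := (hmem P).mpr rfl
    have h3 : h.incl U b = e := hb
    rw [h3] at h1
    rcases P.2.mem_or_mem (show e * (1 - e) ∈ P.asIdeal by
      rw [mul_sub, mul_one, he.eq, sub_self]; exact P.asIdeal.zero_mem) with hc | hc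
    · exact h2 hc
    · exact h1 hc

theorem connectedComponent_eq [IsArtinianRing A] {P : PrimeSpectrum A} {v : W.left}
    (hP : j P ⤳ v) : connectedComponent v = closure {j P} := by
  refine Set.Subset.antisymm ?_ ?_
  · exact IsClopen.connectedComponent_subset ⟨isClosed_closure, h.isOpen_closure P⟩ hP.mem_closure
  · exact isIrreducible_singleton.closure.isPreirreducible.isPreconnected.subset_connectedComponent
      hP.mem_closure

/-- If `W` is connected, every `closure {j P}` is all of `W`, so any two points of the generic fibre
specialize to each other. -/
theorem subsingleton_of_connectedSpace [IsArtinianRing A] [ConnectedSpace W.left] :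
    Subsingleton (PrimeSpectrum A) := by
  refine ⟨fun P Q => le_antisymm ?_ ?_⟩ <;>
  · refine h.le_of_specializes ?_
    rw [specializes_iff_mem_closure, ← h.connectedComponent_eq (specializes_refl _),
      PreconnectedSpace.connectedComponent_eq_univ]
    trivial

end IsNormalModel

end Topology

/-! ### Local rings of algebras étale over a principal ideal domain -/

section LocalAlgebra

/-- By Krull's intersection theorem every nonzero element is a unit times a power of `t`, and such
products are nonzero because `t` is a nonzerodivisor. -/
theorem isDomain_of_maximalIdeal_eq_span {L : Type*} [CommRing L] [IsLocalRing L]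
    [IsNoetherianRing L] {t : L} (ht : IsLocalRing.maximalIdeal L = Ideal.span {t})
    (h0 : t ∈ nonZeroDivisors L) : IsDomain L := by
  have key (a : L) (ha : a ≠ 0) : ∃ n, ∃ u : L, IsUnit u ∧ a = t ^ n * u := by
    have hk := Ideal.iInf_pow_eq_bot_of_isLocalRing (IsLocalRing.maximalIdeal L)
      (IsLocalRing.maximalIdeal.isMaximal L).ne_top
    have : ∃ n, a ∉ IsLocalRing.maximalIdeal L ^ n := by
      by_contra! hc
      exact ha (by simpa [hk] using (Submodule.mem_iInf _).mpr hc)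
    classical
    let n := Nat.find this
    have hn : a ∉ IsLocalRing.maximalIdeal L ^ n := Nat.find_spec this
    obtain ⟨l, hl⟩ : ∃ l, n = l + 1 := Nat.exists_eq_succ_of_ne_zero (fun h => hn (by simp [h]))
    have hl' : a ∈ IsLocalRing.maximalIdeal L ^ l := by
      by_contra hc
      exact Nat.find_min this (by omega : l < n) hc
    rw [ht, Ideal.span_singleton_pow, Ideal.mem_span_singleton] at hl'
    obtain ⟨u, rfl⟩ := hl'
    refine ⟨l, u, ?_, rfl⟩
    by_contra hu
    refine hn ?_
    rw [hl, pow_succ]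
    refine Ideal.mul_mem_mul (Ideal.pow_mem_pow ?_ _) ((IsLocalRing.mem_maximalIdeal u).mpr hu)
    rw [ht]; exact Ideal.mem_span_singleton_self t
  have : NoZeroDivisors L := ⟨fun {a b} hab => by
    by_contra! hc
    obtain ⟨n, u, hu, rfl⟩ := key a hc.1
    obtain ⟨l, v, hv, rfl⟩ := key b hc.2
    have h1 : (u * v) * t ^ (n + l) = 0 := by rw [← hab]; ring
    rw [(hu.mul hv).mul_right_eq_zero] at h1
    exact hc.1 (by
      have := (mul_right_mem_nonZeroDivisors_eq_zero_iff (pow_mem h0 (n + l))).mp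
        (show (1 : L) * t ^ (n + l) = 0 by rw [one_mul, h1])
      rw [← mul_one (t ^ n * u), this, mul_zero])⟩
  exact NoZeroDivisors.to_isDomain L

/-- Let `π` generate the contraction of `q` to `A`. Unramifiedness makes `π` generate the maximal
ideal of the local ring; flatness keeps it a nonzerodivisor unless `π = 0`, and then the local ring
is a field. -/
theorem isDomain_of_etale {A B L : Type*} [CommRing A] [IsDomain A] [IsPrincipalIdealRing A]
    [CommRing B] [Algebra A B] [Algebra.Etale A B] (q : Ideal B) [q.IsPrime] [CommRing L]
    [Algebra B L] [IsLocalization.AtPrime L q] :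
    ∃ _ : IsDomain L, IsField L ∨ IsDiscreteValuationRing L := by
  let e := (IsLocalization.algEquiv q.primeCompl (Localization.AtPrime q) L).toRingEquiv
  have : IsNoetherianRing B := Algebra.FiniteType.isNoetherianRing A B
  have : IsNoetherianRing (Localization.AtPrime q) :=
    IsLocalization.isNoetherianRing q.primeCompl _ inferInstance
  have hfl : Module.Flat B (Localization.AtPrime q) := IsLocalization.flat _ q.primeCompl
  have hfl : Module.Flat A (Localization.AtPrime q) := Module.Flat.trans A B _
  let := Localization.AtPrime.algebraOfLiesOver (q.under A) q
  have h1 : (q.under A).map (algebraMap A (Localization.AtPrime q)) =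
      IsLocalRing.maximalIdeal _ :=
    ((Algebra.isUnramifiedAt_iff_map_eq A (q.under A) q).mp inferInstance).2
  obtain ⟨π, hπ⟩ := IsPrincipalIdealRing.principal (q.under A)
  have h2 : IsLocalRing.maximalIdeal (Localization.AtPrime q) =
      Ideal.span {algebraMap A (Localization.AtPrime q) π} := by
    rw [← h1, hπ, ← Set.image_singleton, ← Ideal.map_span]
  by_cases h0 : π = 0
  · have hF : IsField (Localization.AtPrime q) := by
      rw [IsLocalRing.isField_iff_maximalIdeal_eq, h2, h0]; simp
    have hF' : IsField L := e.symm.toMulEquiv.isField hF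
    exact ⟨hF'.isDomain, .inl hF'⟩
  · have hz : algebraMap A (Localization.AtPrime q) π ∈ nonZeroDivisors _ := by
      have := IsSMulRegular.of_flat (S := Localization.AtPrime q)
        ((isSMulRegular_iff_right_eq_zero_of_smul (R := A) (M := A) (r := π)).mpr fun a ha =>
          (mul_eq_zero.mp ha).resolve_left h0)
      rw [mem_nonZeroDivisors_iff_right]
      intro x hx
      exact isSMulRegular_iff_right_eq_zero_of_smul.mp this x (by rw [smul_eq_mul, mul_comm, hx])
    have hD := isDomain_of_maximalIdeal_eq_span h2 hz
    have hD' : IsDomain L := e.symm.toMulEquiv.isDomain _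
    refine ⟨hD', or_iff_not_imp_left.mpr fun hF => ?_⟩
    have hF' : ¬ IsField (Localization.AtPrime q) := fun h => hF (e.symm.toMulEquiv.isField h)
    have : IsDiscreteValuationRing (Localization.AtPrime q) :=
      ((IsDiscreteValuationRing.TFAE _ hF').out 4 0).mp (by rw [h2]; exact ⟨⟨_, rfl⟩⟩)
    exact IsDiscreteValuationRing.RingEquivClass.isDiscreteValuationRing e

theorem isDomain_of_isStandardSmooth {F B L : Type*} [Field F] [CommRing B]
    [Algebra F B] [Algebra.IsStandardSmoothOfRelativeDimension 1 F B]
    (q : Ideal B) [q.IsPrime] [CommRing L] [Algebra B L]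
    [IsLocalization.AtPrime L q] : ∃ _ : IsDomain L, IsField L ∨ IsDiscreteValuationRing L := by
  obtain ⟨g, hg⟩ := Algebra.IsStandardSmoothOfRelativeDimension.exists_etale_mvPolynomial 1 F B
  let := g.toRingHom.toAlgebra
  have : Algebra.Etale (MvPolynomial (Fin 1) F) B := hg
  have : IsPrincipalIdealRing (MvPolynomial (Fin 1) F) :=
    .of_surjective (MvPolynomial.uniqueAlgEquiv F (Fin 1)).symm.toRingEquiv
      (MvPolynomial.uniqueAlgEquiv F (Fin 1)).symm.surjective
  exact isDomain_of_etale (A := MvPolynomial (Fin 1) F) q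

end LocalAlgebra

/-! ### Smooth curves are regular; connected ones are integral -/

section Stalks
variable {k : Type u} [Field k] {X : Scheme.{u}} (f : X ⟶ Spec (.of k))
  [SmoothOfRelativeDimension 1 f]
include f

/-- The scheme `X` is not assumed integral here: for an abstract cover, integrality is deduced from
this description of its stalks. -/
theorem stalk_of_smooth (x : X) : ∃ _ : IsDomain (X.presheaf.stalk x),
    IsField (X.presheaf.stalk x) ∨ IsDiscreteValuationRing (X.presheaf.stalk x) := by
  obtain ⟨U, hU, V, hV, hxV, e, h⟩ :=
    SmoothOfRelativeDimension.exists_isStandardSmoothOfRelativeDimension (n := 1) (f := f) x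
  have hUt : U = ⊤ := by
    ext y
    simp only [SetLike.mem_coe, TopologicalSpace.Opens.coe_top, Set.mem_univ, iff_true]
    rw [Subsingleton.elim y (f x)]
    exact e hxV
  subst hUt
  have hF : IsField Γ(Spec (.of k), ⊤) :=
    (Scheme.ΓSpecIso (.of k)).commRingCatIsoToRingEquiv.toMulEquiv.isField (Field.toIsField k)
  let := hF.toField
  let := (f.appLE ⊤ V e).hom.toAlgebra
  have : Algebra.IsStandardSmoothOfRelativeDimension 1 Γ(Spec (.of k), ⊤) Γ(X, V) := h
  let := X.presheaf.algebra_section_stalk ⟨x, hxV⟩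
  have := hV.isLocalization_stalk ⟨x, hxV⟩
  exact isDomain_of_isStandardSmooth (F := Γ(Spec (.of k), ⊤))
    (hV.primeIdealOf ⟨x, hxV⟩).asIdeal (L := X.presheaf.stalk x)

theorem coheight_eq_one_or_eq_genericPoint [AlgebraicGeometry.IsIntegral X] (x : X) :
    Order.coheight x = 1 ∨ x = genericPoint X := by
  have h1 := ringKrullDim_stalk_eq_coheight x
  obtain ⟨_, h | h⟩ := stalk_of_smooth f x
  · right
    rw [ringKrullDim_eq_zero_of_isField h] at h1
    have h2 : Order.coheight x = 0 := by exact_mod_cast h1.symm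
    rw [Order.coheight_eq_zero] at h2
    have h3 : genericPoint X ⤳ x := genericPoint_specializes x
    exact (Specializes.antisymm (show x ⤳ genericPoint X from h2 h3) h3).eq
  · left
    rw [IsDiscreteValuationRing.ringKrullDim_eq_one] at h1
    exact_mod_cast h1.symm

/-- The stalks are domains, so only one irreducible component passes through each point. The
finitely many components are therefore disjoint, hence open and closed. -/
theorem isIntegral_of_smooth_of_connected [IsNoetherian X] [ConnectedSpace X] :
    AlgebraicGeometry.IsIntegral X := by
  have : IsReduced X := by
    have (x : X) : IsReduced (X.presheaf.stalk x) := by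
      obtain ⟨_, -⟩ := stalk_of_smooth f x
      infer_instance
    exact isReduced_of_isReduced_stalk X
  have key (Z₁ Z₂ : Set X) (h₁ : Z₁ ∈ irreducibleComponents X) (h₂ : Z₂ ∈ irreducibleComponents X)
      (x : X) (hx₁ : x ∈ Z₁) (hx₂ : x ∈ Z₂) : Z₁ = Z₂ := by
    obtain ⟨_, -⟩ := stalk_of_smooth f x
    -- The generic point of a component through `x` generizes `x`, so it comes from the spectrum of
    -- the stalk; the point of the zero ideal there generizes it, and maximality of the component
    -- forces the two closures to agree.
    have hgen (Z : Set X) (h : Z ∈ irreducibleComponents X) (hx : x ∈ Z) :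
        Z = closure {X.fromSpecStalk x (⟨⊥, Ideal.isPrime_bot⟩ : PrimeSpectrum _)} := by
      obtain ⟨η, hη⟩ := QuasiSober.sober h.1 (isClosed_of_mem_irreducibleComponents Z h)
      have hηx : η ⤳ x := by rw [specializes_iff_mem_closure, hη.def]; exact hx
      obtain ⟨p, hp⟩ : η ∈ Set.range (X.fromSpecStalk x) := by
        rw [Scheme.range_fromSpecStalk]; exact hηx
      have h3 : X.fromSpecStalk x (⟨⊥, Ideal.isPrime_bot⟩ : PrimeSpectrum _) ⤳ η := by
        rw [← hp]
        refine Specializes.map ?_ (X.fromSpecStalk x).continuous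
        exact (PrimeSpectrum.le_iff_specializes _ _).mp (bot_le (a := p.asIdeal))
      have h4 : Z ⊆ closure {X.fromSpecStalk x (⟨⊥, Ideal.isPrime_bot⟩ : PrimeSpectrum _)} := by
        rw [← hη.def]
        exact closure_minimal (Set.singleton_subset_iff.mpr h3.mem_closure) isClosed_closure
      exact h4.antisymm (h.2 isIrreducible_singleton.closure h4)
    rw [hgen Z₁ h₁ hx₁, hgen Z₂ h₂ hx₂]
  have hfin : (irreducibleComponents X).Finite :=
    TopologicalSpace.NoetherianSpace.finite_irreducibleComponents
  obtain ⟨x₀⟩ : Nonempty X := inferInstance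
  have hclopen : IsClopen (irreducibleComponent x₀) := by
    refine ⟨isClosed_irreducibleComponent, ?_⟩
    have : (irreducibleComponent x₀)ᶜ =
        ⋃₀ (irreducibleComponents X \ {irreducibleComponent x₀}) := by
      ext y
      constructor
      · intro hy
        refine ⟨irreducibleComponent y, ⟨irreducibleComponent_mem_irreducibleComponents y,
          fun h => hy ?_⟩, mem_irreducibleComponent⟩
        rw [← Set.mem_singleton_iff.mp h]; exact mem_irreducibleComponent
      · rintro ⟨Z, ⟨hZ, hne⟩, hy⟩ hy'
        exact hne (key _ _ hZ (irreducibleComponent_mem_irreducibleComponents x₀) y hy hy')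
    rw [← isClosed_compl_iff, this, Set.sUnion_eq_biUnion]
    exact (hfin.subset Set.sdiff_subset).isClosed_biUnion fun Z hZ =>
      isClosed_of_mem_irreducibleComponents Z hZ.1
  have huniv : irreducibleComponent x₀ = Set.univ :=
    (isClopen_iff.mp hclopen).resolve_left (Set.nonempty_iff_ne_empty.mp ⟨x₀,
      mem_irreducibleComponent⟩)
  have : IrreducibleSpace X := by
    rw [irreducibleSpace_def, Set.top_eq_univ, ← huniv]
    exact isIrreducible_irreducibleComponent
  exact isIntegral_of_irreducibleSpace_of_isReduced _

theorem isDedekindDomain [AlgebraicGeometry.IsIntegral X] [IsLocallyNoetherian X] {U : X.Opens}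
    (hU : IsAffineOpen U) [Nonempty U] : IsDedekindDomain Γ(X, U) := by
  have : IsDedekindDomainDvr Γ(X, U) := by
    have : IsNoetherianRing Γ(X, U) := IsLocallyNoetherian.component_noetherian ⟨U, hU⟩
    refine { is_dvr_at_nonzero_prime := fun P hP hPp => ?_ }
    let x : X := hU.fromSpec (⟨P, hPp⟩ : PrimeSpectrum Γ(X, U))
    have hx : x ∈ U := by
      rw [← SetLike.mem_coe, ← hU.range_fromSpec]; exact Set.mem_range_self _
    let := X.presheaf.algebra_section_stalk ⟨x, hx⟩
    have hloc : IsLocalization P.primeCompl (X.presheaf.stalk x) :=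
      hU.isLocalization_stalk' ⟨P, hPp⟩ hx
    let e := (IsLocalization.algEquiv P.primeCompl (X.presheaf.stalk x)
      (Localization.AtPrime P)).toRingEquiv
    obtain ⟨_, h | h⟩ := stalk_of_smooth f x
    · exact (IsLocalization.AtPrime.not_isField Γ(X, U) hP (Localization.AtPrime P)
        (e.symm.toMulEquiv.isField h)).elim
    · exact IsDiscreteValuationRing.RingEquivClass.isDiscreteValuationRing e
  infer_instance

end Stalks

/-! ### Orders, local equations and constants on a curve -/

section Orders
variable {X : Scheme.{u}} [AlgebraicGeometry.IsIntegral X] [IsNoetherian X]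

theorem ord_zpow {f : X.functionField} (hf : f ≠ 0) (n : ℤ) (x : X) :
    Scheme.ord (f ^ n) x = n * Scheme.ord f x := by
  cases n with
  | ofNat n => simpa using ord_pow hf n x
  | negSucc n =>
    rw [zpow_negSucc, ord_inv (pow_ne_zero _ hf), ord_pow hf, Int.negSucc_eq]
    push_cast; ring

variable [RegularInCodimOne X]

/-- The stalk is a valuation ring: if `c` is not in it, then `c⁻¹` is, and nonnegativity of both
orders makes `c⁻¹` a unit of the stalk. -/
theorem isSectionAt_zero_iff {x : PrimeDivisor X} {c : X.functionField} :
    IsSectionAt 0 x c ↔ c ∈ (algebraMap (X.presheaf.stalk x.1) X.functionField).range := by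
  have := RegularInCodimOne.isDVR_stalk x.1 x.2
  have h1 (a : X.presheaf.stalk x.1) (ha : a ≠ 0) :
      0 ≤ Scheme.ord (algebraMap (X.presheaf.stalk x.1) X.functionField a) x.1 := by
    have h0 : algebraMap (X.presheaf.stalk x.1) X.functionField a ≠ 0 := by
      rwa [map_ne_zero_iff _ (IsFractionRing.injective _ _)]
    rw [Scheme.le_ord_iff x.2 h0]
    exact Ring.ordFrac_ge_one_of_ne_zero ha
  constructor
  · intro h
    by_cases hc : c = 0
    · exact hc ▸ zero_mem _
    rcases ValuationRing.isInteger_or_isInteger (X.presheaf.stalk x.1) c with hi | ⟨a, ha⟩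
    · exact hi
    have ha0 : a ≠ 0 := by
      rintro rfl
      rw [map_zero] at ha
      exact inv_ne_zero hc ha.symm
    have h2 := h1 a ha0
    rw [ha, ord_inv hc] at h2
    have h3 := h.resolve_left hc
    have h4 : Scheme.ord c⁻¹ x.1 = 0 := by
      rw [ord_inv hc]
      simp only [Finsupp.coe_zero, Pi.zero_apply] at h3
      omega
    rw [Scheme.ord_eq_iff x.2 (inv_ne_zero hc), ← ha] at h4
    have hu : IsUnit a :=
      (Ring.isUnit_iff_ordFrac_one_of_isDiscreteValuationRing (K := X.functionField)).mpr h4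
    obtain ⟨u, rfl⟩ := hu
    refine ⟨(u⁻¹ : (X.presheaf.stalk x.1)ˣ), ?_⟩
    rw [← inv_inv c, ← ha]
    refine eq_inv_of_mul_eq_one_left ?_
    rw [← map_mul, Units.inv_mul, map_one]
  · rintro ⟨a, rfl⟩
    by_cases ha : a = 0
    · exact .inl (by rw [ha, map_zero])
    · exact .inr (by simpa using h1 a ha)

theorem exists_ord_eq_one (x : PrimeDivisor X) :
    ∃ t : X.functionField, t ≠ 0 ∧ Scheme.ord t x.1 = 1 := by
  have := RegularInCodimOne.isDVR_stalk x.1 x.2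
  obtain ⟨ϖ, hϖ⟩ := IsDiscreteValuationRing.exists_irreducible (X.presheaf.stalk x.1)
  have h0 : algebraMap (X.presheaf.stalk x.1) X.functionField ϖ ≠ 0 := by
    rw [map_ne_zero_iff _ (IsFractionRing.injective _ _)]
    exact hϖ.ne_zero
  exact ⟨_, h0, (Scheme.ord_eq_iff x.2 h0).mpr (Ring.ordFrac_irreducible hϖ)⟩

end Orders

namespace SmoothProjectiveCurve
variable {k : Type u} [Field k] (C : SmoothProjectiveCurve k)

/-- A proper specialization would have coheight at least two, while points of a smooth curve have
coheight one or are generic. -/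
theorem isClosed_primeDivisor (x : PrimeDivisor C.scheme) : IsClosed {x.1} := by
  refine isClosed_of_closure_subset fun z hz => ?_
  have hxz : x.1 ⤳ z := specializes_iff_mem_closure.mpr hz
  have hle : z ≤ x.1 := hxz
  by_contra hne
  have hlt : z < x.1 := lt_of_le_not_ge hle fun h => hne
    (Specializes.antisymm (show z ⤳ x.1 from h) hxz).eq
  have h1 := Order.coheight_add_one_le hlt
  rw [x.2] at h1
  rcases coheight_eq_one_or_eq_genericPoint C.str z with h | h
  · rw [h] at h1
    norm_num at h1
  · subst h
    exact hne (Specializes.antisymm (genericPoint_specializes x.1) hxz).eq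

theorem exists_affineOpen_notMem (x : C.scheme) (T : Set (PrimeDivisor C.scheme)) (hT : T.Finite)
    (hx : ∀ y ∈ T, y.1 ≠ x) :
    ∃ U : C.scheme.Opens, IsAffineOpen U ∧ x ∈ U ∧ ∀ y ∈ T, y.1 ∉ U := by
  have hcl : IsClosed (⋃ y ∈ T, {y.1}) := hT.isClosed_biUnion fun y _ => C.isClosed_primeDivisor y
  obtain ⟨_, ⟨U, hU, rfl⟩, h, hUT⟩ := C.scheme.isBasis_affineOpens.exists_subset_of_mem_open
    (a := x) (u := (⋃ y ∈ T, {y.1})ᶜ) (by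
      simp only [Set.mem_compl_iff, Set.mem_iUnion, not_exists]
      exact fun y hy h => hx y hy h.symm) hcl.isOpen_compl
  refine ⟨U, hU, h, fun y hy hyU => hUT hyU ?_⟩
  exact Set.mem_biUnion hy rfl

/-- Finitely many divisors are principal in a neighbourhood of a point. -/
theorem exists_local_equations (x : C.scheme) {ι : Type*} [Finite ι] (F : ι → Divisor C.scheme)
    (T : Set (PrimeDivisor C.scheme)) (hT : T.Finite) :
    ∃ U : C.scheme.Opens, IsAffineOpen U ∧ x ∈ U ∧ (∀ y ∈ T, y.1 ∈ U → y.1 = x) ∧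
      ∃ h : ι → C.scheme.functionField, (∀ i, h i ≠ 0) ∧
        ∀ i (y : PrimeDivisor C.scheme), y.1 ∈ U → Scheme.ord (h i) y.1 = F i y := by
  have hS : (⋃ i, ((F i).support : Set (PrimeDivisor C.scheme))).Finite :=
    Set.finite_iUnion fun i => Finset.finite_toSet _
  rcases coheight_eq_one_or_eq_genericPoint C.str x with hx | hx
  -- Take a uniformizer `t` at `x` and remove all other points of the supports, of `T`, and of the
  -- zeros and poles of `t`; then `t ^ (F i x)` is an equation of `F i`. At the generic point one
  -- removes everything and uses the equation `1`.
  · obtain ⟨t, ht, ht1⟩ := exists_ord_eq_one (⟨x, hx⟩ : PrimeDivisor C.scheme)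
    obtain ⟨U, hU, hxU, h⟩ := C.exists_affineOpen_notMem x
      (((⋃ i, ((F i).support : Set (PrimeDivisor C.scheme))) ∪ T ∪
        {y | Scheme.ord t y.1 ≠ 0}) \ {⟨x, hx⟩})
      (((hS.union hT).union (finite_ord_ne_zero t)).subset Set.sdiff_subset)
      fun y hy h => hy.2 (Subtype.ext h)
    refine ⟨U, hU, hxU, fun y hy hyU => ?_, fun i => t ^ (F i ⟨x, hx⟩),
      fun i => zpow_ne_zero _ ht, fun i y hyU => ?_⟩
    · by_contra hne
      exact h y ⟨.inl (.inr hy), fun e => hne (congrArg Subtype.val e)⟩ hyU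
    · rw [ord_zpow ht]
      by_cases hne : y = ⟨x, hx⟩
      · subst hne
        rw [ht1, mul_one]
      · have h1 : F i y = 0 := by
          by_contra h0
          exact h y ⟨.inl (.inl (Set.mem_iUnion_of_mem i (by simpa using h0))), hne⟩ hyU
        have h2 : Scheme.ord t y.1 = 0 := by
          by_contra h0
          exact h y ⟨.inr h0, hne⟩ hyU
        rw [h1, h2, mul_zero]
  · obtain ⟨U, hU, hxU, h⟩ := C.exists_affineOpen_notMem x
      ((⋃ i, ((F i).support : Set (PrimeDivisor C.scheme))) ∪ T) (hS.union hT)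
      fun y _ h => by
        have h1 := y.2
        have h2 : Order.coheight (genericPoint C.scheme) = 0 := by
          rw [Order.coheight_eq_zero]
          exact fun z _ => (genericPoint_specializes z : genericPoint C.scheme ⤳ z)
        rw [h, hx, h2] at h1
        exact zero_ne_one h1
    refine ⟨U, hU, hxU, fun y hy hyU => (h y (.inr hy) hyU).elim, fun _ => 1,
      fun _ => one_ne_zero, fun i y hyU => ?_⟩
    have h1 : F i y = 0 := by
      by_contra h0
      exact h y (.inl (Set.mem_iUnion_of_mem i (by simpa using h0))) hyU
    rw [h1, ord_one]

theorem exists_germ_mul_eq {U : C.scheme.Opens} (hU : IsAffineOpen U) [Nonempty U]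
    {c : C.scheme.functionField} {x : C.scheme} (hx : x ∈ U)
    (hc : ∀ y : PrimeDivisor C.scheme, y.1 = x → IsSectionAt 0 y c) :
    ∃ s b : Γ(C.scheme, U), x ∈ C.scheme.basicOpen s ∧
      C.scheme.germToFunctionField U s * c = C.scheme.germToFunctionField U b := by
  rcases coheight_eq_one_or_eq_genericPoint C.str x with h | h
  · obtain ⟨(a : C.scheme.presheaf.stalk x), ha⟩ := isSectionAt_zero_iff.mp (hc ⟨x, h⟩ rfl)
    let := C.scheme.presheaf.algebra_section_stalk ⟨x, hx⟩
    have hloc := hU.isLocalization_stalk ⟨x, hx⟩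
    obtain ⟨b, s, rfl⟩ := IsLocalization.exists_mk'_eq
      (hU.primeIdealOf ⟨x, hx⟩).asIdeal.primeCompl a
    have h1 (g : Γ(C.scheme, U)) : C.scheme.germToFunctionField U g =
        algebraMap (C.scheme.presheaf.stalk x) C.scheme.functionField
          (algebraMap Γ(C.scheme, U) (C.scheme.presheaf.stalk x) g) :=
      (Scheme.algebraMap_germ_eq_germToFunctionField _ hx g).symm
    refine ⟨s, b, ?_, ?_⟩
    · rw [C.scheme.mem_basicOpen s.1 x hx]
      exact IsLocalization.map_units (C.scheme.presheaf.stalk x) s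
    · rw [h1, h1, ← ha, ← map_mul]
      exact congrArg _ (IsLocalization.mk'_spec' _ b s)
  · have hfrac := functionField_isFractionRing_of_isAffineOpen C.scheme U hU
    obtain ⟨b, s, hs, rfl⟩ := IsFractionRing.div_surjective (A := Γ(C.scheme, U)) c
    have hs0 := nonZeroDivisors.ne_zero hs
    have hne : Nonempty (C.scheme.basicOpen s) := by
      by_contra hE
      rw [not_nonempty_iff] at hE
      refine hs0 ((basicOpen_eq_bot_iff s).mp ?_)
      ext y
      exact ⟨fun hy => (hE.false ⟨y, hy⟩).elim, fun hy => hy.elim⟩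
    refine ⟨s, b, h ▸ genericPoint_mem _, mul_div_cancel₀ _ ?_⟩
    rwa [map_ne_zero_iff _ (Scheme.germToFunctionField_injective C.scheme U)]

/-- The ideal of denominators of `c` in `Γ(U)` has an element nonvanishing at each point of `U`, by
`exists_germ_mul_eq`; so it contains `1`. -/
theorem mem_range_germ {U : C.scheme.Opens} (hU : IsAffineOpen U) [Nonempty U]
    {c : C.scheme.functionField} (hc : ∀ y : PrimeDivisor C.scheme, y.1 ∈ U → IsSectionAt 0 y c) :
    c ∈ (C.scheme.germToFunctionField U).hom.range := by
  let I : Ideal Γ(C.scheme, U) :=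
    { carrier := {a | C.scheme.germToFunctionField U a * c ∈
      (C.scheme.germToFunctionField U).hom.range}
      zero_mem' := by
        simp only [Set.mem_ofPred_eq, map_zero, zero_mul]; exact zero_mem _
      add_mem' := fun {a b} ha hb => by
        simp only [Set.mem_ofPred_eq, map_add, add_mul] at *; exact add_mem ha hb
      smul_mem' := fun a b hb => by
        simp only [Set.mem_ofPred_eq, smul_eq_mul, map_mul, mul_assoc] at *
        exact mul_mem ⟨a, rfl⟩ hb }
  have hI : Ideal.span (I : Set Γ(C.scheme, U)) = ⊤ := by
    rw [← hU.iSup_basicOpen_eq_self_iff]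
    refine le_antisymm (iSup_le fun _ => C.scheme.basicOpen_le _) fun x hx => ?_
    obtain ⟨s, b, hxs, hs⟩ := C.exists_germ_mul_eq hU (c := c) hx
      fun y hy => hc y (hy ▸ hx)
    exact TopologicalSpace.Opens.mem_iSup.mpr ⟨⟨s, b, hs.symm⟩, hxs⟩
  rw [Ideal.span_eq] at hI
  have h1 : (1 : Γ(C.scheme, U)) ∈ I := hI ▸ trivial
  have h2 : C.scheme.germToFunctionField U 1 * c ∈ (C.scheme.germToFunctionField U).hom.range := h1
  rwa [map_one, one_mul] at h2

/-- Such a function is regular on every affine open and these sections glue. Properness makes the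
ring of global sections integral over `k`, so it equals `k`. -/
theorem exists_const_eq [IsAlgClosed k] {c : C.scheme.functionField}
    (h : ∀ y : PrimeDivisor C.scheme, Scheme.ord c y.1 = 0) : ∃ a : k, C.const a = c := by
  have h1 (U : C.scheme.affineOpens) : ∃ s : Γ(C.scheme, U.1),
      ∀ _ : Nonempty U.1, C.scheme.germToFunctionField U.1 s = c := by
    rcases isEmpty_or_nonempty U.1 with hE | hne
    · exact ⟨0, fun ⟨y⟩ => (hE.false y).elim⟩
    · obtain ⟨s, hs⟩ := C.mem_range_germ U.2 (c := c) fun y _ => .inr (by simp [h y])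
      exact ⟨s, fun _ => hs⟩
  choose s hs using h1
  have hcompat : TopCat.Presheaf.IsCompatible C.scheme.presheaf
      (fun U : C.scheme.affineOpens => U.1) s := by
    intro U V
    rcases isEmpty_or_nonempty (U.1 ⊓ V.1 : C.scheme.Opens) with hE | hne
    · have : U.1 ⊓ V.1 = ⊥ := by
        ext y; exact ⟨fun hy => (hE.false ⟨y, hy⟩).elim, fun hy => hy.elim⟩
      have : Subsingleton Γ(C.scheme, U.1 ⊓ V.1) := by rw [this]; infer_instance
      exact Subsingleton.elim (α := Γ(C.scheme, U.1 ⊓ V.1)) _ _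
    · obtain ⟨y, hy⟩ := id hne
      have h1 : Nonempty U.1 := ⟨⟨y, hy.1⟩⟩
      have h2 : Nonempty V.1 := ⟨⟨y, hy.2⟩⟩
      refine Scheme.germToFunctionField_injective C.scheme (U.1 ⊓ V.1) ?_
      refine (C.scheme.presheaf.germ_res_apply (homOfLE inf_le_left) _ _ (s U)).trans
        (Eq.trans ?_ (C.scheme.presheaf.germ_res_apply (homOfLE inf_le_right) _ _ (s V)).symm)
      exact (hs U h1).trans (hs V h2).symm
  obtain ⟨t, ht, -⟩ := C.scheme.sheaf.existsUnique_gluing' (fun U : C.scheme.affineOpens => U.1) ⊤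
    (fun U => homOfLE le_top) (by rw [iSup_affineOpens_eq_top]) s hcompat
  have : Nonempty (⊤ : C.scheme.Opens) := ⟨⟨genericPoint C.scheme, trivial⟩⟩
  have htc : C.scheme.germToFunctionField ⊤ t = c := by
    obtain ⟨U, hU, hη⟩ := exists_affineOpen_mem (genericPoint C.scheme)
    have : Nonempty U := ⟨⟨_, hη⟩⟩
    have h2 := hs ⟨U, hU⟩ this
    rw [← h2, ← ht ⟨U, hU⟩]
    exact (C.scheme.presheaf.germ_res_apply (homOfLE le_top) _ _ t).symm
  have hint : ((Scheme.ΓSpecIso (.of k)).inv ≫ C.str.appTop).hom.IsIntegral :=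
    RingHom.isIntegral_respectsIso.2 (e := (Scheme.ΓSpecIso (.of k)).symm.commRingCatIsoToRingEquiv)
      _ (isIntegral_appTop_of_universallyClosed C.str)
  let := ((Scheme.ΓSpecIso (.of k)).inv ≫ C.str.appTop).hom.toAlgebra
  have : Algebra.IsIntegral k Γ(C.scheme, ⊤) := ⟨hint⟩
  obtain ⟨a, ha⟩ := (IsAlgClosed.algebraMap_bijective_of_isIntegral (k := k)
    (K := Γ(C.scheme, ⊤))).2 t
  refine ⟨a, ?_⟩
  rw [← htc, ← ha]
  rfl

end SmoothProjectiveCurve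

/-! ### Type T1 as absence of relations modulo `m` -/

section TypeT1
variable {A : Type*} [AddCommGroup A]

theorem exists_sum_of_mem_closure {B : Finset A} {B₁ : Set A} (hB : B₁ ⊆ B) {z : A}
    (hz : z ∈ AddSubgroup.closure B₁) :
    ∃ a : B → ℤ, (∀ b, b.1 ∉ B₁ → a b = 0) ∧ ∑ b, a b • b.1 = z := by
  classical
  induction hz using AddSubgroup.closure_induction with
  | mem x hx =>
    refine ⟨Pi.single ⟨x, hB hx⟩ 1, fun b hb => ?_, ?_⟩
    · rw [Pi.single_apply, if_neg]
      rintro rfl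
      exact hb hx
    · rw [Fintype.sum_eq_single ⟨x, hB hx⟩]
      · simp
      · intro b hb
        rw [Pi.single_apply, if_neg hb, zero_smul]
  | zero => exact ⟨0, fun _ _ => rfl, by simp⟩
  | add x y _ _ hx hy =>
    obtain ⟨a, ha, rfl⟩ := hx
    obtain ⟨a', ha', rfl⟩ := hy
    exact ⟨a + a', fun b hb =>
      by simp [ha b hb, ha' b hb], by simp [add_smul, Finset.sum_add_distrib]⟩
  | neg x _ hx =>
    obtain ⟨a, ha, rfl⟩ := hx
    exact ⟨-a, fun b hb => by simp [ha b hb], by simp⟩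

/-- A relation puts `a b • b` both in `⟨b⟩` and in the subgroup generated by the other elements.
Conversely, two expressions of one element over disjoint subsets differ by a relation, whose
coefficients kill the generators because these have order `m`. -/
theorem isTypeT1_iff {B : Finset A} {m : ℕ} (hB : ∀ b ∈ B, addOrderOf b = m) :
    IsTypeT1 (B : Set A) ↔ ∀ a : B → ℤ, ∑ b, a b • b.1 = 0 → ∀ b, (m : ℤ) ∣ a b := by
  classical
  have hdvd (b : B) (n : ℤ) : (m : ℤ) ∣ n ↔ n • b.1 = 0 := by
    rw [← hB b.1 b.2, addOrderOf_dvd_iff_zsmul_eq_zero]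
  constructor
  · intro h a ha b
    rw [hdvd]
    have h1 := h {b.1} (Set.singleton_subset_iff.mpr b.2) ((B : Set A) \ {b.1}) Set.sdiff_subset
      Set.disjoint_sdiff_right
    have h2 : a b • b.1 ∈ AddSubgroup.closure {b.1} ⊓ AddSubgroup.closure ((B : Set A) \ {b.1}) :=
      by
      refine AddSubgroup.mem_inf.mpr ⟨zsmul_mem (AddSubgroup.subset_closure
        (Set.mem_singleton _)) _, ?_⟩
      rw [← Finset.add_sum_erase _ _ (Finset.mem_univ b)] at ha
      rw [eq_neg_of_add_eq_zero_left ha]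
      refine neg_mem (sum_mem fun c hc => zsmul_mem (AddSubgroup.subset_closure ?_) _)
      exact ⟨c.2, fun hcb => (Finset.mem_erase.mp hc).1 (Subtype.ext hcb)⟩
    exact AddSubgroup.mem_bot.mp (h1 ▸ h2)
  · intro h B₁ h₁ B₂ h₂ hd
    refine (AddSubgroup.eq_bot_iff_forall _).mpr fun z hz => ?_
    obtain ⟨a, ha, hz₁⟩ := exists_sum_of_mem_closure h₁ hz.1
    obtain ⟨a', ha', hz₂⟩ := exists_sum_of_mem_closure h₂ hz.2
    rw [← hz₁]
    refine Finset.sum_eq_zero fun b _ => (hdvd b _).mp ?_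
    by_cases hb : b.1 ∈ B₁
    · have h3 := h (a - a') (by
        simp only [Pi.sub_apply, sub_smul, Finset.sum_sub_distrib, hz₁, hz₂, sub_self]) b
      rwa [Pi.sub_apply, ha' b (Set.disjoint_left.mp hd hb), sub_zero] at h3
    · rw [ha b hb]; exact dvd_zero _

end TypeT1

theorem ord_prod {X : Scheme.{u}} [AlgebraicGeometry.IsIntegral X] [IsNoetherian X] {ι : Type*}
    (s : Finset ι) {f : ι → X.functionField} (hf : ∀ i, f i ≠ 0) (x : X) :
    Scheme.ord (∏ i ∈ s, f i) x = ∑ i ∈ s, Scheme.ord (f i) x := by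
  classical
  induction s using Finset.induction_on with
  | empty => simp [ord_one]
  | insert i s hi ih =>
    rw [Finset.prod_insert hi, Finset.sum_insert hi,
      Scheme.ord_mul (hf i) (Finset.prod_ne_zero_iff.mpr fun j _ => hf j), ih]

/-! ### The group `P_m` inside the functions modulo `m`-th powers -/

namespace KummerDatum
section
variable {Y : Scheme.{u}} [AlgebraicGeometry.IsIntegral Y] [IsNoetherian Y] {m : ℕ}
  {S : Finset (PrimeDivisor Y)}

/-- An integral combination of representatives. -/
noncomputable def linearCombination {ι : Type*} [Fintype ι] (d : ι → KummerDatum m S) (a : ι → ℤ) :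
    KummerDatum m S where
  E := ∑ i, a i • (d i).E
  D := ∑ i, a i • (d i).D
  support_subset := by
    classical
    refine Finsupp.support_finsetSum.trans (Finset.biUnion_subset.mpr fun i _ => ?_)
    exact Finsupp.support_smul.trans (d i).support_subset
  f := ∏ i, (d i).f ^ a i
  f_ne_zero := Finset.prod_ne_zero_iff.mpr fun i _ => zpow_ne_zero _ (d i).f_ne_zero
  ord_f x := by
    rw [ord_prod _ fun i => zpow_ne_zero _ (d i).f_ne_zero]
    simp only [ord_zpow (d _).f_ne_zero, (d _).ord_f, Finsupp.coe_finsetSum, Finset.sum_apply,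
      Finsupp.coe_smul, Pi.smul_apply, smul_eq_mul, Finset.mul_sum, ← Finset.sum_add_distrib]
    exact Finset.sum_congr rfl fun i _ => by ring

theorem toGenPic_linearCombination {ι : Type*} [Fintype ι] (d : ι → KummerDatum m S) (a : ι → ℤ) :
    (linearCombination d a).toGenPic = ∑ i, a i • (d i).toGenPic := by
  simp only [toGenPic, ← QuotientAddGroup.mk_zsmul, ← QuotientAddGroup.mk_sum]
  congr 1
  refine Subtype.ext (Prod.ext ?_ ?_)
  · simp [linearCombination, Prod.fst_sum, QuotientAddGroup.mk_sum, QuotientAddGroup.mk_zsmul]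
  · simp [linearCombination, Prod.snd_sum]

theorem exists_reduced [NeZero m] (a : GenPic m S) :
    ∃ d : KummerDatum m S, d.toGenPic = a ∧ ∀ x, 0 ≤ d.D x ∧ d.D x < m := by
  obtain ⟨⟨⟨e, D⟩, hD, h⟩, rfl⟩ := QuotientAddGroup.mk_surjective a
  obtain ⟨E, rfl⟩ := QuotientAddGroup.mk_surjective e
  simp only [] at hD h
  rw [← QuotientAddGroup.mk_nsmul, QuotientAddGroup.eq] at h
  obtain ⟨g, hg, hgord⟩ := h
  -- Coefficientwise Euclidean division: adding `F` to `E` and subtracting `m F` from `D` changes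
  -- the pair by a trivial one, keeps `m E + D`, and leaves the remainders of `D` modulo `m`. The
  -- function `g` has divisor `-(m E + D)`, whence the inverse.
  let F : Divisor Y := D.mapRange (fun n => n / m) (by simp)
  have hm0 : (0 : ℤ) < m := by exact_mod_cast Nat.pos_of_ne_zero (NeZero.ne m)
  have hF (x) : F x = D x / m := by simp [F]
  refine ⟨⟨E + F, D - m • F, ?_, g⁻¹, inv_ne_zero hg, fun x => ?_⟩, ?_, fun x => ?_⟩
  · intro x hx
    refine hD (Finsupp.mem_support_iff.mpr fun h0 => Finsupp.mem_support_iff.mp hx ?_)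
    simp [hF, h0]
  · rw [ord_inv hg, ← hgord]
    simp; ring
  · rw [toGenPic, QuotientAddGroup.eq, AddSubgroup.mem_addSubgroupOf]
    refine ⟨F, ?_, ?_⟩
    · intro x hx
      refine hD (Finsupp.mem_support_iff.mpr fun h0 => Finsupp.mem_support_iff.mp hx ?_)
      simp [hF, h0]
    · refine Prod.ext ?_ ?_
      · simp only [AddSubgroup.coe_add, NegMemClass.coe_neg, Prod.fst_add, Prod.fst_neg,
          ← QuotientAddGroup.mk_neg, ← QuotientAddGroup.mk_add]
        congr 1; abel
      · simp only [AddSubgroup.coe_add, NegMemClass.coe_neg, Prod.snd_add, Prod.snd_neg]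
        abel
  · have h1 := Int.emod_nonneg (D x) hm0.ne'
    have h2 := Int.emod_lt_of_pos (D x) hm0
    have h3 := Int.emod_add_mul_ediv (D x) m
    simp only [Finsupp.sub_apply, Finsupp.smul_apply, nsmul_eq_mul, hF]
    constructor <;> linarith

end

section
variable {k : Type u} [Field k] [IsAlgClosed k] {C : SmoothProjectiveCurve k} {m : ℕ} [NeZero m]
  {S : Finset (PrimeDivisor C.scheme)}

/-- The injectivity of `P_m` into functions modulo `m`-th powers. Equality of classes makes `d'.f /
(g ^ m d.f)` free of zeros and poles; conversely `f' = g ^ m f` shows that `D' - D` is divisible by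
`m`, and the quotient is the divisor of the trivial pair. -/
theorem toGenPic_eq_iff {d d' : KummerDatum m S} :
    d.toGenPic = d'.toGenPic ↔ ∃ g : C.scheme.functionField, g ≠ 0 ∧ d'.f = g ^ m * d.f := by
  have hm0 : (m : ℤ) ≠ 0 := by exact_mod_cast NeZero.ne m
  rw [toGenPic, toGenPic, QuotientAddGroup.eq, AddSubgroup.mem_addSubgroupOf]
  constructor
  · rintro ⟨F, -, hF⟩
    obtain ⟨h1, h2⟩ := Prod.ext_iff.mp hF
    simp only [AddSubgroup.coe_add, NegMemClass.coe_neg, Prod.fst_add, Prod.fst_neg,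
      Prod.snd_add, Prod.snd_neg] at h1 h2
    rw [← QuotientAddGroup.mk_neg, ← QuotientAddGroup.mk_add, eq_comm, QuotientAddGroup.eq] at h1
    obtain ⟨g, hg, hgord⟩ := h1
    obtain ⟨c, hc⟩ := C.exists_const_eq (c := d'.f / (g ^ m * d.f)) fun y => by
      rw [div_eq_mul_inv, Scheme.ord_mul d'.f_ne_zero
        (inv_ne_zero (mul_ne_zero (pow_ne_zero _ hg) d.f_ne_zero)),
        ord_inv (mul_ne_zero (pow_ne_zero _ hg) d.f_ne_zero),
        Scheme.ord_mul (pow_ne_zero _ hg) d.f_ne_zero, ord_pow hg, ← hgord, d.ord_f, d'.ord_f]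
      have h3 := congrArg (fun D => D y) h2
      simp at h3 ⊢
      linarith
    -- The constant is itself an `m`-th power and is absorbed into `g`; this is where algebraic
    -- closedness removes the dependence on the isomorphism `φ`.
    obtain ⟨b, rfl⟩ := IsAlgClosed.exists_pow_nat_eq c (Nat.pos_of_ne_zero (NeZero.ne m))
    have hb : C.const b ≠ 0 := by
      intro h0
      rw [map_pow, h0, zero_pow (NeZero.ne m), eq_comm, div_eq_zero_iff] at hc
      exact hc.elim d'.f_ne_zero (mul_ne_zero (pow_ne_zero _ hg) d.f_ne_zero)
    refine ⟨C.const b * g, mul_ne_zero hb hg, ?_⟩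
    rw [map_pow, eq_div_iff (mul_ne_zero (pow_ne_zero _ hg) d.f_ne_zero)] at hc
    rw [← hc]; ring
  · rintro ⟨g, hg, h⟩
    have hord (x : PrimeDivisor C.scheme) :
        (m : ℤ) * d'.E x + d'.D x = m * Scheme.ord g x.1 + (m * d.E x + d.D x) := by
      rw [← d'.ord_f, h, Scheme.ord_mul (pow_ne_zero _ hg) d.f_ne_zero, ord_pow hg, d.ord_f]
    let F : Divisor C.scheme := (d'.D - d.D).mapRange (fun n => n / m) (by simp)
    have hF (x) : m * F x = d'.D x - d.D x := by
      simp only [F, Finsupp.mapRange_apply, Finsupp.coe_sub, Pi.sub_apply]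
      exact Int.mul_ediv_cancel' ⟨Scheme.ord g x.1 + d.E x - d'.E x, by linarith [hord x]⟩
    refine ⟨F, fun x hx => ?_, Prod.ext ?_ ?_⟩
    · by_contra hxS
      have h1 : d.D x = 0 := Finsupp.notMem_support_iff.mp fun h => hxS (d.support_subset h)
      have h2 : d'.D x = 0 := Finsupp.notMem_support_iff.mp fun h => hxS (d'.support_subset h)
      have h3 := hF x
      rw [h1, h2, sub_zero] at h3
      exact Finsupp.mem_support_iff.mp hx ((mul_eq_zero.mp h3).resolve_left hm0)
    · simp only [AddSubgroup.coe_add, NegMemClass.coe_neg, Prod.fst_add, Prod.fst_neg,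
        ← QuotientAddGroup.mk_neg, ← QuotientAddGroup.mk_add]
      rw [eq_comm, QuotientAddGroup.eq]
      refine ⟨g, hg, fun x => ?_⟩
      refine mul_left_cancel₀ hm0 ?_
      have h3 := hF x
      have h4 := hord x
      simp only [Finsupp.add_apply, Finsupp.neg_apply]
      linarith
    · refine Finsupp.ext fun x => ?_
      have h3 := hF x
      simp
      linarith

theorem sum_toGenPic_eq_iff {ι : Type*} [Fintype ι] {d : ι → KummerDatum m S} {a : ι → ℤ}
    {e : KummerDatum m S} : ∑ i, a i • (d i).toGenPic = e.toGenPic ↔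
      ∃ g : C.scheme.functionField, g ≠ 0 ∧ e.f = g ^ m * ∏ i, (d i).f ^ a i := by
  rw [← toGenPic_linearCombination, toGenPic_eq_iff]
  rfl

/-- The dictionary between additive relations in `P_m` and multiplicative relations modulo `m`-th
powers; orders and type T1 are translated through it. -/
theorem sum_toGenPic_eq_zero_iff {ι : Type*} [Fintype ι] {d : ι → KummerDatum m S} {a : ι → ℤ} :
    ∑ i, a i • (d i).toGenPic = 0 ↔
      ∃ g : C.scheme.functionField, g ≠ 0 ∧ g ^ m = ∏ i, (d i).f ^ a i := by
  have h0 : (0 : GenPic m S) = (linearCombination d 0).toGenPic := by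
    simp [toGenPic_linearCombination]
  rw [h0, sum_toGenPic_eq_iff]
  have h1 : (linearCombination d 0).f = 1 := by simp [linearCombination]
  rw [h1]
  constructor
  · rintro ⟨g, hg, h⟩
    exact ⟨g⁻¹, inv_ne_zero hg, by rw [inv_pow]; exact inv_eq_of_mul_eq_one_right h.symm⟩
  · rintro ⟨g, hg, h⟩
    exact ⟨g⁻¹, inv_ne_zero hg, by rw [← h, inv_pow, inv_mul_cancel₀ (pow_ne_zero _ hg)]⟩

theorem addOrderOf_toGenPic_eq_iff {d : KummerDatum m S} : addOrderOf d.toGenPic = m ↔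
    ∀ n : ℤ, (∃ g : C.scheme.functionField, g ≠ 0 ∧ g ^ m = d.f ^ n) → (m : ℤ) ∣ n := by
  have key (n : ℤ) : n • d.toGenPic = 0 ↔
      ∃ g : C.scheme.functionField, g ≠ 0 ∧ g ^ m = d.f ^ n := by
    have := sum_toGenPic_eq_zero_iff (ι := Unit) (d := fun _ => d) (a := fun _ => n)
    rwa [Fintype.sum_unique, Fintype.prod_unique] at this
  constructor
  · intro h n hn
    rw [← h, addOrderOf_dvd_iff_zsmul_eq_zero]
    exact (key n).mpr hn
  · intro h
    refine Nat.dvd_antisymm ?_ ?_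
    · have := addOrderOf_dvd_iff_zsmul_eq_zero.mpr ((key m).mpr ⟨d.f, d.f_ne_zero, by simp⟩)
      exact_mod_cast this
    · have := h (addOrderOf d.toGenPic)
        ((key _).mp (by rw [natCast_zsmul, addOrderOf_nsmul_eq_zero]))
      exact_mod_cast this

end
end KummerDatum

theorem pullSections_bijective {X : Scheme.{u}} {R : Type u} [CommRing R]
    (w : Spec (.of R) ⟶ X) [IsOpenImmersion w] (V : X.Opens) (h : ⊤ ≤ w ⁻¹ᵁ V)
    (hV : V ≤ w.opensRange) : Function.Bijective (pullSections w V h) := by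
  have e : w ⁻¹ᵁ V = ⊤ := top_le_iff.mp h
  have : IsIso (homOfLE h) := ⟨⟨homOfLE e.le, Subsingleton.elim _ _, Subsingleton.elim _ _⟩⟩
  have := w.isIso_app V hV
  have h0 : Function.Bijective (w.app V) := ConcreteCategory.bijective_of_isIso _
  have h1 : Function.Bijective ((Spec (.of R)).presheaf.map (homOfLE h).op) :=
    ConcreteCategory.bijective_of_isIso _
  have h2 : Function.Bijective (Scheme.ΓSpecIso (.of R)).hom :=
    ConcreteCategory.bijective_of_isIso _
  exact h2.comp (h1.comp h0)

/-! ### Charts and generic fibre of the cyclic cover -/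

namespace KummerDatum
section
variable {Y : Scheme.{u}} [AlgebraicGeometry.IsIntegral Y] [IsNoetherian Y] [RegularInCodimOne Y]
  {m : ℕ} [NeZero m] {S : Finset (PrimeDivisor Y)} (d : KummerDatum m S)

/-- The part of the cyclic cover over an affine open subscheme. -/
noncomputable def chart {U : Y.Opens} (hU : IsAffineOpen U) :
    Spec (.of (d.sections U)) ⟶ d.cover.left :=
  colimit.ι d.glueData.functor (⟨U, hU⟩ : Y.AffineZariskiSite)

instance {U : Y.Opens} (hU : IsAffineOpen U) : IsOpenImmersion (d.chart hU) :=
  d.glueData.cover.map_prop (⟨U, hU⟩ : Y.AffineZariskiSite)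

theorem chart_hom {U : Y.Opens} (hU : IsAffineOpen U) :
    d.chart hU ≫ d.cover.hom = Spec.map (CommRingCat.ofHom (d.structureMap U)) ≫ hU.fromSpec := by
  refine (Scheme.Cover.RelativeGluingData.ι_toBase d.glueData (⟨U, hU⟩ :
    Y.AffineZariskiSite)).trans ?_
  refine (Category.assoc _ _ _).trans ?_
  refine congrArg (fun t => Spec.map (CommRingCat.ofHom (d.structureMap U)) ≫ t) ?_
  exact hU.isoSpec_inv_ι

theorem opensRange_chart {U : Y.Opens} (hU : IsAffineOpen U) :
    (d.chart hU).opensRange = d.cover.hom ⁻¹ᵁ U := by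
  have := d.glueData.toBase_preimage_eq_opensRange_ι (⟨U, hU⟩ : Y.AffineZariskiSite)
  refine this.symm.trans ?_
  congr 1
  exact U.opensRange_ι

theorem map_restrict_chart {U : Y.Opens} (hU : IsAffineOpen U) (g : Γ(Y, U)) :
    Spec.map (CommRingCat.ofHom (d.restrict (Y.basicOpen_le g))) ≫ d.chart hU =
      d.chart (hU.basicOpen g) :=
  colimit.w d.glueData.functor (homOfLE (Scheme.AffineZariskiSite.basicOpen_le
    (⟨U, hU⟩ : Y.AffineZariskiSite) g))

/-- The value of a section at the generic point. -/
noncomputable def genericValue (U : Y.Opens) [Nonempty U] : d.sections U →+* d.Alg :=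
  (Pi.evalRingHom (fun _ : U => d.Alg) ⟨genericPoint Y, genericPoint_mem U⟩).comp
    (d.sections U).subtype

theorem genericValue_injective (U : Y.Opens) [Nonempty U] :
    Function.Injective (d.genericValue U) := fun s t h =>
  Subtype.ext (funext fun y => by
    rw [s.2.1 y ⟨genericPoint Y, genericPoint_mem U⟩, t.2.1 y ⟨genericPoint Y, genericPoint_mem U⟩]
    exact h)

theorem mem_range_genericValue {U : Y.Opens} [Nonempty U] {a : d.Alg} :
    a ∈ (d.genericValue U).range ↔ ∀ x : PrimeDivisor Y, x.1 ∈ U → a ∈ d.localSubring x := by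
  constructor
  · rintro ⟨s, rfl⟩ x hx
    have := s.2.2 x hx
    rwa [s.2.1 ⟨x.1, hx⟩ ⟨genericPoint Y, genericPoint_mem U⟩] at this
  · intro h
    exact ⟨⟨fun _ => a, fun _ _ => rfl, fun x hx => h x hx⟩, rfl⟩

/-- The inclusion of the generic fibre of the cyclic cover. -/
noncomputable def genericFibre : Spec (.of d.Alg) ⟶ d.cover.left :=
  haveI : Nonempty (exists_affineOpen_mem (genericPoint Y)).choose :=
    ⟨⟨_, (exists_affineOpen_mem (genericPoint Y)).choose_spec.2⟩⟩
  Spec.map (CommRingCat.ofHom (d.genericValue (exists_affineOpen_mem (genericPoint Y)).choose)) ≫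
    d.chart (exists_affineOpen_mem (genericPoint Y)).choose_spec.1

theorem map_genericValue_basicOpen {U : Y.Opens} (hU : IsAffineOpen U) [Nonempty U] (g : Γ(Y, U))
    [Nonempty (Y.basicOpen g)] :
    Spec.map (CommRingCat.ofHom (d.genericValue (Y.basicOpen g))) ≫ d.chart (hU.basicOpen g) =
      Spec.map (CommRingCat.ofHom (d.genericValue U)) ≫ d.chart hU := by
  rw [← d.map_restrict_chart hU g, ← Category.assoc, ← Spec.map_comp]
  rfl

/-- Two affine opens share a basic open neighbourhood of the generic point, and the charts are
compatible with restriction to basic opens, so the choice made in the definition is immaterial. -/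
theorem genericFibre_eq {U : Y.Opens} (hU : IsAffineOpen U) [Nonempty U] :
    d.genericFibre = Spec.map (CommRingCat.ofHom (d.genericValue U)) ≫ d.chart hU := by
  have key {U V : Y.Opens} (hU : IsAffineOpen U) (hV : IsAffineOpen V) [Nonempty U] [Nonempty V] :
      Spec.map (CommRingCat.ofHom (d.genericValue U)) ≫ d.chart hU =
        Spec.map (CommRingCat.ofHom (d.genericValue V)) ≫ d.chart hV := by
    obtain ⟨f, g, hfg, hη⟩ := exists_basicOpen_le_affine_inter hU hV (genericPoint Y)
      ⟨genericPoint_mem U, genericPoint_mem V⟩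
    have h1 : Nonempty (Y.basicOpen f) := ⟨⟨_, hη⟩⟩
    have h2 : Nonempty (Y.basicOpen g) := ⟨⟨_, hfg ▸ hη⟩⟩
    rw [← d.map_genericValue_basicOpen hU f, ← d.map_genericValue_basicOpen hV g]
    -- The two basic opens are equal but presented differently; stating the equality for variable
    -- opens allows substitution.
    have h3 {A B : Y.Opens} (hA : IsAffineOpen A) (hB : IsAffineOpen B) [Nonempty A] [Nonempty B]
        (e : A = B) : Spec.map (CommRingCat.ofHom (d.genericValue A)) ≫ d.chart hA =
          Spec.map (CommRingCat.ofHom (d.genericValue B)) ≫ d.chart hB := by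
      subst e; rfl
    exact h3 _ _ hfg
  have : Nonempty (exists_affineOpen_mem (genericPoint Y)).choose :=
    ⟨⟨_, (exists_affineOpen_mem (genericPoint Y)).choose_spec.2⟩⟩
  exact key _ hU

theorem genericFibre_hom : d.genericFibre ≫ d.cover.hom = genericMap Y d.Alg := by
  obtain ⟨U, hU, hη⟩ := exists_affineOpen_mem (genericPoint Y)
  have : Nonempty U := ⟨⟨_, hη⟩⟩
  rw [d.genericFibre_eq hU, Category.assoc, chart_hom, genericMap_eq hU, ← Category.assoc,
    ← Spec.map_comp]
  rfl

theorem le_preimage_chart {U : Y.Opens} (hU : IsAffineOpen U) :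
    ⊤ ≤ d.chart hU ⁻¹ᵁ (d.cover.hom ⁻¹ᵁ U) := by
  rw [← opensRange_chart d hU]
  simp

theorem pullSections_genericFibre {U : Y.Opens} (hU : IsAffineOpen U) [Nonempty U] :
    pullSections d.genericFibre (d.cover.hom ⁻¹ᵁ U) (le_preimage_of_comp_eq d.genericFibre_hom U) =
      (d.genericValue U).comp (pullSections (d.chart hU) (d.cover.hom ⁻¹ᵁ U)
        (d.le_preimage_chart hU)) := by
  have h1 : ⊤ ≤ (Spec.map (CommRingCat.ofHom (d.genericValue U)) ≫ d.chart hU) ⁻¹ᵁ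
      (d.cover.hom ⁻¹ᵁ U) := by
    rw [← d.genericFibre_eq hU]
    exact le_preimage_of_comp_eq d.genericFibre_hom U
  rw [← pullSections_map_comp _ _ _ _ h1]
  congr 1
  exact d.genericFibre_eq hU

theorem pullSections_genericFibre_injective {U : Y.Opens} (hU : IsAffineOpen U) [Nonempty U] :
    Function.Injective (pullSections d.genericFibre (d.cover.hom ⁻¹ᵁ U)
      (le_preimage_of_comp_eq d.genericFibre_hom U)) := by
  rw [d.pullSections_genericFibre hU]
  exact (d.genericValue_injective U).comp
    (pullSections_bijective _ _ _ (d.opensRange_chart hU).ge).1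

/-- The bridge from the glued scheme to the explicit algebra: over an affine open the sections of
the cover are those elements of `K[z]/(z ^ m - f)` satisfying the pointwise conditions on
coefficients. -/
theorem mem_range_pullSections_genericFibre {U : Y.Opens} (hU : IsAffineOpen U) [Nonempty U]
    {a : d.Alg} : a ∈ (pullSections d.genericFibre (d.cover.hom ⁻¹ᵁ U)
      (le_preimage_of_comp_eq d.genericFibre_hom U)).range ↔
        ∀ x : PrimeDivisor Y, x.1 ∈ U → a ∈ d.localSubring x := by
  rw [d.pullSections_genericFibre hU, ← mem_range_genericValue]
  constructor
  · rintro ⟨s, rfl⟩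
    exact ⟨_, rfl⟩
  · rintro ⟨t, rfl⟩
    obtain ⟨s, rfl⟩ := (pullSections_bijective (d.chart hU) _ (d.le_preimage_chart hU)
      (d.opensRange_chart hU).ge).2 t
    exact ⟨s, rfl⟩

instance : IsAffineHom d.cover.hom := by
  refine isAffineHom_of_forall_exists_isAffineOpen _ fun y => ?_
  obtain ⟨U, hU, hy⟩ := exists_affineOpen_mem y
  exact ⟨U, hy, hU, d.opensRange_chart hU ▸ isAffineOpen_opensRange (d.chart hU)⟩

section
variable (ζ : Y.functionField) (hζ : ζ ^ m = 1)

theorem chart_rotation {U : Y.Opens} (hU : IsAffineOpen U) :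
    d.chart hU ≫ (d.rotation ζ hζ).left =
      Spec.map (CommRingCat.ofHom (d.scaleSections ζ hζ U)) ≫ d.chart hU :=
  ι_colimMap (d.scaleGlueData ζ hζ) (⟨U, hU⟩ : Y.AffineZariskiSite)

theorem genericFibre_rotation : d.genericFibre ≫ (d.rotation ζ hζ).left =
    Spec.map (CommRingCat.ofHom (d.scale ζ hζ)) ≫ d.genericFibre := by
  obtain ⟨U, hU, hη⟩ := exists_affineOpen_mem (genericPoint Y)
  have : Nonempty U := ⟨⟨_, hη⟩⟩
  rw [d.genericFibre_eq hU, Category.assoc, chart_rotation, ← Category.assoc, ← Category.assoc,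
    ← Spec.map_comp, ← Spec.map_comp]
  rfl
end
end
end KummerDatum
-- The cyclic cover is a normalization
namespace SmoothProjectiveCurve
variable {k : Type u} [Field k] (C : SmoothProjectiveCurve k)

theorem ord_const {a : k} (ha : a ≠ 0) (x : C.scheme) : Scheme.ord (C.const a) x = 0 := by
  have : Nonempty (⊤ : C.scheme.Opens) := ⟨⟨genericPoint C.scheme, trivial⟩⟩
  exact Scheme.ord_of_isUnit (U := ⊤) (f := (C.str.appTop).hom ((Scheme.ΓSpecIso
    (.of k)).inv.hom a))
    ((ha.isUnit.map _).map _) trivial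

theorem isSectionAt_const_mul_iff {a : k} (ha : a ≠ 0) {E : Divisor C.scheme}
    {x : PrimeDivisor C.scheme} {c : C.scheme.functionField} :
    IsSectionAt E x (C.const a * c) ↔ IsSectionAt E x c := by
  have h0 : C.const a ≠ 0 := (map_ne_zero_iff _ C.const.injective).mpr ha
  by_cases hc : c = 0
  · simp [hc]
  simp only [IsSectionAt, mul_eq_zero, h0, hc, false_or, Scheme.ord_mul h0 hc, C.ord_const ha,
    zero_add]

theorem isSectionAt_zero_of_isIntegral {U : C.scheme.Opens} (hU : IsAffineOpen U) [Nonempty U]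
    {c : C.scheme.functionField} (hc : IsIntegral Γ(C.scheme, U) c) {x : PrimeDivisor C.scheme}
    (hx : x.1 ∈ U) : IsSectionAt 0 x c := by
  have := functionField_isFractionRing_of_isAffineOpen C.scheme U hU
  have := isDedekindDomain C.str hU
  obtain ⟨g, rfl⟩ := IsIntegrallyClosed.isIntegral_iff.mp hc
  exact KummerDatum.ord_germ_nonneg x hx g

end SmoothProjectiveCurve

/-- Orthogonality of characters: the sum is geometric with ratio `ζ ^ (l - i)`, an `m`-th root of
unity, equal to one only when `l = i`. -/
theorem sum_inv_pow_mul_pow {K : Type*} [Field K] {m : ℕ} [NeZero m] {ζ : K} (hζ :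
    IsPrimitiveRoot ζ m) {i l : ℕ}
    (hi : i < m) (hl : l < m) :
    ∑ j ∈ Finset.range m, (ζ ^ j)⁻¹ ^ i * (ζ ^ j) ^ l = if l = i then (m : K) else 0 := by
  have h0 : ζ ≠ 0 := hζ.ne_zero (NeZero.ne m)
  have h1 (j : ℕ) : (ζ ^ j)⁻¹ ^ i * (ζ ^ j) ^ l = ((ζ ^ i)⁻¹ * ζ ^ l) ^ j := by
    rw [mul_pow, inv_pow, inv_pow]; ring
  simp only [h1]
  split_ifs with h
  · subst h
    simp [inv_mul_cancel₀ (pow_ne_zero _ h0)]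
  · have h2 : (ζ ^ i)⁻¹ * ζ ^ l - 1 ≠ 0 := by
      rw [sub_ne_zero]
      intro h3
      rw [inv_mul_eq_one₀ (pow_ne_zero _ h0)] at h3
      exact h (hζ.pow_inj hi hl h3).symm
    refine (mul_eq_zero.mp ?_).resolve_right h2
    rw [geom_sum_mul, mul_pow, inv_pow, ← pow_mul, ← pow_mul, mul_comm i, mul_comm l, pow_mul,
      pow_mul,
      hζ.pow_eq_one]
    simp

namespace KummerDatum
section
variable {Y : Scheme.{u}} [AlgebraicGeometry.IsIntegral Y] [IsNoetherian Y]
  {m : ℕ} [NeZero m] {S : Finset (PrimeDivisor Y)} (d : KummerDatum m S)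

/-- This is why the integral part appears. For integers `n ≤ ⌊q⌋` means `n ≤ q`, so the order bound
on `c` is equivalent to `m ord c + i (m E + D) ≥ 0`, which says that the `m`-th power of `c z ^ i`
is regular. -/
theorem isSectionAt_twist_iff {i : ℕ} {x : PrimeDivisor Y} {c : Y.functionField} :
    IsSectionAt (d.twist i) x c ↔ IsSectionAt 0 x (c ^ m * d.f ^ i) := by
  have hm : 0 < m := Nat.pos_of_ne_zero (NeZero.ne m)
  by_cases hc : c = 0
  · simp [IsSectionAt, hc, hm.ne']
  have h1 : c ^ m * d.f ^ i ≠ 0 := mul_ne_zero (pow_ne_zero _ hc) (pow_ne_zero _ d.f_ne_zero)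
  simp only [IsSectionAt, hc, h1, false_or, twist_apply,
    Scheme.ord_mul (pow_ne_zero m hc) (pow_ne_zero i d.f_ne_zero), ord_pow hc, ord_pow d.f_ne_zero,
    d.ord_f]
  have h2 : -(i * d.E x + ⌊(i * d.D x : ℚ) / m⌋) ≤ Scheme.ord c x.1 ↔
      -(Scheme.ord c x.1 + i * d.E x) ≤ ⌊(i * d.D x : ℚ) / m⌋ := by
    constructor <;> intro h <;> linarith
  have hm' : (0 : ℚ) < m := by exact_mod_cast hm
  rw [h2, Int.le_floor, le_div_iff₀ hm']
  have h3 : (((-(Scheme.ord c x.1 + i * d.E x) : ℤ) : ℚ) * m ≤ i * d.D x) ↔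
      -(Scheme.ord c x.1 + i * d.E x) * m ≤ i * d.D x := by exact_mod_cast Iff.rfl
  rw [h3]
  simp only [Finsupp.coe_zero, Pi.zero_apply, neg_zero]
  constructor <;> intro h <;> linarith

instance : Nontrivial d.Alg :=
  ⟨⟨1, 0, fun h => by
    have := d.coeff_root_pow (Nat.pos_of_ne_zero (NeZero.ne m)) 0
    rw [pow_zero, h, map_zero, if_pos rfl] at this
    exact zero_ne_one this⟩⟩

theorem ext_coeff {s t : d.Alg} (h : ∀ i < m, d.coeff i s = d.coeff i t) : s = t := by
  rw [d.eq_sum_coeff s, d.eq_sum_coeff t]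
  exact Finset.sum_congr rfl fun i hi => by rw [h i (by simpa using hi)]

theorem smul_root_pow_pow (c : Y.functionField) (i : ℕ) :
    (c • AdjoinRoot.root _ ^ i : d.Alg) ^ m = algebraMap _ d.Alg (c ^ m * d.f ^ i) := by
  rw [_root_.smul_pow, ← pow_mul, mul_comm i m, pow_mul, d.root_pow_m, ← map_pow, Algebra.smul_def,
    ← map_mul]

variable [RegularInCodimOne Y]

/-- The automorphism `z ↦ ζ z` of the generic fibre, over the function field. -/
noncomputable def scaleHom (ζ : Y.functionField) (hζ : ζ ^ m = 1) :
    d.Alg →ₐ[Y.functionField] d.Alg where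
  __ := d.scale ζ hζ
  commutes' _ := AdjoinRoot.lift_of _

/-- A summand is a combination of the conjugates. -/
theorem sum_scaleHom {ζ : Y.functionField} (hζ : IsPrimitiveRoot ζ m) (a : d.Alg) {i : ℕ}
    (hi : i < m) : ∑ j ∈ Finset.range m, (ζ ^ j)⁻¹ ^ i •
      d.scaleHom (ζ ^ j) (by rw [← pow_mul, mul_comm, pow_mul, hζ.pow_eq_one, one_pow]) a =
        ((m : Y.functionField) * d.coeff i a) • AdjoinRoot.root _ ^ i := by
  refine d.ext_coeff fun l hl => ?_
  rw [map_sum, map_smul, d.coeff_root_pow hi]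
  have hp (j : ℕ) : (ζ ^ j) ^ m = 1 := by
    rw [← pow_mul, mul_comm, pow_mul, hζ.pow_eq_one, one_pow]
  have h1 (j : ℕ) : d.coeff l ((ζ ^ j)⁻¹ ^ i • d.scaleHom (ζ ^ j) (hp j) a) =
      ((ζ ^ j)⁻¹ ^ i * (ζ ^ j) ^ l) * d.coeff l a := by
    rw [map_smul, smul_eq_mul, mul_assoc]
    congr 1
    exact d.coeff_scale _ (hp j) a hl
  simp only [h1]
  rw [← Finset.sum_mul, sum_inv_pow_mul_pow hζ hi hl]
  split_ifs with h
  · subst h; simp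
  · simp

end

section
variable {k : Type u} [Field k] {C : SmoothProjectiveCurve k} {m : ℕ} [NeZero m]
  {S : Finset (PrimeDivisor C.scheme)} (d : KummerDatum m S)

omit [NeZero m] in
theorem isPrimitiveRoot_const {μ : k} (hμ : IsPrimitiveRoot μ m) :
    IsPrimitiveRoot (C.const μ) m := hμ.map_of_injective C.const.injective

/-- Each summand `c z ^ i` has as its `m`-th power the regular function `c ^ m f ^ i`, and sums of
integral elements are integral. -/
theorem isIntegral_of_mem_localSubring {U : C.scheme.Opens} (hU : IsAffineOpen U) [Nonempty U]
    {a : d.Alg} (ha : ∀ x : PrimeDivisor C.scheme, x.1 ∈ U → a ∈ d.localSubring x) :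
    ((algebraMap C.scheme.functionField d.Alg).comp
      (C.scheme.germToFunctionField U).hom).IsIntegralElem a := by
  change IsIntegral Γ(C.scheme, U) a
  rw [d.eq_sum_coeff a]
  refine IsIntegral.sum _ fun i hi => ?_
  refine IsIntegral.of_pow (Nat.pos_of_ne_zero (NeZero.ne m)) ?_
  rw [d.smul_root_pow_pow]
  obtain ⟨g, hg⟩ := C.mem_range_germ hU (c := d.coeff i a ^ m * d.f ^ i) fun x hx =>
    d.isSectionAt_twist_iff.mp (ha x hx i (by simpa using hi))
  rw [← hg]
  exact isIntegral_algebraMap (R := Γ(C.scheme, U)) (A := d.Alg) (x := g)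

/-- The conjugates of an integral element and the roots of unity are integral, so the weighted sum
`m c_i z ^ i` is. Its `m`-th power lies in `K` and is regular because `Γ(U)` is integrally closed;
finally the constant `m` does not affect orders. -/
theorem mem_localSubring_of_isIntegral {μ : k} (hμ : IsPrimitiveRoot μ m) (hmk : (m : k) ≠ 0)
    {U : C.scheme.Opens} (hU : IsAffineOpen U) [Nonempty U] {a : d.Alg}
    (ha : ((algebraMap C.scheme.functionField d.Alg).comp
      (C.scheme.germToFunctionField U).hom).IsIntegralElem a)
    (x : PrimeDivisor C.scheme) (hx : x.1 ∈ U) : a ∈ d.localSubring x := by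
  change IsIntegral Γ(C.scheme, U) a at ha
  intro i hi
  have hζ := isPrimitiveRoot_const (C := C) hμ
  have h1 := d.sum_scaleHom hζ a hi
  have hζi (j : ℕ) : IsIntegral Γ(C.scheme, U) (algebraMap _ d.Alg ((C.const μ ^ j)⁻¹ ^ i)) := by
    refine IsIntegral.of_pow (Nat.pos_of_ne_zero (NeZero.ne m)) ?_
    have : ((C.const μ ^ j)⁻¹ ^ i) ^ m = 1 := by
      rw [← pow_mul, mul_comm, pow_mul, inv_pow, ← pow_mul, mul_comm j, pow_mul, hζ.pow_eq_one]
      simp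
    rw [← map_pow, this, map_one]
    exact isIntegral_one
  have h2 : IsIntegral Γ(C.scheme, U)
      (((m : C.scheme.functionField) * d.coeff i a) • AdjoinRoot.root _ ^ i : d.Alg) := by
    rw [← h1]
    refine IsIntegral.sum _ fun j _ => ?_
    rw [Algebra.smul_def]
    exact (hζi j).mul (ha.map ((d.scaleHom _ (by
      rw [← pow_mul, mul_comm, pow_mul, hζ.pow_eq_one, one_pow])).restrictScalars Γ(C.scheme, U)))
  have h3 := h2.pow m
  rw [d.smul_root_pow_pow, isIntegral_algebraMap_iff
    (algebraMap C.scheme.functionField d.Alg).injective] at h3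
  have h4 := C.isSectionAt_zero_of_isIntegral hU h3 hx
  rw [← d.isSectionAt_twist_iff] at h4
  have h5 : (m : C.scheme.functionField) = C.const m := (map_natCast _ m).symm
  rw [h5] at h4
  exact (C.isSectionAt_const_mul_iff hmk).mp h4

theorem isModel_genericFibre : IsModel d.cover d.genericFibre where
  isIntegralHom := by
    refine ⟨fun U hU b => ?_⟩
    rcases isEmpty_or_nonempty U with hE | hne
    · have : d.cover.hom ⁻¹ᵁ U = ⊥ := by
        ext y; exact ⟨fun hy => (hE.false ⟨_, hy⟩).elim, fun hy => hy.elim⟩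
      have : Subsingleton Γ(d.cover.left, d.cover.hom ⁻¹ᵁ U) := by rw [this]; infer_instance
      exact ⟨Polynomial.X, Polynomial.monic_X, Subsingleton.elim _ _⟩
    · obtain ⟨p, hp, h⟩ := d.isIntegral_of_mem_localSubring hU
        ((d.mem_range_pullSections_genericFibre hU).mp ⟨b, rfl⟩)
      refine ⟨p, hp, d.pullSections_genericFibre_injective hU ?_⟩
      rw [map_zero, ← h, Polynomial.hom_eval₂]
      congr 1
      exact RingHom.ext fun g => pullSections_app d.genericFibre_hom hU g
  comp_hom := d.genericFibre_hom
  injective U hU _ := d.pullSections_genericFibre_injective hU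
  exists_mul U hU _ a := by
    -- Away from finitely many points all coefficients have order zero and all twists vanish, so `a`
    -- is a section there. On a basic open subset of `U` inside that locus `a` is a section, and a
    -- power of its equation clears the poles over `U`.
    obtain ⟨V, hV, hηV, hVT⟩ := C.exists_affineOpen_notMem (genericPoint C.scheme)
      (⋃ i ∈ Finset.range m, ({x | Scheme.ord (d.coeff i a) x.1 ≠ 0} ∪ (d.twist i).support))
      (Set.Finite.biUnion (Finset.finite_toSet _) fun i _ =>
        (finite_ord_ne_zero _).union (Finset.finite_toSet _)) fun y _ h => by
        have h1 := y.2
        rw [h] at h1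
        have h2 : Order.coheight (genericPoint C.scheme) = 0 := by
          rw [Order.coheight_eq_zero]
          exact fun z _ => (genericPoint_specializes z : genericPoint C.scheme ⤳ z)
        rw [h2] at h1
        exact zero_ne_one h1
    obtain ⟨g, hgV, hηg⟩ := hU.exists_basicOpen_le ⟨genericPoint C.scheme, hηV⟩ (genericPoint_mem U)
    have : Nonempty (C.scheme.basicOpen g) := ⟨⟨_, hηg⟩⟩
    obtain ⟨n, hn⟩ := d.exists_pow_smul_mem U g a fun x hx i hi => by
      have h3 := hVT x
      by_contra hne
      refine h3 (Set.mem_biUnion (Finset.mem_coe.mpr (Finset.mem_range.mpr hi)) ?_) (hgV hx)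
      by_contra h4
      simp only [Set.mem_union, Set.mem_ofPred_eq, Finset.mem_coe, Finsupp.mem_support_iff,
        not_or, not_not] at h4
      exact hne (.inr (by rw [h4.1, h4.2]; simp))
    refine ⟨g ^ n, pow_ne_zero _ ?_, (d.mem_range_pullSections_genericFibre hU).mpr fun x hx => ?_⟩
    · rintro rfl
      exact (Scheme.basicOpen_zero C.scheme U).le hηg
    · have := hn x hx
      rwa [map_pow, map_pow]

theorem isNormalModel_genericFibre {μ : k} (hμ : IsPrimitiveRoot μ m) (hmk : (m : k) ≠ 0) :
    IsNormalModel d.cover d.genericFibre where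
  toIsModel := d.isModel_genericFibre
  mem_range _ hU _ _ ha := (d.mem_range_pullSections_genericFibre hU).mpr
    (d.mem_localSubring_of_isIntegral hμ hmk hU ha)

end
end KummerDatum

/-! ### Normal curves over an algebraically closed field are smooth -/

section SmoothAlgebra
open Algebra

instance isPrincipalIdealRing_mvPolynomial (F : Type*) [Field F] :
    IsPrincipalIdealRing (MvPolynomial (Fin 1) F) :=
  .of_surjective (MvPolynomial.uniqueAlgEquiv F (Fin 1)).symm.toRingEquiv
    (MvPolynomial.uniqueAlgEquiv F (Fin 1)).symm.surjective

instance isStandardSmooth_mvPolynomial (R : Type*) [CommRing R] [Nontrivial R] :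
    IsStandardSmoothOfRelativeDimension 1 R (MvPolynomial (Fin 1) R) := by
  have : IsStandardSmooth R (MvPolynomial (Fin 1) R) :=
    .of_basis_kaehlerDifferential (KaehlerDifferential.mvPolynomialBasis R (Fin 1)) (by
      rintro _ ⟨i, rfl⟩
      exact ⟨MvPolynomial.X i, (KaehlerDifferential.mvPolynomialBasis_apply _ _ _).symm⟩)
  rw [IsStandardSmoothOfRelativeDimension.iff_of_isStandardSmooth,
    rank_eq_card_basis (KaehlerDifferential.mvPolynomialBasis R (Fin 1))]
  simp

variable {k : Type*} [Field k] [IsAlgClosed k]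

/-- By the Nullstellensatz the residue field at `q` is `k`, so the residue extension is surjective.
-/
theorem isSeparable_of_finiteType {C : Type*} [CommRing C] [Algebra k C] [FiniteType k C]
    {R : Type*} [CommRing R] [Algebra k R] [Algebra R C] [IsScalarTower k R C]
    (p : Ideal R) [p.IsPrime] (q : Ideal C) [q.IsMaximal] [q.LiesOver p]
    [Algebra (Localization.AtPrime p) (Localization.AtPrime q)]
    [Localization.AtPrime.IsLiesOverAlgebra p q] :
    Algebra.IsSeparable p.ResidueField q.ResidueField := by
  have hs : Function.Surjective (algebraMap k (C ⧸ q)) := by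
    let := Ideal.Quotient.field q
    have : Module.Finite k (C ⧸ q) := finite_of_finite_type_of_isJacobsonRing k (C ⧸ q)
    exact IsAlgClosed.algebraMap_bijective_of_isIntegral.2
  have hs' : Function.Surjective (algebraMap p.ResidueField q.ResidueField) := by
    intro y
    obtain ⟨c, rfl⟩ := (Ideal.bijective_algebraMap_quotient_residueField q).2 y
    obtain ⟨a, rfl⟩ := hs c
    refine ⟨algebraMap k _ a, ?_⟩
    rw [← IsScalarTower.algebraMap_apply, ← IsScalarTower.algebraMap_apply]
  refine ⟨fun y => ?_⟩
  obtain ⟨x, rfl⟩ := hs' y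
  exact isSeparable_algebraMap x

/-- Choose `s ∈ C` that is a uniformizer at `q` and map `k[X]` to `C` by `X ↦ s`. The map is flat,
being torsion-free over a principal ideal domain, and unramified at `q`, hence étale near `q`;
composing with the smooth affine line gives the claim. -/
theorem exists_isStandardSmooth_away {C : Type*} [CommRing C] [IsDedekindDomain C] [Algebra k C]
    [FiniteType k C] (hC : ¬ IsField C) (q : Ideal C) [q.IsMaximal] :
    ∃ t ∉ q, IsStandardSmoothOfRelativeDimension 1 k (Localization.Away t) := by
  have hq0 := Ring.ne_bot_of_isMaximal_of_not_isField ‹q.IsMaximal› hC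
  have : IsDiscreteValuationRing (Localization.AtPrime q) :=
    IsLocalization.AtPrime.isDiscreteValuationRing_of_dedekind_domain C hq0 _
  obtain ⟨ϖ, hϖ⟩ := IsDiscreteValuationRing.exists_irreducible (Localization.AtPrime q)
  obtain ⟨s, u, rfl⟩ := IsLocalization.exists_mk'_eq q.primeCompl ϖ
  have hass : Associated (algebraMap C (Localization.AtPrime q) s)
      (IsLocalization.mk' (Localization.AtPrime q) s u) := by
    rw [← IsLocalization.mk'_spec' (Localization.AtPrime q) s u]
    exact (associated_unit_mul_left _ _ (IsLocalization.map_units _ u))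
  have hirr : Irreducible (algebraMap C (Localization.AtPrime q) s) := hass.symm.irreducible hϖ
  have hmax : IsLocalRing.maximalIdeal (Localization.AtPrime q) =
      Ideal.span {algebraMap C (Localization.AtPrime q) s} := hirr.maximalIdeal_eq
  have hsq : s ∈ q := by
    rw [← IsLocalization.AtPrime.to_map_mem_maximal_iff (Localization.AtPrime q) q, hmax]
    exact Ideal.mem_span_singleton_self _
  have hs0 : s ≠ 0 := by rintro rfl; exact hirr.ne_zero (map_zero _)
  -- An algebraic nonzero element of a domain over a field is a unit, but `s` lies in `q`.
  have htr : Transcendental k s := fun h =>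
    (Ideal.IsPrime.ne_top' : q ≠ ⊤) (Ideal.eq_top_of_isUnit_mem _ hsq (h.isIntegral.isUnit hs0))
  let φ : MvPolynomial (Fin 1) k →ₐ[k] C := MvPolynomial.aeval fun _ => s
  have hφ : Function.Injective φ :=
    (algebraicIndependent_unique_type_iff (x := fun _ : Fin 1 => s)).mpr htr
  let := φ.toRingHom.toAlgebra
  have : IsScalarTower k (MvPolynomial (Fin 1) k) C := .of_algHom φ
  have : Module.IsTorsionFree (MvPolynomial (Fin 1) k) C :=
    Module.isTorsionFree_iff_algebraMap_injective.mpr hφ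
  have : FiniteType (MvPolynomial (Fin 1) k) C := .of_restrictScalars_finiteType k _ _
  have : IsNoetherianRing (MvPolynomial (Fin 1) k) := inferInstance
  have : FinitePresentation (MvPolynomial (Fin 1) k) C :=
    FinitePresentation.of_finiteType.mp inferInstance
  let p := q.under (MvPolynomial (Fin 1) k)
  let := Localization.AtPrime.algebraOfLiesOver p q
  have : Algebra.IsUnramifiedAt (MvPolynomial (Fin 1) k) q := by
    rw [Algebra.isUnramifiedAt_iff_map_eq _ p]
    refine ⟨isSeparable_of_finiteType (k := k) p q, le_antisymm ?_ ?_⟩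
    · rw [Ideal.map_le_iff_le_comap]
      intro a ha
      rw [Ideal.mem_comap, IsScalarTower.algebraMap_apply _ C,
        IsLocalization.AtPrime.to_map_mem_maximal_iff (Localization.AtPrime q) q]
      exact ha
    · rw [hmax, Ideal.span_singleton_le_iff_mem]
      have hX : algebraMap (MvPolynomial (Fin 1) k) C (MvPolynomial.X 0) = s :=
        MvPolynomial.aeval_X _ _
      rw [← hX, ← IsScalarTower.algebraMap_apply]
      refine Ideal.mem_map_of_mem _ ?_
      change algebraMap (MvPolynomial (Fin 1) k) C (MvPolynomial.X 0) ∈ q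
      rwa [hX]
  have := Algebra.IsEtaleAt.of_isUnramifiedAt_of_flat (R := MvPolynomial (Fin 1) k) q
  obtain ⟨t, ht, h⟩ := Algebra.exists_etale_of_isEtaleAt (R := MvPolynomial (Fin 1) k) q
  have := Algebra.Etale.iff_isStandardSmoothOfRelativeDimension_zero.mp h
  exact ⟨t, ht, IsStandardSmoothOfRelativeDimension.trans 1 0 k (MvPolynomial (Fin 1) k) _⟩

section IntegralClosure
variable (A K L : Type*) {B : Type*} [CommRing A] [IsDedekindDomain A] [Field K] [Algebra A K]
  [IsFractionRing A K] [CommRing L] [Algebra K L] [Algebra A L] [IsScalarTower A K L]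
  [Module.Finite K L] [FormallyUnramified K L]
  [CommRing B] [Algebra A B] [Algebra B L] [IsScalarTower A B L] [IsIntegralClosure B A L]

theorem isSeparable_quotient (P : Ideal L) [P.IsMaximal] : letI := Ideal.Quotient.field P
    Algebra.IsSeparable K (L ⧸ P) :=
  letI := Ideal.Quotient.field P
  have : FormallyUnramified L (L ⧸ P) := .of_surjective (IsScalarTower.toAlgHom L L (L ⧸ P))
    Ideal.Quotient.mk_surjective
  have : FormallyUnramified K (L ⧸ P) := .comp K L (L ⧸ P)
  FormallyUnramified.isSeparable _ _

/-- The map to the integral closure in a residue field. -/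
noncomputable def toIntegralClosure (P : Ideal L) : B →ₐ[A] integralClosure A (L ⧸ P) :=
  ((Ideal.Quotient.mkₐ A P).comp (IsScalarTower.toAlgHom A B L)).codRestrict _ fun b =>
    (IsIntegralClosure.isIntegral A L b).map ((Ideal.Quotient.mkₐ A P).comp
      (IsScalarTower.toAlgHom A B L))

include K L in
-- Since `L` is reduced, `B` embeds in the product of the integral closures of `A` in the residue
-- fields of `L`; each is finite by separability, and `A` is Noetherian.
theorem finite_of_isIntegralClosure : Module.Finite A B := by
  have := FormallyUnramified.isReduced_of_field K L
  have : IsArtinianRing L := IsArtinianRing.of_finite K L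
  have (P : MaximalSpectrum L) : Module.Finite A (integralClosure A (L ⧸ P.asIdeal)) := by
    let := Ideal.Quotient.field P.asIdeal
    have := isSeparable_quotient K L P.asIdeal
    exact IsIntegralClosure.finite A K (L ⧸ P.asIdeal) _
  refine Module.Finite.of_injective
    (LinearMap.pi fun P : MaximalSpectrum L => (toIntegralClosure A L (B :=
      B) P.asIdeal).toLinearMap) ?_
  refine (injective_iff_map_eq_zero _).mpr fun b hb =>
    IsIntegralClosure.algebraMap_injective B A L ?_
  rw [map_zero]
  refine (nilpotent_iff_mem_prime.mpr fun P hP => ?_).eq_zero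
  have := congrArg Subtype.val (congrFun hb ⟨P, IsArtinianRing.isMaximal_of_isPrime P⟩)
  exact Ideal.Quotient.eq_zero_iff_mem.mp this

variable {A K L}

omit [IsDedekindDomain A] [Algebra A K] [IsFractionRing A K] [IsScalarTower A K L]
  [Algebra.FormallyUnramified K L] [Algebra A B] [IsScalarTower A B L] in
include A K in
-- The idempotent of `L` isolating the component through `q` is integral, hence lies in `B`. Below,
-- inverting it replaces `L` by a single residue field.
theorem exists_idempotent (q : Ideal B) [hq : q.IsPrime] : ∃ P : Ideal L, P.IsMaximal ∧ ∃ e : B,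
    IsIdempotentElem e ∧ e ∉ q ∧ ∀ Q : Ideal L, Q.IsPrime → (algebraMap B L e ∈ Q ↔ Q ≠ P) := by
  have : IsArtinianRing L := IsArtinianRing.of_finite K L
  have hinj := IsIntegralClosure.algebraMap_injective B A L
  obtain ⟨q₀, hq₀, hle⟩ := Ideal.exists_minimalPrimes_le (I := ⊥) (J := q) bot_le
  obtain ⟨P, hP, hPq⟩ := Ideal.exists_comap_eq_of_mem_minimalPrimes_of_injective hinj q₀ hq₀
  obtain ⟨e, he, hPe⟩ := PrimeSpectrum.isClopen_iff.mp
    (isClopen_discrete {(⟨P, hP⟩ : PrimeSpectrum L)})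
  have hmem (Q : Ideal L) (hQ : Q.IsPrime) : e ∈ Q ↔ Q ≠ P := by
    have : (⟨Q, hQ⟩ : PrimeSpectrum L) ∈ ({⟨P, hP⟩} : Set (PrimeSpectrum L)) ↔
      (⟨Q, hQ⟩ : PrimeSpectrum L) ∈ (PrimeSpectrum.basicOpen e : Set _) := by rw [hPe]
    rw [Set.mem_singleton_iff, PrimeSpectrum.mk.injEq] at this
    rw [ne_eq, this]
    exact not_not.symm
  obtain ⟨b, rfl⟩ := IsIntegralClosure.isIntegral_iff (A := B).mp
    (show IsIntegral A e from ⟨Polynomial.X ^ 2 - Polynomial.X, by monicity!, by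
      simp [pow_two, he.eq]⟩)
  have hb : IsIdempotentElem b := hinj (by rw [map_mul]; exact he)
  refine ⟨P, IsArtinianRing.isMaximal_of_isPrime P, b, hb, fun hbq => ?_, hmem⟩
  have h1 : algebraMap B L (1 - b) ∈ P := by
    refine (hP.mem_or_mem (x := algebraMap B L b) ?_).resolve_left fun h => (hmem P hP).mp h rfl
    rw [← map_mul, hb.mul_one_sub_self, map_zero]
    exact zero_mem _
  have h2 : 1 - b ∈ q := hle (hPq ▸ h1 : 1 - b ∈ q₀)
  exact hq.ne_top ((Ideal.eq_top_iff_one _).mpr (by simpa using add_mem h2 hbq))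

variable [Algebra k A] [Algebra k B] [IsScalarTower k A B] [Algebra k L] [IsScalarTower k A L]
  [FiniteType k A]

variable (A K L) in
include A K L in
-- Inverting the idempotent `e` turns `B` into the integral closure of `A` in the field `L / P`,
-- which is Dedekind, so the domain case applies.
theorem exists_isStandardSmooth_away_of_isIntegralClosure (hA : ¬ IsField A) (q : Ideal B)
    [q.IsMaximal] : ∃ t ∉ q, IsStandardSmoothOfRelativeDimension 1 k (Localization.Away t) := by
  have := FormallyUnramified.isReduced_of_field K L
  obtain ⟨P, hP, e, he, heq, hmem⟩ := exists_idempotent (A := A) (K := K) (L := L) q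
  let := Ideal.Quotient.field P
  have := isSeparable_quotient K L P
  have : IsDedekindDomain (integralClosure A (L ⧸ P)) :=
    IsIntegralClosure.isDedekindDomain A K (L ⧸ P) _
  have : Module.Finite A (integralClosure A (L ⧸ P)) :=
    IsIntegralClosure.finite A K (L ⧸ P) _
  have : FiniteType k (integralClosure A (L ⧸ P)) :=
    Algebra.FiniteType.trans (S := A) inferInstance inferInstance
  let φ := (toIntegralClosure A L (B := B) P).restrictScalars k
  let := φ.toRingHom.toAlgebra
  have : IsScalarTower k B (integralClosure A (L ⧸ P)) := .of_algHom φ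
  have hφ (b : B) : ((φ b : integralClosure A (L ⧸ P)) : L ⧸ P) =
    Ideal.Quotient.mk P (algebraMap B L b) := rfl
  have he1 : Ideal.Quotient.mk P (algebraMap B L e) = 1 := by
    have h1 : IsIdempotentElem (Ideal.Quotient.mk P (algebraMap B L e)) := (he.map _).map _
    refine (IsIdempotentElem.iff_eq_zero_or_one.mp h1).resolve_left fun h => ?_
    exact (hmem P hP.isPrime).mp (Ideal.Quotient.eq_zero_iff_mem.mp h) rfl
  have hzero (l : L) (hl : l ∈ P) : algebraMap B L e * l = 0 := by
    refine (nilpotent_iff_mem_prime.mpr fun Q hQ => ?_).eq_zero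
    by_cases h : Q = P
    · exact h ▸ P.mul_mem_left _ hl
    · exact Q.mul_mem_right _ ((hmem Q hQ).mpr h)
  -- An integral residue class lifts to the integral element `e l`: if `p` annihilates the class,
  -- then `p (e l)` lies in `P` and is killed by `e`, so `X * p` annihilates `e l`.
  have hsurj : Function.Surjective φ := by
    rintro ⟨c, p, hp, hc⟩
    obtain ⟨l, rfl⟩ := Ideal.Quotient.mk_surjective c
    have h1 : IsIntegral A (algebraMap B L e * l) := by
      refine ⟨Polynomial.X * p, Polynomial.monic_X.mul hp, ?_⟩
      rw [Polynomial.eval₂_mul, Polynomial.eval₂_X, mul_assoc]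
      refine hzero _ (P.mul_mem_left _ (Ideal.Quotient.eq_zero_iff_mem.mp ?_))
      rw [Polynomial.hom_eval₂, map_mul, he1, one_mul]
      exact hc
    obtain ⟨b, hb⟩ := (IsIntegralClosure.isIntegral_iff (A := B)).mp h1
    refine ⟨b, Subtype.ext ?_⟩
    rw [hφ, hb, map_mul, he1, one_mul]
  have hker : RingHom.ker (algebraMap B (integralClosure A (L ⧸ P))) = Ideal.span {1 - e} := by
    ext b
    rw [Ideal.mem_span_singleton, RingHom.mem_ker]
    constructor
    · intro hb
      have h1 : algebraMap B L b ∈ P := Ideal.Quotient.eq_zero_iff_mem.mp (congrArg Subtype.val hb)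
      have h2 : e * b = 0 := IsIntegralClosure.algebraMap_injective B A L (by
        rw [map_mul, hzero _ h1, map_zero])
      exact ⟨b, by rw [sub_mul, one_mul, h2, sub_zero]⟩
    · rintro ⟨b, rfl⟩
      refine Subtype.ext ?_
      change Ideal.Quotient.mk P (algebraMap B L ((1 - e) * b)) = 0
      rw [map_mul, map_mul, map_sub, map_sub, he1]
      simp
  have haway : IsLocalization.Away e (integralClosure A (L ⧸ P)) :=
    IsLocalization.away_of_isIdempotentElem he hker hsurj
  have hq : RingHom.ker φ ≤ q := by
    change RingHom.ker (algebraMap B (integralClosure A (L ⧸ P))) ≤ q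
    rw [hker, Ideal.span_singleton_le_iff_mem]
    refine (‹q.IsMaximal›.isPrime.mem_or_mem (x := e) ?_).resolve_left heq
    rw [he.mul_one_sub_self]; exact zero_mem _
  have : (q.map φ).IsMaximal := Ideal.IsMaximal.map_of_surjective_of_ker_le hsurj hq
  have hC : ¬ IsField (integralClosure A (L ⧸ P)) := fun h =>
    hA (isField_of_isIntegral_of_isField (fun a b hab => IsFractionRing.injective A K
      ((algebraMap K (L ⧸ P)).injective (by
        rw [← IsScalarTower.algebraMap_apply, ← IsScalarTower.algebraMap_apply]
        exact congrArg Subtype.val hab))) h)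
  obtain ⟨t', ht', hsm⟩ := exists_isStandardSmooth_away (k := k) hC (q.map φ)
  obtain ⟨t, rfl⟩ := hsurj t'
  have h3 : IsLocalization.Away (t * e) (Localization.Away (φ t)) :=
    IsLocalization.Away.mul (integralClosure A (L ⧸ P)) _ e t
  refine ⟨t * e, fun h => ?_, ?_⟩
  · exact (‹q.IsMaximal›.isPrime.mem_or_mem h).elim (fun h => ht' (Ideal.mem_map_of_mem _ h)) heq
  · exact .of_algEquiv 1 ((IsLocalization.algEquiv (Submonoid.powers (t * e))
      (Localization.Away (φ t)) (Localization.Away (t * e))).restrictScalars k)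

end IntegralClosure

end SmoothAlgebra

/-! ### Finiteness and smoothness of normal models -/

section
variable {k : Type u} [Field k] (C : SmoothProjectiveCurve k)

theorem isField_spec : IsField Γ(Spec (.of k), ⊤) :=
  (Scheme.ΓSpecIso (.of k)).commRingCatIsoToRingEquiv.toMulEquiv.isField (Field.toIsField k)

theorem finiteType_appLE {U : C.scheme.Opens} (hU : IsAffineOpen U) :
    (C.str.appLE ⊤ U le_top).hom.FiniteType :=
  C.str.finiteType_appLE (isAffineOpen_top _) hU le_top

theorem isAlgClosed_spec [IsAlgClosed k] : letI := (isField_spec (k := k)).toField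
    IsAlgClosed Γ(Spec (.of k), ⊤) :=
  letI := (isField_spec (k := k)).toField
  .of_ringEquiv k _ (Scheme.ΓSpecIso (.of k)).commRingCatIsoToRingEquiv.symm

/-- If it were a field, it would be `k` by the Nullstellensatz and have no differentials, against
relative dimension one. -/
theorem not_isField [IsAlgClosed k] {U : C.scheme.Opens} (hU : IsAffineOpen U) [Nonempty U] :
    ¬ IsField Γ(C.scheme, U) := by
  intro hF
  let := (isField_spec (k := k)).toField
  have := isAlgClosed_spec (k := k)
  let := hF.toField
  obtain ⟨s, hs, h⟩ := HasRingHomProperty.appLE (P := @SmoothOfRelativeDimension 1) C.str C.smooth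
    ⟨⊤, isAffineOpen_top (Spec (.of k))⟩ ⟨U, hU⟩ le_top
  obtain ⟨t, hts, ht⟩ : ∃ t ∈ s, t ≠ 0 := by
    by_contra! hc
    have : Ideal.span s = ⊥ := Ideal.span_eq_bot.mpr hc
    exact bot_ne_top (this.symm.trans hs)
  have h1 := h t hts
  let := (C.str.appLE ⊤ U le_top).hom.toAlgebra
  have h2 : Algebra.IsStandardSmoothOfRelativeDimension 1 Γ(Spec (.of k), ⊤) (Localization.Away t)
    := by
    rw [← RingHom.isStandardSmoothOfRelativeDimension_algebraMap]
    exact h1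
  have h3 : Algebra.FiniteType Γ(Spec (.of k), ⊤) Γ(C.scheme, U) := finiteType_appLE C hU
  have h4 : Module.Finite Γ(Spec (.of k), ⊤) Γ(C.scheme, U) :=
    finite_of_finite_type_of_isJacobsonRing _ _
  have h5 : Function.Surjective (algebraMap Γ(Spec (.of k), ⊤) Γ(C.scheme, U)) :=
    IsAlgClosed.algebraMap_bijective_of_isIntegral.2
  have h6 := hF.localization_map_bijective (M := .powers t) (Rₘ := Localization.Away t)
    fun ⟨n, hn⟩ => pow_ne_zero n ht hn
  have h7 : Function.Surjective (algebraMap Γ(Spec (.of k), ⊤) (Localization.Away t)) := by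
    rw [IsScalarTower.algebraMap_eq _ Γ(C.scheme, U)]
    exact h6.2.comp h5
  have : Nontrivial (Localization.Away t) := h6.1.nontrivial
  have h8 := KaehlerDifferential.subsingleton_of_surjective _ _ h7
  have h9 := Algebra.IsStandardSmoothOfRelativeDimension.rank_kaehlerDifferential
    (R := Γ(Spec (.of k), ⊤)) (S := Localization.Away t) 1
  rw [rank_subsingleton'] at h9
  simp at h9

variable {C} {W : Over C.scheme} {A : Type u} [CommRing A] [Algebra C.scheme.functionField A]
  [Module.Finite C.scheme.functionField A] [Algebra.FormallyUnramified C.scheme.functionField A]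
  {j : Spec (.of A) ⟶ W.left}

/-- Normality says precisely that the sections over `U` form the integral closure of `Γ(Y, U)` in
`A`, so the preceding algebra applies over the base field `Γ(Spec k)`. -/
theorem IsNormalModel.finite_and_exists_isStandardSmooth [IsAlgClosed k] (h : IsNormalModel W j)
    {U : C.scheme.Opens} (hU : IsAffineOpen U) [Nonempty U] :
    (W.hom.app U).hom.Finite ∧ ∀ q : Ideal Γ(W.left, W.hom ⁻¹ᵁ U), q.IsMaximal →
      ∃ t ∉ q, ((algebraMap _ (Localization.Away t)).comp ((W.hom.app U).hom.comp
        (C.str.appLE ⊤ U le_top).hom)).IsStandardSmoothOfRelativeDimension 1 := by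
  let := (isField_spec (k := k)).toField
  have := isAlgClosed_spec (k := k)
  let := (C.str.appLE ⊤ U le_top).hom.toAlgebra
  let := (W.hom.app U).hom.toAlgebra
  let := ((W.hom.app U).hom.comp (C.str.appLE ⊤ U le_top).hom).toAlgebra
  let := (h.incl U).toAlgebra
  let : Algebra Γ(C.scheme, U) A :=
    ((algebraMap C.scheme.functionField A).comp (C.scheme.germToFunctionField U).hom).toAlgebra
  let : Algebra Γ(Spec (.of k), ⊤) A :=
    ((algebraMap Γ(C.scheme, U) A).comp (C.str.appLE ⊤ U le_top).hom).toAlgebra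
  have : IsScalarTower Γ(Spec (.of k), ⊤) Γ(C.scheme, U) Γ(W.left, W.hom ⁻¹ᵁ U) :=
    .of_algebraMap_eq fun _ => rfl
  have : IsScalarTower Γ(Spec (.of k), ⊤) Γ(C.scheme, U) A := .of_algebraMap_eq fun _ => rfl
  have : IsScalarTower Γ(C.scheme, U) C.scheme.functionField A := .of_algebraMap_eq fun _ => rfl
  have : IsScalarTower Γ(C.scheme, U) Γ(W.left, W.hom ⁻¹ᵁ U) A :=
    .of_algebraMap_eq fun g => (pullSections_app h.comp_hom hU g).symm
  have := functionField_isFractionRing_of_isAffineOpen C.scheme U hU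
  have := isDedekindDomain C.str hU
  have : Algebra.FiniteType Γ(Spec (.of k), ⊤) Γ(C.scheme, U) := finiteType_appLE C hU
  have : IsIntegralClosure Γ(W.left, W.hom ⁻¹ᵁ U) Γ(C.scheme, U) A :=
    ⟨h.injective U hU, fun {a} => ⟨fun ha => h.mem_range U hU a ha, by
      rintro ⟨b, rfl⟩
      have := h.isIntegralHom
      exact isIntegralElem_pullSections h.comp_hom hU b⟩⟩
  refine ⟨finite_of_isIntegralClosure Γ(C.scheme, U) C.scheme.functionField A, fun q hq => ?_⟩
  obtain ⟨t, ht, hsm⟩ := exists_isStandardSmooth_away_of_isIntegralClosure (k := Γ(Spec (.of k), ⊤))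
    Γ(C.scheme, U) C.scheme.functionField A (not_isField C hU) q
  refine ⟨t, ht, ?_⟩
  rw [← RingHom.isStandardSmoothOfRelativeDimension_algebraMap] at hsm
  exact hsm

theorem IsNormalModel.isFinite [IsAlgClosed k] (h : IsNormalModel W j) : IsFinite W.hom where
  __ := h.isAffineHom
  finite_app U hU := by
    rcases isEmpty_or_nonempty U with hE | hne
    · have : W.hom ⁻¹ᵁ U = ⊥ := by
        ext y; exact ⟨fun hy => (hE.false ⟨_, hy⟩).elim, fun hy => hy.elim⟩
      have : Subsingleton Γ(W.left, W.hom ⁻¹ᵁ U) := by rw [this]; infer_instance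
      exact RingHom.Finite.of_surjective _ fun b => ⟨0, Subsingleton.elim _ _⟩
    · exact (h.finite_and_exists_isStandardSmooth hU).1

theorem IsNormalModel.smooth [IsAlgClosed k] (h : IsNormalModel W j) :
    SmoothOfRelativeDimension 1 (W.hom ≫ C.str) where
  exists_isStandardSmoothOfRelativeDimension x := by
    obtain ⟨U, hU, hxU⟩ := exists_affineOpen_mem (W.hom x)
    have : Nonempty U := ⟨⟨_, hxU⟩⟩
    let p := (h.isAffineOpen hU).primeIdealOf ⟨x, hxU⟩
    -- Smoothness is known near closed points. If `x` is not closed, a closed specialization of it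
    -- in the chart is used: an open neighbourhood of that point contains `x`.
    obtain ⟨q, hq, hpq⟩ := Ideal.exists_le_maximal p.asIdeal p.2.ne_top
    obtain ⟨t, ht, hsm⟩ := (h.finite_and_exists_isStandardSmooth hU).2 q hq
    refine ⟨⊤, isAffineOpen_top _, W.left.basicOpen t, (h.isAffineOpen hU).basicOpen t, ?_,
      le_top, ?_⟩
    · have hp : (h.isAffineOpen hU).fromSpec p = x :=
        (h.isAffineOpen hU).fromSpec_primeIdealOf ⟨x, hxU⟩
      rw [← hp, ← SetLike.mem_coe, ← (h.isAffineOpen hU).fromSpec_image_basicOpen]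
      exact ⟨p, fun h => ht (hpq h), rfl⟩
    · have := (h.isAffineOpen hU).isLocalization_basicOpen t
      let e := IsLocalization.algEquiv (.powers t) (Localization.Away t)
        Γ(W.left, W.left.basicOpen t)
      have h0 : (W.hom ≫ C.str).appLE ⊤ (W.left.basicOpen t) le_top = C.str.appLE ⊤ U le_top ≫
          W.hom.app U ≫ W.left.presheaf.map (homOfLE (W.left.basicOpen_le t)).op := by
        rw [W.hom.app_eq_appLE, Scheme.Hom.appLE_map]
        exact (Scheme.Hom.appLE_comp_appLE _ _ _ _ _ _ _).symm
      have h1 : ((W.hom ≫ C.str).appLE ⊤ (W.left.basicOpen t) le_top).hom =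
          e.toRingEquiv.toRingHom.comp
            ((algebraMap _ (Localization.Away t)).comp ((W.hom.app U).hom.comp
              (C.str.appLE ⊤ U le_top).hom)) := by
        rw [← RingHom.comp_assoc, show e.toRingEquiv.toRingHom.comp
          (algebraMap _ (Localization.Away t)) =
            algebraMap Γ(W.left, W.hom ⁻¹ᵁ U) Γ(W.left, W.left.basicOpen t) from
              RingHom.ext fun b => e.commutes b]
        exact congrArg CommRingCat.Hom.hom h0
      rw [h1]
      exact RingHom.isStandardSmoothOfRelativeDimension_respectsIso.1 _ _ hsm

theorem IsNormalModel.isCover [IsAlgClosed k] (h : IsNormalModel W j) {U : C.scheme.Opens}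
    [Nonempty U] (hU : Etale (W.hom ∣_ U)) : C.IsCover W where
  finite := h.isFinite
  smooth := h.smooth
  generically_etale := ⟨U, ⟨_, genericPoint_mem U⟩, hU⟩

end

/-- Differentiating `w ^ m = r` gives `m w ^ (m - 1) dw = 0` with unit coefficient, and `dw`
generates the differentials. -/
theorem formallyUnramified_of_adjoin_eq_top {R B : Type*} [CommRing R] [CommRing B] [Algebra R B]
    {w : B} (hw : Algebra.adjoin R {w} = ⊤) {m : ℕ} (hm : IsUnit (m : B)) (hu : IsUnit w) {r : R}
    (hr : w ^ m = algebraMap R B r) : Algebra.FormallyUnramified R B := by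
  have h1 : KaehlerDifferential.D R B w = 0 := by
    have h := (KaehlerDifferential.D R B).leibniz_pow w m
    rw [hr, Derivation.map_algebraMap, ← Nat.cast_smul_eq_nsmul B, smul_smul] at h
    exact ((hm.mul (hu.pow _)).smul_eq_zero.mp h.symm)
  have h2 : KaehlerDifferential.D R B = 0 :=
    Derivation.ext_of_adjoin_eq_top _ hw (by simpa using h1)
  refine ⟨subsingleton_of_forall_eq 0 fun y => ?_⟩
  have h3 : y ∈ Submodule.span B (Set.range (KaehlerDifferential.D R B)) := by
    rw [KaehlerDifferential.span_range_derivation]; trivial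
  rw [h2] at h3
  have h4 : Set.range ((0 : Derivation R B (Ω[B⁄R])) : B → Ω[B⁄R]) ⊆ {0} := by
    rintro _ ⟨b, rfl⟩; rfl
  simpa using Submodule.span_mono h4 h3

section
variable (P : MorphismProperty Scheme.{u})
  {Q : ∀ {R S : Type u} [CommRing R] [CommRing S], (R →+* S) → Prop} [HasRingHomProperty P Q]
include Q

theorem app_iff_morphismRestrict {X Y : Scheme.{u}} (f : X ⟶ Y) [IsAffineHom f] {V : Y.Opens}
    (hV : IsAffineOpen V) : P (f ∣_ V) ↔ Q (f.app V).hom := by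
  have : IsAffine V := hV
  have : IsAffine (f ⁻¹ᵁ V) := hV.preimage f
  rw [HasRingHomProperty.iff_of_isAffine (P := P), Scheme.Hom.appTop, morphismRestrict_app']
  have key (V' : Y.Opens) (W' : X.Opens) (hV' : V' = V) (hW' : W' = f ⁻¹ᵁ V) (e : W' ≤ f ⁻¹ᵁ V') :
      Q (f.appLE V' W' e).hom ↔ Q (f.app V).hom := by
    subst hV' hW'
    rw [Scheme.Hom.appLE_eq_app]
  exact key _ _ V.ι_image_top (f ⁻¹ᵁ V).ι_image_top _

theorem morphismRestrict_iff_of_le {X Y : Scheme.{u}} (f : X ⟶ Y) {U V : Y.Opens} (hVU : V ≤ U) :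
    P (f ∣_ U ∣_ U.ι ⁻¹ᵁ V) ↔ P (f ∣_ V) := by
  have h1 : U.ι ''ᵁ U.ι ⁻¹ᵁ V = V := by
    rw [Scheme.Hom.image_preimage_eq_opensRange_inf, Scheme.Opens.opensRange_ι,
      inf_eq_right.mpr hVU]
  exact MorphismProperty.arrow_mk_iso_iff P
    (morphismRestrictRestrict f U (U.ι ⁻¹ᵁ V) ≪≫ morphismRestrictEq f h1)

theorem morphismRestrict_of_forall_app {X Y : Scheme.{u}} (f : X ⟶ Y) [IsAffineHom f] {U : Y.Opens}
    (H : ∀ x ∈ U, ∃ V ≤ U, IsAffineOpen V ∧ x ∈ V ∧ Q (f.app V).hom) : P (f ∣_ U) := by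
  refine IsZariskiLocalAtTarget.of_forall_exists_morphismRestrict fun x => ?_
  obtain ⟨V, hVU, hV, hxV, hf⟩ := H x.1 x.2
  exact ⟨U.ι ⁻¹ᵁ V, hxV, (morphismRestrict_iff_of_le P f hVU).mpr
    ((app_iff_morphismRestrict P f hV).mpr hf)⟩

theorem app_of_morphismRestrict {X Y : Scheme.{u}} (f : X ⟶ Y) [IsAffineHom f] {U V : Y.Opens}
    (hU : P (f ∣_ U)) (hVU : V ≤ U) (hV : IsAffineOpen V) : Q (f.app V).hom :=
  (app_iff_morphismRestrict P f hV).mp ((morphismRestrict_iff_of_le P f hVU).mp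
    (IsZariskiLocalAtTarget.restrict hU _))

end

/-! ### The cyclic cover is étale outside `S` -/

namespace KummerDatum
section
variable {k : Type u} [Field k] {C : SmoothProjectiveCurve k} {m : ℕ} [NeZero m]
  {S : Finset (PrimeDivisor C.scheme)} (d : KummerDatum m S)

theorem isUnit_root : IsUnit (AdjoinRoot.root _ : d.Alg) := by
  refine (isUnit_pow_iff (NeZero.ne m)).mp ?_
  rw [d.root_pow_m]
  exact d.f_ne_zero.isUnit.map _

instance : Module.Finite C.scheme.functionField d.Alg := d.monic.finite_adjoinRoot

omit [NeZero m] in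
theorem natCast_ne_zero (hmk : (m : k) ≠ 0) : (m : C.scheme.functionField) ≠ 0 := by
  rw [← map_natCast C.const]
  exact (map_ne_zero_iff _ C.const.injective).mpr hmk

theorem formallyUnramified (hmk : (m : k) ≠ 0) :
    Algebra.FormallyUnramified C.scheme.functionField d.Alg := by
  refine formallyUnramified_of_adjoin_eq_top (w := AdjoinRoot.root _) AdjoinRoot.adjoinRoot_eq_top
    (m := m) ?_ d.isUnit_root d.root_pow_m
  rw [← map_natCast (algebraMap C.scheme.functionField d.Alg)]
  exact (natCast_ne_zero hmk).isUnit.map _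

variable {μ : k} (hμ : IsPrimitiveRoot μ m) (hmk : (m : k) ≠ 0)
include hμ hmk

/-- Where `E` has equation `h` and `D` vanishes, `w = z / h` satisfies `w ^ m = r` with `r = f / h ^
m` a unit, and the sections are `Γ(V)[w]`. This is unramified because `m` and `w` are units, and
flat because it is torsion-free over a Dedekind domain. -/
theorem etale_app [IsAlgClosed k] {V : C.scheme.Opens} (hV : IsAffineOpen V) [Nonempty V]
    (hVS : ∀ x ∈ S, x.1 ∉ V) {h : C.scheme.functionField} (h0 : h ≠ 0)
    (hh : ∀ y : PrimeDivisor C.scheme, y.1 ∈ V → Scheme.ord h y.1 = d.E y) :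
    (d.cover.hom.app V).hom.Etale := by
  have hN := d.isNormalModel_genericFibre hμ hmk
  have := d.formallyUnramified hmk
  have hD (y : PrimeDivisor C.scheme) (hy : y.1 ∈ V) : d.D y = 0 := by
    by_contra hne
    exact hVS y (d.support_subset (Finsupp.mem_support_iff.mpr hne)) hy
  have htw (i : ℕ) (y : PrimeDivisor C.scheme) (hy : y.1 ∈ V) : d.twist i y = i * d.E y := by
    rw [twist_apply, hD y hy]; simp
  let := (d.cover.hom.app V).hom.toAlgebra
  let := (hN.incl V).toAlgebra
  have : IsScalarTower Γ(C.scheme, V) C.scheme.functionField d.Alg := .of_algebraMap_eq fun _ => rfl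
  have : IsScalarTower Γ(C.scheme, V) Γ(d.cover.left, d.cover.hom ⁻¹ᵁ V) d.Alg :=
    .of_algebraMap_eq fun g => (pullSections_app hN.comp_hom hV g).symm
  have hinj : Function.Injective (algebraMap Γ(d.cover.left, d.cover.hom ⁻¹ᵁ V) d.Alg) :=
    hN.injective V hV
  obtain ⟨w, hw⟩ : (h⁻¹ • AdjoinRoot.root _ ^ 1 : d.Alg) ∈ (hN.incl V).range :=
    (d.mem_range_pullSections_genericFibre hV).mpr fun x hx => d.smul_root_pow_mem (.inr (by
      rw [htw _ _ hx, ord_inv h0, hh x hx]; simp))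
  have hw' : algebraMap _ d.Alg w = h⁻¹ • AdjoinRoot.root _ :=
    by rw [← pow_one (AdjoinRoot.root _)]; exact hw
  have hne : h⁻¹ ^ m * d.f ≠ 0 := mul_ne_zero (pow_ne_zero _ (inv_ne_zero h0)) d.f_ne_zero
  have hord (y : PrimeDivisor C.scheme) (hy : y.1 ∈ V) : Scheme.ord (h⁻¹ ^ m * d.f) y.1 = 0 := by
    rw [Scheme.ord_mul (pow_ne_zero _ (inv_ne_zero h0)) d.f_ne_zero, ord_pow (inv_ne_zero h0),
      ord_inv h0, hh y hy, d.ord_f, hD y hy]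
    ring
  obtain ⟨r, hr⟩ := C.mem_range_germ hV (c := h⁻¹ ^ m * d.f) fun y hy => .inr
    (by rw [hord y hy]; simp)
  obtain ⟨r', hr'⟩ := C.mem_range_germ hV (c := (h⁻¹ ^ m * d.f)⁻¹) fun y hy => .inr (by
    rw [ord_inv hne, hord y hy]; simp)
  have hrr' : r * r' = 1 := Scheme.germToFunctionField_injective C.scheme V (by
    rw [map_mul, map_one]
    exact (congrArg₂ (· * ·) hr hr').trans (mul_inv_cancel₀ hne))
  have hwm : w ^ m = algebraMap _ _ r := hinj (by
    rw [map_pow, hw', ← IsScalarTower.algebraMap_apply, _root_.smul_pow, d.root_pow_m,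
      Algebra.smul_def, ← map_mul, IsScalarTower.algebraMap_apply _ C.scheme.functionField]
    exact congrArg _ hr.symm)
  have hwu : IsUnit w := by
    refine (isUnit_pow_iff (NeZero.ne m)).mp ?_
    rw [hwm]
    exact (IsUnit.of_mul_eq_one _ hrr').map _
  have hmu : IsUnit (m : Γ(d.cover.left, d.cover.hom ⁻¹ᵁ V)) := by
    have h1 : IsUnit (m : Γ(Spec (.of k), ⊤)) := by
      rw [← map_natCast (Scheme.ΓSpecIso (.of k)).inv.hom]
      exact hmk.isUnit.map _
    have h2 := h1.map ((d.cover.hom ≫ C.str).appLE ⊤ (d.cover.hom ⁻¹ᵁ V) le_top).hom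
    rwa [map_natCast] at h2
  -- On `V` the twist of index `i` is `i E`, so a section `∑ c_i z ^ i` equals `∑ (c_i h ^ i) w ^ i`
  -- with regular coefficients `c_i h ^ i`.
  have hadj : Algebra.adjoin Γ(C.scheme, V) {w} = ⊤ := by
    refine top_le_iff.mp fun b _ => ?_
    have hb := (d.mem_range_pullSections_genericFibre hV).mp ⟨b, rfl⟩
    have hc (i : Fin m) : ∃ g : Γ(C.scheme, V), C.scheme.germToFunctionField V g =
        d.coeff i (hN.incl V b) * h ^ (i : ℕ) := by
      refine C.mem_range_germ hV fun y hy => ?_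
      have h1 := hb y hy i i.2
      refine IsSectionAt.mul (E := d.twist i) (F := - d.twist i) h1 (.inr ?_) (by simp)
      rw [ord_pow h0, hh y hy, Finsupp.neg_apply, htw _ _ hy, neg_neg]
    choose g hg using hc
    have : b = ∑ i : Fin m, g i • w ^ (i : ℕ) := hinj (by
      refine (d.eq_sum_coeff (hN.incl V b)).trans ?_
      rw [map_sum, Finset.sum_range]
      refine Finset.sum_congr rfl fun i _ => ?_
      rw [Algebra.smul_def (g i), map_mul, map_pow, hw', ← IsScalarTower.algebraMap_apply,
        IsScalarTower.algebraMap_apply _ C.scheme.functionField, _root_.smul_pow,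
          ← Algebra.smul_def,
        smul_smul]
      congr 1
      refine Eq.trans ?_ (congrArg (· * h⁻¹ ^ (i : ℕ)) (hg i).symm)
      rw [mul_assoc, ← mul_pow, mul_inv_cancel₀ h0, one_pow, mul_one])
    rw [this]
    exact sum_mem fun i _ => Subalgebra.smul_mem _ (pow_mem
      (Algebra.self_mem_adjoin_singleton _ _) _) _
  have := formallyUnramified_of_adjoin_eq_top hadj hmu hwu hwm
  have := isDedekindDomain C.str hV
  have : Module.IsTorsionFree Γ(C.scheme, V) Γ(d.cover.left, d.cover.hom ⁻¹ᵁ V) := by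
    have := functionField_isFractionRing_of_isAffineOpen C.scheme V hV
    have : FaithfulSMul Γ(C.scheme, V) C.scheme.functionField :=
      (faithfulSMul_iff_algebraMap_injective _ _).mpr (IsFractionRing.injective _ _)
    have : Module.IsTorsionFree Γ(C.scheme, V) d.Alg :=
      .trans_faithfulSMul Γ(C.scheme, V) C.scheme.functionField _
    exact hinj.moduleIsTorsionFree _ fun r b => by
      rw [Algebra.smul_def, map_mul, Algebra.smul_def, ← IsScalarTower.algebraMap_apply]
  have : Module.Finite Γ(C.scheme, V) Γ(d.cover.left, d.cover.hom ⁻¹ᵁ V) :=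
    (hN.finite_and_exists_isStandardSmooth hV).1
  have : Algebra.FinitePresentation Γ(C.scheme, V) Γ(d.cover.left, d.cover.hom ⁻¹ᵁ V) :=
    Algebra.FinitePresentation.of_finiteType.mp inferInstance
  exact (Algebra.Etale.of_formallyUnramified_of_flat :
    Algebra.Etale Γ(C.scheme, V) Γ(d.cover.left, d.cover.hom ⁻¹ᵁ V))

theorem isEtaleOutside [IsAlgClosed k] : C.IsEtaleOutside S d.cover := fun U hU =>
  morphismRestrict_of_forall_app @Etale.{u} _ fun x hx => by
    obtain ⟨V, hV, hxV, hVS, h, h0, hh⟩ := C.exists_local_equations x (fun _ : Unit => d.E) S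
      (Finset.finite_toSet _)
    obtain ⟨_, ⟨V', hV', rfl⟩, hxV', hVV'⟩ := C.scheme.isBasis_affineOpens.exists_subset_of_mem_open
      (show x ∈ ((U ⊓ V : C.scheme.Opens) : Set C.scheme) from ⟨hx, hxV⟩) (U ⊓ V).isOpen
    have : Nonempty V' := ⟨⟨x, hxV'⟩⟩
    exact ⟨V', fun y hy => (hVV' hy).1, hV', hxV', d.etale_app hμ hmk hV'
      (fun y hy hyV => hU y hy (hVV' hyV).1) (h0 ()) fun y hy => hh () y (hVV' hy).2⟩

end
end KummerDatum

theorem exists_genericMap_eq {Y : Scheme.{u}} [AlgebraicGeometry.IsIntegral Y] {Ω : Type u}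
    [Field Ω]
    (y : Spec (.of Ω) ⟶ Y) (hy : ∀ t, y t = genericPoint Y) :
    ∃ _ : Algebra Y.functionField Ω, y = genericMap Y Ω := by
  obtain ⟨⟨x, φ⟩, rfl⟩ := (Scheme.SpecToEquivOfField Ω Y).symm.surjective y
  have hx : x = genericPoint Y := by
    rw [← hy (IsLocalRing.closedPoint Ω)]
    exact (Scheme.fromSpecResidueField_apply x _).symm
  subst hx
  refine ⟨(Y.residue _ ≫ φ).hom.toAlgebra, ?_⟩
  change Spec.map φ ≫ Y.fromSpecResidueField _ = Spec.map (Y.residue _ ≫ φ) ≫ _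
  rw [Spec.map_comp, Category.assoc]
  rfl

theorem primeDivisor_ne_genericPoint {Y : Scheme.{u}} [AlgebraicGeometry.IsIntegral Y]
    (y : PrimeDivisor Y) : y.1 ≠ genericPoint Y := by
  intro h
  have h1 := y.2
  rw [h, Order.coheight_eq_zero.mpr fun z _ =>
    (genericPoint_specializes z : genericPoint Y ⤳ z)] at h1
  exact zero_ne_one h1

/-! ### The Galois action on the cyclic cover -/

namespace KummerDatum
section
variable {k : Type u} [Field k] {C : SmoothProjectiveCurve k} {m : ℕ} [NeZero m]
  {S : Finset (PrimeDivisor C.scheme)} (d : KummerDatum m S)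

omit [NeZero m] in
theorem eval₂_eq_zero {R : Type*} [CommRing R] [Algebra C.scheme.functionField R] {r : R}
    (hr : r ^ m = algebraMap _ R d.f) :
    (Polynomial.X ^ m - Polynomial.C d.f).eval₂ (algebraMap C.scheme.functionField R) r = 0 := by
  rw [Polynomial.eval₂_sub, Polynomial.eval₂_X_pow, Polynomial.eval₂_C, hr, sub_self]

/-- A root of the equation of the generic fibre gives a point. -/
noncomputable def liftRoot {R : Type*} [CommRing R] [Algebra C.scheme.functionField R] (r : R)
    (hr : r ^ m = algebraMap _ R d.f) : d.Alg →ₐ[C.scheme.functionField] R where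
  __ := AdjoinRoot.lift (algebraMap _ R) r (d.eval₂_eq_zero hr)
  commutes' _ := AdjoinRoot.lift_of (d.eval₂_eq_zero hr)

omit [NeZero m] in
theorem liftRoot_root {R : Type*} [CommRing R] [Algebra C.scheme.functionField R] (r : R)
    (hr : r ^ m = algebraMap _ R d.f) : d.liftRoot r hr (AdjoinRoot.root _) = r :=
  AdjoinRoot.lift_root (d.eval₂_eq_zero hr)

theorem scaleHom_root (ζ : C.scheme.functionField) (hζ : ζ ^ m = 1) :
    d.scaleHom ζ hζ (AdjoinRoot.root _) = ζ • AdjoinRoot.root _ := by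
  have := d.scale_smul_root_pow ζ hζ 1 1
  rwa [one_smul, pow_one, pow_one, mul_one] at this

theorem map_root_pow {R : Type*} [CommRing R] [Algebra C.scheme.functionField R]
    (φ : d.Alg →ₐ[C.scheme.functionField] R) :
    φ (AdjoinRoot.root _) ^ m = algebraMap _ R d.f := by
  rw [← map_pow, d.root_pow_m, φ.commutes]

variable {μ : k} (hμ : IsPrimitiveRoot μ m)

/-- The isomorphism of `ℤ / m` with the group of roots of unity given by `μ`. -/
noncomputable def rootsEquiv : Multiplicative (ZMod m) ≃* rootsOfUnity m C.scheme.functionField :=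
  have h : IsPrimitiveRoot ((hμ.map_of_injective C.const.injective).toRootsOfUnity :
    (C.scheme.functionField)ˣ) m := IsPrimitiveRoot.coe_units_iff.mp
      (hμ.map_of_injective C.const.injective)
  (AddEquiv.toMultiplicativeLeft h.zmodEquivZPowers).trans (MulEquiv.subgroupCongr h.zpowers_eq)

theorem rootsEquiv_one : ((rootsEquiv (C := C) hμ (.ofAdd 1) : (C.scheme.functionField)ˣ) :
    C.scheme.functionField) = C.const μ := by
  have h : IsPrimitiveRoot ((hμ.map_of_injective C.const.injective).toRootsOfUnity :
    (C.scheme.functionField)ˣ) m := IsPrimitiveRoot.coe_units_iff.mp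
      (hμ.map_of_injective C.const.injective)
  have h1 := h.zmodEquivZPowers_apply_coe_nat 1
  rw [Nat.cast_one] at h1
  refine (congrArg (fun t => (((Additive.toMul t).1 : (C.scheme.functionField)ˣ) :
    C.scheme.functionField)) h1).trans ?_
  simp

/-- The action of `ℤ / m` on the generic fibre. -/
noncomputable def rotationHom : Multiplicative (ZMod m) →*
    (d.Alg ≃ₐ[C.scheme.functionField] d.Alg) :=
  (autAdjoinRootXPowSubC m d.f).comp (rootsEquiv hμ).toMonoidHom

theorem rotationHom_root (g : Multiplicative (ZMod m)) : d.rotationHom hμ g (AdjoinRoot.root _) =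
    ((rootsEquiv (C := C) hμ g : (C.scheme.functionField)ˣ) : C.scheme.functionField) •
      AdjoinRoot.root _ :=
  autAdjoinRootXPowSubC_root _ _

variable (hmk : (m : k) ≠ 0)

theorem muAut_eq : (((d.isNormalModel_genericFibre hμ hmk).autHom (d.rotationHom hμ))
    (.ofAdd 1)).hom =
    muAut hμ d := by
  have hN := d.isNormalModel_genericFibre hμ hmk
  refine hN.hom_ext (((hN.comp_autHom _ _)).trans (Eq.trans ?_ (d.genericFibre_rotation _ _).symm))
  congr 3
  refine AdjoinRoot.ringHom_ext (RingHom.ext fun c => ?_) ?_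
  · exact ((d.rotationHom hμ (.ofAdd 1)).commutes c).trans
      ((d.scaleHom (C.const μ) (isPrimitiveRoot_const hμ).pow_eq_one).commutes c).symm
  · refine (d.rotationHom_root hμ _).trans ?_
    rw [rootsEquiv_one]
    exact (d.scaleHom_root _ (isPrimitiveRoot_const hμ).pow_eq_one).symm

/-- A geometric point of the cover over the generic point is an `m`-th root of `f` in `Ω`. Such
roots exist, and any two differ by a unique `m`-th root of unity, which already lies in `K` as a
power of `μ`. -/
theorem isGaloisCover [IsAlgClosed k] : C.IsGaloisCover d.cover
    ((d.isNormalModel_genericFibre hμ hmk).autHom (d.rotationHom hμ)) where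
  isCover := by
    obtain ⟨U, -, hη, hUS⟩ := C.exists_affineOpen_notMem (genericPoint C.scheme) S
      (Finset.finite_toSet _) fun y _ =>
        primeDivisor_ne_genericPoint y
    have : Nonempty U := ⟨⟨_, hη⟩⟩
    have := d.formallyUnramified hmk
    exact (d.isNormalModel_genericFibre hμ hmk).isCover (d.isEtaleOutside hμ hmk U hUS)
  simply_transitive Ω _ _ y hy := by
    have hN := d.isNormalModel_genericFibre hμ hmk
    obtain ⟨_, rfl⟩ := exists_genericMap_eq y hy
    refine ⟨?_, fun w w' hw hw' => ?_⟩
    · obtain ⟨r, hr⟩ := IsAlgClosed.exists_pow_nat_eq (algebraMap _ Ω d.f)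
        (Nat.pos_of_ne_zero (NeZero.ne m))
      exact ⟨Spec.map (CommRingCat.ofHom (d.liftRoot r hr).toRingHom) ≫ d.genericFibre, by
        rw [Category.assoc, hN.comp_hom, map_genericMap]⟩
    · obtain ⟨φ, rfl, -⟩ := hN.existsUnique_algHom hw
      obtain ⟨φ', hφ', huniq⟩ := hN.existsUnique_algHom hw'
      have h0 (g : Multiplicative (ZMod m)) :
          (Spec.map (CommRingCat.ofHom φ.toRingHom) ≫ d.genericFibre) ≫
            (hN.autHom (d.rotationHom hμ) g).hom.left =
          Spec.map (CommRingCat.ofHom (φ.comp (d.rotationHom hμ g).toAlgHom).toRingHom) ≫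
            d.genericFibre := by
        rw [Category.assoc, hN.comp_autHom, ← Category.assoc, ← Spec.map_comp]
        rfl
      have h1 (g : Multiplicative (ZMod m)) :
          (Spec.map (CommRingCat.ofHom φ.toRingHom) ≫ d.genericFibre) ≫
            (hN.autHom (d.rotationHom hμ) g).hom.left = w' ↔
          algebraMap _ Ω ((rootsEquiv (C := C) hμ g : (C.scheme.functionField)ˣ) :
            C.scheme.functionField) * φ (AdjoinRoot.root _) = φ' (AdjoinRoot.root _) := by
        rw [h0]
        have h2 : φ (d.rotationHom hμ g (AdjoinRoot.root _)) =
          algebraMap _ Ω ((rootsEquiv (C := C) hμ g : (C.scheme.functionField)ˣ) :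
            C.scheme.functionField) * φ (AdjoinRoot.root _) := by
          rw [rotationHom_root, map_smul, Algebra.smul_def]
        rw [← h2]
        constructor
        · intro h
          rw [← huniq _ h]
          rfl
        · intro h
          rw [← hφ']
          congr 3
          exact congrArg AlgHom.toRingHom (AdjoinRoot.algHom_ext h :
            φ.comp (d.rotationHom hμ g).toAlgHom = φ')
      simp only [h1]
      have hr0 : φ (AdjoinRoot.root _) ≠ 0 := (d.isUnit_root.map φ).ne_zero
      have hr0' : φ' (AdjoinRoot.root _) ≠ 0 := (d.isUnit_root.map φ').ne_zero
      have hq : (φ' (AdjoinRoot.root _) / φ (AdjoinRoot.root _)) ^ m = 1 := by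
        rw [div_pow, map_root_pow, map_root_pow, div_self]
        exact (map_ne_zero_iff _ (algebraMap _ Ω).injective).mpr d.f_ne_zero
      obtain ⟨i, -, hi⟩ := ((isPrimitiveRoot_const (C := C) hμ).map_of_injective
        (algebraMap _ Ω).injective).eq_pow_of_pow_eq_one hq
      rw [← map_pow] at hi
      obtain ⟨g, hg⟩ := (rootsEquiv (C := C) hμ).surjective
        (rootsOfUnity.mkOfPowEq (C.const μ ^ i) (by
          rw [← pow_mul, mul_comm, pow_mul, (isPrimitiveRoot_const hμ).pow_eq_one, one_pow]))
      refine ⟨g, ?_, fun g' hg' => (rootsEquiv (C := C) hμ).injective ?_⟩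
      · simp only [hg, rootsOfUnity.coe_mkOfPowEq, hi]
        exact div_mul_cancel₀ _ hr0
      · rw [hg]
        refine Subtype.ext (Units.ext ((algebraMap _ Ω).injective ?_))
        rw [rootsOfUnity.coe_mkOfPowEq, hi]
        exact eq_div_of_mul_eq hr0 hg'

end
end KummerDatum

/-! ### Kummer theory for several radicals -/

section KummerAlgebra
variable {K : Type u} [Field K] {ι : Type u} {T : Type u} [CommRing T] [Algebra K T]

/-- The `K`-algebra `T` is generated by `m`-th roots `z i` of the `f i`, subject to no further
relations. -/
structure IsKummerAlgebra (m : ℕ) (f : ι → K) (z : ι → T) : Prop where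
  pow_eq : ∀ i, z i ^ m = algebraMap K T (f i)
  existsUnique_algHom : ∀ (R : Type u) [CommRing R] [Algebra K R] (r : ι → R),
    (∀ i, r i ^ m = algebraMap K R (f i)) → ∃! φ : T →ₐ[K] R, ∀ i, φ (z i) = r i

/-- The only relations between the `f i` modulo `m`-th powers are the trivial ones. -/
def IndependentModPowers (m : ℕ) [Fintype ι] (f : ι → K) : Prop :=
  ∀ a : ι → ℤ, (∃ g : K, g ≠ 0 ∧ g ^ m = ∏ i, f i ^ a i) → ∀ i, (m : ℤ) ∣ a i

namespace IsKummerAlgebra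
variable {m : ℕ} {f : ι → K} {z : ι → T} (h : IsKummerAlgebra m f z)
include h

theorem algHom_ext {R : Type u} [CommRing R] [Algebra K R] {φ ψ : T →ₐ[K] R}
    (e : ∀ i, φ (z i) = ψ (z i)) : φ = ψ :=
  (h.existsUnique_algHom R (fun i => ψ (z i)) fun i => by
    rw [← map_pow, h.pow_eq, ψ.commutes]).unique e fun _ => rfl

/-- The universal property gives a map into the subalgebra generated by the roots, and its composite
with the inclusion fixes the roots, so it is the identity. -/
theorem adjoin_eq_top : Algebra.adjoin K (Set.range z) = ⊤ := by
  obtain ⟨φ, hφ, -⟩ := h.existsUnique_algHom (Algebra.adjoin K (Set.range z))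
    (fun i => ⟨z i, Algebra.subset_adjoin ⟨i, rfl⟩⟩) fun i => Subtype.ext (h.pow_eq i)
  have h1 : (Subalgebra.val _).comp φ = AlgHom.id K T :=
    h.algHom_ext fun i => congrArg Subtype.val (hφ i)
  refine top_le_iff.mp fun x _ => ?_
  rw [← AlgHom.id_apply (R := K) x, ← h1]
  exact (φ x).2

variable [NeZero m]

theorem span_eq_top [Fintype ι] :
    Submodule.span K (Set.range fun a : ι → Fin m => ∏ i, z i ^ (a i : ℕ)) = ⊤ := by
  classical
  set N := Submodule.span K (Set.range fun a : ι → Fin m => ∏ i, z i ^ (a i : ℕ)) with hN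
  have hmul (i : ι) : ∀ y ∈ N, z i * y ∈ N := by
    intro y hy
    induction hy using Submodule.span_induction with
    | zero => simp
    | add x y _ _ hx hy => rw [mul_add]; exact N.add_mem hx hy
    | smul c x _ hx => rw [mul_smul_comm]; exact N.smul_mem c hx
    | mem y hy =>
      obtain ⟨a, rfl⟩ := hy
      have hupd (n : Fin m) : ∏ l, z l ^ (Function.update a i n l : ℕ) =
          z i ^ (n : ℕ) * ∏ l ∈ Finset.univ.erase i, z l ^ (a l : ℕ) := by
        rw [← Finset.mul_prod_erase _ _ (Finset.mem_univ i), Function.update_self]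
        congr 1
        refine Finset.prod_congr rfl fun l hl => ?_
        rw [Function.update_of_ne (Finset.ne_of_mem_erase hl)]
      simp only []
      rw [← Finset.mul_prod_erase _ _ (Finset.mem_univ i), ← mul_assoc, ← pow_succ']
      by_cases hlt : (a i : ℕ) + 1 < m
      · exact Submodule.subset_span ⟨Function.update a i ⟨a i + 1, hlt⟩, hupd _⟩
      · have hm : (a i : ℕ) + 1 = m := by have := (a i).2; omega
        rw [hm, h.pow_eq, ← Algebra.smul_def]
        refine N.smul_mem _ (Submodule.subset_span ⟨Function.update a i 0, ?_⟩)
        refine (hupd 0).trans ?_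
        rw [Fin.val_zero, pow_zero, one_mul]
  -- The elements that multiply the span `N` into itself form a subalgebra containing the
  -- generators, hence everything; applying this to `1 ∈ N` shows that `N` is all of `T`.
  let M : Subalgebra K T :=
    { carrier := {x | ∀ y ∈ N, x * y ∈ N}
      mul_mem' := fun {x x'} hx hx' y hy => by rw [mul_assoc]; exact hx _ (hx' _ hy)
      add_mem' := fun {x x'} hx hx' y hy => by rw [add_mul]; exact N.add_mem (hx _ hy) (hx' _ hy)
      algebraMap_mem' := fun c y hy => by rw [← Algebra.smul_def]; exact N.smul_mem c hy }
  have hM : M = ⊤ := top_le_iff.mp (h.adjoin_eq_top ▸ Algebra.adjoin_le (by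
    rintro _ ⟨i, rfl⟩; exact hmul i))
  refine top_le_iff.mp fun x _ => ?_
  have h1 : (1 : T) ∈ N := Submodule.subset_span ⟨fun _ => 0, by simp⟩
  have hx : x ∈ M := hM ▸ trivial
  simpa using hx 1 h1

theorem moduleFinite [Fintype ι] : Module.Finite K T :=
  ⟨Submodule.fg_def.mpr ⟨_, Set.finite_range _, h.span_eq_top⟩⟩

omit h in
-- Each monomial is an eigenvector of the Galois group, with a character into the roots of unity.
-- Equal characters would make a quotient of monomials lie in `K`, giving a relation modulo `m`-th
-- powers; so the characters are distinct, and Dedekind's independence of characters concludes.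
theorem linearIndependent_prod_pow {L : Type*} [Field L] [Algebra K L] [IsGalois K L] [Fintype ι]
    {ζ : K} (hζ : IsPrimitiveRoot ζ m) (hf : IndependentModPowers m f) {w : ι → L}
    (hw : ∀ i, w i ^ m = algebraMap K L (f i)) (hw0 : ∀ i, w i ≠ 0) :
    LinearIndependent K fun a : ι → Fin m => ∏ i, w i ^ (a i : ℕ) := by
  classical
  have hm0 : 0 < m := Nat.pos_of_ne_zero (NeZero.ne m)
  let t (a : ι → Fin m) : L := ∏ i, w i ^ (a i : ℕ)
  have ht0 (a) : t a ≠ 0 := Finset.prod_ne_zero_iff.mpr fun i _ => pow_ne_zero _ (hw0 i)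
  have htm (a) : t a ^ m = algebraMap K L (∏ i, f i ^ (a i : ℕ)) := by
    rw [map_prod, ← Finset.prod_pow]
    exact Finset.prod_congr rfl fun i _ => by rw [← pow_mul, mul_comm, pow_mul, hw, map_pow]
  have hroot (σ : L ≃ₐ[K] L) (a) : ∃ c : K, σ (t a) = algebraMap K L c * t a := by
    have h1 : (σ (t a) / t a) ^ m = 1 := by
      rw [div_pow, ← map_pow, htm, σ.commutes, div_self]
      rw [← htm]; exact pow_ne_zero _ (ht0 a)
    obtain ⟨j, -, hj⟩ := (hζ.map_of_injective (algebraMap K L).injective).eq_pow_of_pow_eq_one h1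
    refine ⟨ζ ^ j, ?_⟩
    rw [map_pow, hj, div_mul_cancel₀ _ (ht0 a)]
  let χ (a : ι → Fin m) : (L ≃ₐ[K] L) →* L :=
    { toFun := fun σ => σ (t a) / t a
      map_one' := div_self (ht0 a)
      map_mul' := fun σ τ => by
        obtain ⟨c, hc⟩ := hroot τ a
        rw [AlgEquiv.mul_apply, hc, map_mul, σ.commutes, mul_div_assoc, mul_comm,
          mul_div_cancel_right₀ _ (ht0 a)] }
  have hχ : Function.Injective χ := by
    intro a b hab
    have h1 (σ : L ≃ₐ[K] L) : σ (t a / t b) = t a / t b := by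
      have := DFunLike.congr_fun hab σ
      change σ (t a) / t a = σ (t b) / t b at this
      rw [map_div₀, div_eq_div_iff ((map_ne_zero σ).mpr (ht0 b)) (ht0 b)]
      rw [div_eq_div_iff (ht0 a) (ht0 b)] at this
      rw [this, mul_comm]
    obtain ⟨g, hg⟩ := IntermediateField.mem_bot.mp ((InfiniteGalois.mem_bot_iff_fixed _).mpr h1)
    have hf0 (i) : f i ≠ 0 := by
      intro hi
      have := hw i
      rw [hi, map_zero] at this
      exact hw0 i (eq_zero_of_pow_eq_zero this)
    have h2 : g ^ m = ∏ i, f i ^ ((a i : ℤ) - (b i : ℤ)) := by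
      refine (algebraMap K L).injective ?_
      rw [map_pow, hg, div_pow, htm, htm, ← map_div₀, ← Finset.prod_div_distrib]
      congr 1
      exact Finset.prod_congr rfl fun i _ => by
        rw [zpow_sub₀ (hf0 i), zpow_natCast, zpow_natCast]
    have h3 := hf _ ⟨g, fun h0 => by
      rw [h0, map_zero] at hg
      exact div_ne_zero (ht0 a) (ht0 b) hg.symm, h2⟩
    funext i
    refine Fin.ext ?_
    have h4 := (a i).2
    have h5 := (b i).2
    -- Both exponents lie in `[0, m)`, so a difference divisible by `m` vanishes.
    have h6 := Int.eq_zero_of_abs_lt_dvd (h3 i) (by rw [abs_lt]; omega)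
    omega
  rw [Fintype.linearIndependent_iff]
  intro c hc a
  have hli := (linearIndependent_monoidHom (L ≃ₐ[K] L) L).comp χ hχ
  rw [Fintype.linearIndependent_iff] at hli
  have := hli (fun a => algebraMap K L (c a) * t a) (by
    funext σ
    have h1 := congrArg σ hc
    rw [map_sum, map_zero] at h1
    rw [Finset.sum_apply, Pi.zero_apply, ← h1]
    refine Finset.sum_congr rfl fun a _ => ?_
    change algebraMap K L (c a) * t a * (σ (t a) / t a) = σ (c a • t a)
    rw [map_smul, Algebra.smul_def, mul_assoc, mul_div_cancel₀ _ (ht0 a)]) a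
  exact (map_eq_zero _).mp ((mul_eq_zero.mp this).resolve_right (ht0 a))

/-- Choosing roots in a separable closure maps `T` to a field. The reduced monomials span `T` and
have independent images, so the map is injective. -/
theorem isDomain [Fintype ι] {ζ : K} (hζ : IsPrimitiveRoot ζ m) (hm : (m : K) ≠ 0)
    (hf : IndependentModPowers m f) (hf0 : ∀ i, f i ≠ 0) : IsDomain T := by
  classical
  -- Invertibility of `m` is what guarantees that `m`-th roots exist already in the separable
  -- closure.
  have : NeZero (m : SeparableClosure K) := ⟨by
    rw [← map_natCast (algebraMap K _)]; exact (map_ne_zero _).mpr hm⟩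
  choose w hw using fun i => IsSepClosed.exists_pow_nat_eq (algebraMap K (SeparableClosure K)
    (f i)) m
  obtain ⟨φ, hφ, -⟩ := h.existsUnique_algHom _ w hw
  have hli := linearIndependent_prod_pow hζ hf hw fun i h0 => by
    have := hw i
    rw [h0, zero_pow (NeZero.ne m), eq_comm, map_eq_zero] at this
    exact hf0 i this
  rw [Fintype.linearIndependent_iff] at hli
  have hinj : Function.Injective φ := by
    rw [injective_iff_map_eq_zero]
    intro x hx
    have hx' : x ∈ (⊤ : Submodule K T) := trivial
    rw [← h.span_eq_top] at hx'
    obtain ⟨c, rfl⟩ := (Submodule.mem_span_range_iff_exists_fun K).mp hx'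
    have := hli c (by
      rw [← hx, map_sum]
      exact Finset.sum_congr rfl fun a _ => by simp [hφ])
    exact Finset.sum_eq_zero fun a _ => by rw [this a, zero_smul]
  exact hinj.isDomain φ.toRingHom

omit [NeZero m] in
/-- The automorphism that multiplies the generators by `m`-th roots of unity. -/
theorem existsUnique_smul (ζ : ι → K) (hζ : ∀ i, ζ i ^ m = 1) :
    ∃! φ : T →ₐ[K] T, ∀ i, φ (z i) = ζ i • z i :=
  h.existsUnique_algHom T _ fun i => by rw [smul_pow, hζ, one_smul, h.pow_eq]

/-- If `∏ f_l ^ a_l = g ^ m`, then in the domain `T` the element `t = ∏ z_l ^ a_l` is `g` times an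
`m`-th root of unity, hence in `K`. The automorphism scaling only `z_i` by `ζ` fixes `t` but also
multiplies it by `ζ ^ a_i`. The computation is in units since exponents may be negative. -/
theorem independent [Fintype ι] [IsDomain T] {ζ : K} (hζ : IsPrimitiveRoot ζ m)
    (hf0 : ∀ i, f i ≠ 0) : IndependentModPowers m f := by
  classical
  rintro a ⟨g, hg0, hg⟩ i
  have hu (i) : IsUnit (z i) := isUnit_of_mul_isUnit_left (y := z i ^ (m - 1)) (by
    rw [← pow_succ', Nat.sub_add_cancel (NeZero.one_le), h.pow_eq]
    exact (hf0 i).isUnit.map _)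
  let u (i) : Tˣ := (hu i).unit
  let t : Tˣ := ∏ i, u i ^ a i
  let γ : Tˣ := Units.map (algebraMap K T).toMonoidHom (Units.mk0 g hg0)
  have hu (i) : u i ^ m = Units.map (algebraMap K T).toMonoidHom (Units.mk0 (f i) (hf0 i)) :=
    Units.ext (h.pow_eq i)
  have ht : t ^ m = γ ^ m := by
    rw [← map_pow, ← Finset.prod_pow]
    have : (Units.mk0 g hg0) ^ m = ∏ i, (Units.mk0 (f i) (hf0 i)) ^ a i :=
      Units.ext (by simpa [Units.coe_prod] using hg)
    rw [this, map_prod]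
    refine Finset.prod_congr rfl fun i _ => ?_
    rw [map_zpow, ← hu, ← zpow_natCast, ← zpow_natCast, zpow_comm]
  have h1 : ((t / γ : Tˣ) : T) ^ m = 1 := by
    rw [← Units.val_pow_eq_pow_val, div_pow, ht, div_self']; rfl
  have hT : IsPrimitiveRoot (algebraMap K T ζ) m := hζ.map_of_injective (algebraMap K T).injective
  obtain ⟨j, -, hj⟩ := hT.eq_pow_of_pow_eq_one h1
  have htK : (t : T) = algebraMap K T (ζ ^ j * g) := by
    rw [map_mul, map_pow, hj]
    change _ = ((t / γ * γ : Tˣ) : T)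
    rw [div_mul_cancel]
  obtain ⟨φ, hφ, -⟩ := h.existsUnique_smul (fun l => if l = i then ζ else 1) fun l => by
    split_ifs
    exacts [hζ.pow_eq_one, one_pow m]
  let ξ : Tˣ := (hT.isUnit (NeZero.ne m)).unit
  have h2 (l) : Units.map φ.toRingHom.toMonoidHom (u l) = (if l = i then ξ else 1) * u l := by
    refine Units.ext ((hφ l).trans ?_)
    change _ = _ * z l
    split_ifs
    · exact Algebra.smul_def _ _
    · rw [one_smul, Units.val_one, one_mul]
  have h3 : Units.map φ.toRingHom.toMonoidHom t = ξ ^ a i * t := by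
    rw [map_prod]
    simp only [map_zpow, h2, mul_zpow, Finset.prod_mul_distrib]
    congr 1
    rw [Finset.prod_eq_single i (fun l _ hl => by rw [if_neg hl, one_zpow]) (by simp), if_pos rfl]
  have h4 : Units.map φ.toRingHom.toMonoidHom t = t := by
    refine Units.ext ?_
    change φ (t : T) = t
    rw [htK, φ.commutes]
  rw [h4, eq_comm, mul_eq_right] at h3
  have h5 : IsPrimitiveRoot ξ m := IsPrimitiveRoot.coe_units_iff.mp hT
  exact (h5.zpow_eq_one_iff_dvd _).mp h3

end IsKummerAlgebra
end KummerAlgebra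

/-! ### Connectedness and equivariant isomorphisms -/

namespace KummerDatum
variable {k : Type u} [Field k] {C : SmoothProjectiveCurve k} {m : ℕ} [NeZero m]
  {S : Finset (PrimeDivisor C.scheme)} (d : KummerDatum m S)

omit [NeZero m] in
theorem existsUnique_algHom_root {R : Type*} [CommRing R] [Algebra C.scheme.functionField R] (r : R)
    (hr : r ^ m = algebraMap _ R d.f) :
    ∃! φ : d.Alg →ₐ[C.scheme.functionField] R, φ (AdjoinRoot.root _) = r :=
  ⟨d.liftRoot r hr, d.liftRoot_root r hr, fun _ h =>
    AdjoinRoot.algHom_ext (h.trans (d.liftRoot_root r hr).symm)⟩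

theorem isKummerAlgebra :
    IsKummerAlgebra m (fun _ : PUnit.{u + 1} => d.f) (fun _ => (AdjoinRoot.root _ : d.Alg)) where
  pow_eq _ := d.root_pow_m
  existsUnique_algHom R _ _ r hr := by
    obtain ⟨φ, hφ, huniq⟩ := d.existsUnique_algHom_root (r .unit) (hr .unit)
    exact ⟨φ, fun _ => hφ, fun ψ hψ => huniq ψ (hψ .unit)⟩

theorem addOrderOf_toGenPic_eq_iff_independent [IsAlgClosed k] :
    addOrderOf d.toGenPic = m ↔ IndependentModPowers m (fun _ : PUnit.{u + 1} => d.f) := by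
  rw [addOrderOf_toGenPic_eq_iff]
  constructor
  · rintro h a ⟨g, hg0, hg⟩ i
    exact h _ ⟨g, hg0, by rwa [Fintype.prod_unique] at hg⟩
  · rintro h n ⟨g, hg0, hg⟩
    exact h (fun _ => n) ⟨g, hg0, by rwa [Fintype.prod_unique]⟩ .unit

variable {μ : k} (hμ : IsPrimitiveRoot μ m) (hmk : (m : k) ≠ 0)
include hμ hmk

/-- Order `m` means independence of the single function `f`, that is, the generic fibre is a domain.
A domain gives an integral cover; a connected cover has only one prime in its generic fibre, which
is reduced because it is unramified, hence a domain. -/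
theorem addOrderOf_toGenPic_eq_iff_connectedSpace [IsAlgClosed k] :
    addOrderOf d.toGenPic = m ↔ ConnectedSpace d.cover.left := by
  have hN := d.isNormalModel_genericFibre hμ hmk
  rw [addOrderOf_toGenPic_eq_iff_independent]
  constructor
  · intro h
    have := d.isKummerAlgebra.isDomain (isPrimitiveRoot_const hμ) (natCast_ne_zero hmk) h
      fun _ => d.f_ne_zero
    have := hN.isIntegral
    infer_instance
  · intro h
    have : IsArtinianRing d.Alg := IsArtinianRing.of_finite C.scheme.functionField _
    have := hN.subsingleton_of_connectedSpace
    have := d.formallyUnramified hmk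
    have : IsReduced d.Alg := Algebra.FormallyUnramified.isReduced_of_field C.scheme.functionField _
    have : NoZeroDivisors d.Alg := ⟨fun {a b} hab => by
      have hz (c : d.Alg) (P : PrimeSpectrum d.Alg) (hc : c ∈ P.asIdeal) : c = 0 :=
        (nilpotent_iff_mem_prime.mpr fun J hJ => by
          have : P = ⟨J, hJ⟩ := Subsingleton.elim _ _
          rwa [this] at hc).eq_zero
      obtain ⟨P⟩ : Nonempty (PrimeSpectrum d.Alg) := inferInstance
      exact (P.2.mem_or_mem (hab ▸ P.asIdeal.zero_mem)).imp (hz a P) (hz b P)⟩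
    have : IsDomain d.Alg := NoZeroDivisors.to_isDomain _
    exact d.isKummerAlgebra.independent (isPrimitiveRoot_const hμ) fun _ => d.f_ne_zero

omit hmk in
theorem genericFibre_muAut : d.genericFibre ≫ (muAut hμ d).left =
    Spec.map (CommRingCat.ofHom
      (d.scaleHom (C.const μ) (isPrimitiveRoot_const hμ).pow_eq_one).toRingHom) ≫ d.genericFibre :=
  d.genericFibre_rotation _ _

omit hmk in
/-- The eigenvectors of the rotation with eigenvalue `μ` are the multiples of the root. -/
theorem exists_smul_root (hm : 1 < m) {a : d.Alg}
    (ha : d.scaleHom (C.const μ) (isPrimitiveRoot_const hμ).pow_eq_one a = C.const μ • a) :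
    ∃ c : C.scheme.functionField, a = c • AdjoinRoot.root _ := by
  have hprim := isPrimitiveRoot_const (C := C) hμ
  refine ⟨d.coeff 1 a, d.ext_coeff fun i hi => ?_⟩
  have h1 := congrArg (d.coeff i) ha
  have h2 : d.coeff i (d.scaleHom (C.const μ) hprim.pow_eq_one a) = C.const μ ^ i * d.coeff i a :=
    d.coeff_scale _ hprim.pow_eq_one a hi
  rw [h2, map_smul, smul_eq_mul] at h1
  have h3 := d.coeff_root_pow hm i
  rw [pow_one] at h3
  rw [map_smul, h3]
  split_ifs with h
  · subst h; simp
  · rw [smul_zero]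
    refine (mul_eq_mul_right_iff.mp h1).resolve_left fun h4 => h (hprim.pow_inj hi hm ?_)
    rw [h4, pow_one]

omit hmk in
-- Morphisms out of a normalization are determined on generic fibres, and an algebra map out of
-- `K[z]/(z ^ m - f)` by the image of the root, so equivariance is a single eigenvector equation.
theorem muAut_comp_eq_iff [IsNoetherian C.scheme] {W : Over C.scheme} {A : Type u} [CommRing A]
    [Algebra C.scheme.functionField A] {j : Spec (.of A) ⟶ W.left} (h : IsNormalModel W j)
    {f : W ⟶ d.cover} {φ : d.Alg →ₐ[C.scheme.functionField] A}
    (hf : j ≫ f.left = Spec.map (CommRingCat.ofHom φ.toRingHom) ≫ d.genericFibre)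
    {σ : W ⟶ W} {s : A →ₐ[C.scheme.functionField] A}
    (hσ : j ≫ σ.left = Spec.map (CommRingCat.ofHom s.toRingHom) ≫ j) :
    σ ≫ f = f ≫ muAut hμ d ↔ s (φ (AdjoinRoot.root _)) = C.const μ • φ (AdjoinRoot.root _) := by
  have hM := d.isModel_genericFibre
  have := hM.isIntegralHom
  have h1 := IsNormalModel.comp_homOfAlgHom_comp hσ hf
  have h2 := IsNormalModel.comp_homOfAlgHom_comp hf (d.genericFibre_muAut hμ)
  have h3 : φ ((d.scaleHom (C.const μ) (isPrimitiveRoot_const hμ).pow_eq_one) (AdjoinRoot.root _)) =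
      C.const μ • φ (AdjoinRoot.root _) := by
    rw [scaleHom_root, map_smul]
  have hr (ψ : d.Alg →ₐ[C.scheme.functionField] A) :
      (Spec.map (CommRingCat.ofHom ψ.toRingHom) ≫ d.genericFibre) ≫ d.cover.hom =
        genericMap C.scheme A := by
    rw [Category.assoc, hM.comp_hom, map_genericMap]
  constructor
  · intro e
    rw [e, h2] at h1
    have h4 := (hM.existsUnique_algHom (hr _)).unique h1 rfl
    rw [← h3]
    exact (DFunLike.congr_fun h4 (AdjoinRoot.root _)).symm
  · intro e
    refine h.hom_ext (h1.trans (Eq.trans ?_ h2.symm))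
    congr 3
    exact congrArg AlgHom.toRingHom (AdjoinRoot.algHom_ext (e.trans h3.symm) :
      s.comp φ = φ.comp (d.scaleHom (C.const μ) (isPrimitiveRoot_const hμ).pow_eq_one))

/-- If `f' = g ^ m f`, sending the root of `f'` to `g` times the root of `f` is an equivariant
isomorphism. Conversely an equivariant isomorphism carries the root to an eigenvector of eigenvalue
`μ`, hence to `c z`, and then `f' = c ^ m f`. -/
theorem toGenPic_eq_iff_exists_iso [IsAlgClosed k] (hm : 1 < m) (d' : KummerDatum m S) :
    d.toGenPic = d'.toGenPic ↔
      ∃ e : d.cover ≅ d'.cover, muAut hμ d ≫ e.hom = e.hom ≫ muAut hμ d' := by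
  have hN := d.isNormalModel_genericFibre hμ hmk
  have hN' := d'.isNormalModel_genericFibre hμ hmk
  rw [toGenPic_eq_iff]
  constructor
  · rintro ⟨g, hg, hf⟩
    have h1 : (g • AdjoinRoot.root _ : d.Alg) ^ m = algebraMap _ _ d'.f := by
      rw [_root_.smul_pow, d.root_pow_m, Algebra.smul_def, ← map_mul, hf]
    have h2 : (g⁻¹ • AdjoinRoot.root _ : d'.Alg) ^ m = algebraMap _ _ d.f := by
      have : g⁻¹ ^ m * d'.f = d.f := by
        rw [hf, inv_pow, inv_mul_cancel_left₀ (pow_ne_zero m hg)]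
      rw [_root_.smul_pow, d'.root_pow_m, Algebra.smul_def, ← map_mul, this]
    let φ : d'.Alg ≃ₐ[C.scheme.functionField] d.Alg :=
      AlgEquiv.ofAlgHom (d'.liftRoot _ h1) (d.liftRoot _ h2)
        (AdjoinRoot.algHom_ext (by
          rw [AlgHom.comp_apply, liftRoot_root, map_smul, liftRoot_root, inv_smul_smul₀ hg]
          rfl))
        (AdjoinRoot.algHom_ext (by
          rw [AlgHom.comp_apply, liftRoot_root, map_smul, liftRoot_root, smul_inv_smul₀ hg]
          rfl))
    refine ⟨hN.isoOfAlgEquiv hN' φ, (d'.muAut_comp_eq_iff hμ hN (hN.comp_isoOfAlgEquiv hN' φ)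
      (d.genericFibre_muAut hμ)).mpr ?_⟩
    have h3 : φ.toAlgHom (AdjoinRoot.root _) = g • AdjoinRoot.root _ := d'.liftRoot_root _ h1
    rw [h3, map_smul, scaleHom_root, smul_comm]
  · rintro ⟨e, he⟩
    have hw : (d.genericFibre ≫ e.hom.left) ≫ d'.cover.hom = genericMap C.scheme d.Alg := by
      rw [Category.assoc, Over.w, hN.comp_hom]
    obtain ⟨φ, hφ, -⟩ := hN'.existsUnique_algHom hw
    rw [d'.muAut_comp_eq_iff hμ hN hφ.symm (d.genericFibre_muAut hμ)] at he
    obtain ⟨c, hc⟩ := d.exists_smul_root hμ hm he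
    have h1 := d'.map_root_pow φ
    rw [hc, _root_.smul_pow, d.root_pow_m, Algebra.smul_def, ← map_mul] at h1
    have h2 := (algebraMap C.scheme.functionField d.Alg).injective h1
    refine ⟨c, ?_, h2.symm⟩
    rintro rfl
    rw [zero_pow (NeZero.ne m), zero_mul] at h2
    exact d'.f_ne_zero h2.symm

end KummerDatum

/-! ### Fibre products of covers and their generic fibres -/

section FiniteProducts

theorem isClosedUnderFiniteProducts_overObj (P : MorphismProperty Scheme.{u})
    [P.IsStableUnderBaseChange] [P.IsMultiplicative] {X : Scheme.{u}} :
    (P.overObj (X := X)).IsClosedUnderFiniteProducts := by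
  have : (P.overObj (X := X)).IsClosedUnderBinaryProducts := ⟨fun Z ⟨p, hp⟩ => by
    let c : BinaryFan (p.diag.obj ⟨.left⟩) (p.diag.obj ⟨.right⟩) :=
      (Cone.postcompose (diagramIsoPair p.diag).hom).obj ⟨Z, p.π⟩
    have hc : IsLimit c := (IsLimit.postcomposeHomEquiv (diagramIsoPair p.diag) _).symm p.isLimit
    have h1 := Over.isPullback_of_binaryFan_isLimit c hc
    have h2 := P.comp_mem _ _ (P.of_isPullback h1.flip (hp ⟨.right⟩)) (hp ⟨.left⟩)
    rw [show c.fst.left ≫ (p.diag.obj ⟨.left⟩).hom = Z.hom from Over.w c.fst] at h2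
    exact h2⟩
  exact .mk'

variable {Y : Scheme.{u}} {ι : Type u} [Finite ι] {V : ι → Over Y}

theorem fibreProduct_hom (P : MorphismProperty Scheme.{u}) [P.IsStableUnderBaseChange]
    [P.IsMultiplicative] (h : ∀ i, P (V i).hom) : P (fibreProduct V).hom :=
  have := isClosedUnderFiniteProducts_overObj P (X := Y)
  (P.overObj (X := Y)).prop_product h

end FiniteProducts

section GenericFibre
variable {Y : Scheme.{u}} [AlgebraicGeometry.IsIntegral Y]

/-- Take for `A` the global sections of the base change to `Spec K`. Over an affine `U` it is the
localization of the sections of `W` at the nonzero functions on `U`, and flatness makes these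
nonzerodivisors, so sections embed in `A`. -/
theorem exists_isModel (W : Over Y) [IsIntegralHom W.hom] [Flat W.hom] :
    ∃ (A : Type u) (_ : CommRing A) (_ : Algebra Y.functionField A) (j : Spec (.of A) ⟶ W.left),
      IsModel W j := by
  let K := Y.functionField
  let G := pullback W.hom (genericMap Y K)
  have hG : IsAffine G := isAffine_of_isAffineHom (pullback.snd W.hom (genericMap Y K))
  let A : Type u := Γ(G, ⊤)
  let a : K →+* A := (pullback.snd W.hom (genericMap Y K)).appTop.hom.comp
    (Scheme.ΓSpecIso (.of K)).inv.hom
  let : Algebra K A := a.toAlgebra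
  let j : Spec (.of A) ⟶ W.left := G.isoSpec.inv ≫ pullback.fst W.hom (genericMap Y K)
  have hsnd : G.isoSpec.inv ≫ pullback.snd W.hom (genericMap Y K) =
      Spec.map (CommRingCat.ofHom (algebraMap K A)) := by
    rw [← Scheme.isoSpec_inv_naturality, Scheme.isoSpec_Spec_inv, ← Spec.map_comp]
    rfl
  have hj : j ≫ W.hom = genericMap Y A := by
    rw [← map_genericMap (Algebra.ofId K A), Category.assoc, pullback.condition, ← Category.assoc,
      hsnd]
    rfl
  -- Cancelling the cartesian square of affine charts from that of the generic fibre leaves a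
  -- cartesian square of spectra, that is, `A = Γ(W_U) ⊗ K`.
  have hpo (U : Y.Opens) (hU : IsAffineOpen U) [Nonempty U] :
      IsPushout (W.hom.app U) (Y.germToFunctionField U)
        (CommRingCat.ofHom (pullSections j (W.hom ⁻¹ᵁ U) (le_preimage_of_comp_eq hj U)))
        (CommRingCat.ofHom (algebraMap K A)) := by
    have hV : IsAffineOpen (W.hom ⁻¹ᵁ U) := hU.preimage W.hom
    have h1 : IsPullback (Spec.map (W.hom.app U)) hV.fromSpec hU.fromSpec W.hom := by
      refine IsOpenImmersion.isPullback _ _ _ _ ?_ ?_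
      · rw [W.hom.app_eq_appLE]
        exact (IsAffineOpen.SpecMap_appLE_fromSpec _ _ _ _).symm
      · rw [hU.opensRange_fromSpec, hV.opensRange_fromSpec]
    have h2 : IsPullback (Spec.map (CommRingCat.ofHom (algebraMap K A))) j (genericMap Y K) W.hom :=
      (IsPullback.of_iso (IsPullback.of_hasPullback W.hom (genericMap Y K)) G.isoSpec (Iso.refl _)
        (Iso.refl _) (Iso.refl _) (by simp [j]) (by simp [← hsnd]) (by simp) (by simp)).flip
    have h3 := map_pullSections_fromSpec j hV (le_preimage_of_comp_eq hj U)
    have h4 : genericMap Y K = Spec.map (Y.germToFunctionField U) ≫ hU.fromSpec := genericMap_eq hU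
    rw [← h3, h4] at h2
    have h5 := IsPullback.of_right h2.flip (by
      rw [← cancel_mono hU.fromSpec, Category.assoc, Category.assoc, h1.w, h2.w,
        Category.assoc]) h1.flip
    exact (IsPullback.of_map_of_faithful Scheme.Spec h5).unop.flip
  have hloc (U : Y.Opens) (hU : IsAffineOpen U) [Nonempty U] :
      letI := (pullSections j (W.hom ⁻¹ᵁ U) (le_preimage_of_comp_eq hj U)).toAlgebra
      IsLocalization ((nonZeroDivisors Γ(Y, U)).map (W.hom.app U).hom) A := by
    let := (pullSections j (W.hom ⁻¹ᵁ U) (le_preimage_of_comp_eq hj U)).toAlgebra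
    let := (W.hom.app U).hom.toAlgebra
    let : Algebra Γ(Y, U) A := (a.comp (Y.germToFunctionField U).hom).toAlgebra
    have : IsScalarTower Γ(Y, U) K A := .of_algebraMap_eq fun _ => rfl
    have : IsScalarTower Γ(Y, U) Γ(W.left, W.hom ⁻¹ᵁ U) A :=
      .of_algebraMap_eq fun g => (pullSections_app hj hU g).symm
    have := functionField_isFractionRing_of_isAffineOpen Y U hU
    have h1 : Algebra.IsPushout Γ(Y, U) Γ(W.left, W.hom ⁻¹ᵁ U) K A :=
      CommRingCat.isPushout_iff_isPushout.mp (hpo U hU)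
    exact (Algebra.isLocalization_iff_isPushout (A := K) (nonZeroDivisors Γ(Y, U))).mpr h1
  refine ⟨A, inferInstance, inferInstance, j, inferInstance, hj, fun U hU _ => ?_, fun U hU _ x =>
    ?_⟩
  · let := (pullSections j (W.hom ⁻¹ᵁ U) (le_preimage_of_comp_eq hj U)).toAlgebra
    have := hloc U hU
    let := (W.hom.app U).hom.toAlgebra
    have hflat : Module.Flat Γ(Y, U) Γ(W.left, W.hom ⁻¹ᵁ U) := by
      have := W.hom.flat_appLE hU (hU.preimage W.hom) le_rfl
      rw [← Scheme.Hom.app_eq_appLE] at this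
      exact this
    refine IsLocalization.injective A (M := (nonZeroDivisors Γ(Y, U)).map (W.hom.app U).hom) ?_
    rintro _ ⟨g, hg, rfl⟩
    have := Module.Flat.isSMulRegular_of_nonZeroDivisors (M := Γ(W.left, W.hom ⁻¹ᵁ U)) hg
    refine mem_nonZeroDivisors_iff_right.mpr fun x hx => this ?_
    simp only [Algebra.smul_def, mul_zero]
    rw [mul_comm]
    exact hx
  · let := (pullSections j (W.hom ⁻¹ᵁ U) (le_preimage_of_comp_eq hj U)).toAlgebra
    have := hloc U hU
    obtain ⟨⟨b, ⟨_, g, hg, rfl⟩⟩, hb⟩ :=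
      IsLocalization.surj ((nonZeroDivisors Γ(Y, U)).map (W.hom.app U).hom) x
    refine ⟨g, nonZeroDivisors.ne_zero hg, b, ?_⟩
    rw [mul_comm, ← pullSections_app hj hU g]
    exact hb.symm

end GenericFibre

theorem of_forall_app (P : MorphismProperty Scheme.{u})
    {Q : ∀ {R S : Type u} [CommRing R] [CommRing S], (R →+* S) → Prop} [HasRingHomProperty P Q]
    {X Y : Scheme.{u}} (f : X ⟶ Y) [IsAffineHom f]
    (H : ∀ x, ∃ V, IsAffineOpen V ∧ x ∈ V ∧ Q (f.app V).hom) : P f := by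
  refine IsZariskiLocalAtTarget.of_forall_exists_morphismRestrict fun x => ?_
  obtain ⟨V, hV, hxV, hf⟩ := H x
  exact ⟨V, hxV, (app_iff_morphismRestrict P f hV).mpr hf⟩

section
variable {k : Type u} [Field k] {C : SmoothProjectiveCurve k}

/-- Sections embed in the `K`-vector space `A`, so they are torsion-free, hence flat over the
Dedekind domain `Γ(V)`. -/
theorem IsModel.flat {W : Over C.scheme} {A : Type u} [CommRing A]
    [Algebra C.scheme.functionField A]
    {j : Spec (.of A) ⟶ W.left} (h : IsModel W j) : Flat W.hom := by
  have := h.isAffineHom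
  refine of_forall_app @Flat.{u} _ fun x => ?_
  obtain ⟨V, hV, hxV⟩ := exists_affineOpen_mem x
  have : Nonempty V := ⟨⟨_, hxV⟩⟩
  refine ⟨V, hV, hxV, ?_⟩
  let := (W.hom.app V).hom.toAlgebra
  let : Algebra Γ(C.scheme, V) A :=
    ((algebraMap C.scheme.functionField A).comp (C.scheme.germToFunctionField V).hom).toAlgebra
  have : IsScalarTower Γ(C.scheme, V) C.scheme.functionField A := .of_algebraMap_eq fun _ => rfl
  have := isDedekindDomain C.str hV
  have : Module.IsTorsionFree Γ(C.scheme, V) Γ(W.left, W.hom ⁻¹ᵁ V) := by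
    have := functionField_isFractionRing_of_isAffineOpen C.scheme V hV
    have : FaithfulSMul Γ(C.scheme, V) C.scheme.functionField :=
      (faithfulSMul_iff_algebraMap_injective _ _).mpr (IsFractionRing.injective _ _)
    have : Module.IsTorsionFree Γ(C.scheme, V) A :=
      .trans_faithfulSMul Γ(C.scheme, V) C.scheme.functionField _
    exact (h.injective V hV).moduleIsTorsionFree _ fun r b => by
      rw [Algebra.smul_def, map_mul, Algebra.smul_def]
      exact congrArg (· * _) (pullSections_app h.comp_hom hV r)
  change Module.Flat Γ(C.scheme, V) Γ(W.left, W.hom ⁻¹ᵁ V)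
  infer_instance

variable {m : ℕ} [NeZero m] {S : Finset (PrimeDivisor C.scheme)} {ι : Type u} [Finite ι]
  (d : ι → KummerDatum m S)

/-- Flatness and integrality pass to fibre products, so the product has a generic fibre `T`. Maps `T
→ R` are points of the product over the generic map, hence families of points of the factors, hence
families of roots of the `f i` in `R`. -/
theorem exists_isModel_fibreProduct :
    ∃ (T : Type u) (_ : CommRing T) (_ : Algebra C.scheme.functionField T)
      (j : Spec (.of T) ⟶ (fibreProduct fun i => (d i).cover).left) (z : ι → T)
      (φ : ∀ i, (d i).Alg →ₐ[C.scheme.functionField] T),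
      IsModel (fibreProduct fun i => (d i).cover) j ∧
      IsKummerAlgebra m (fun i => (d i).f) z ∧
      ∀ i, φ i (AdjoinRoot.root _) = z i ∧
        j ≫ (Pi.π (fun i => (d i).cover) i).left =
          Spec.map (CommRingCat.ofHom (φ i).toRingHom) ≫ (d i).genericFibre := by
  have hM (i) := (d i).isModel_genericFibre
  have : IsIntegralHom (fibreProduct fun i => (d i).cover).hom :=
    fibreProduct_hom @IsIntegralHom.{u} fun i => (hM i).isIntegralHom
  have : Flat (fibreProduct fun i => (d i).cover).hom :=
    fibreProduct_hom @Flat.{u} fun i => (hM i).flat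
  obtain ⟨T, _, _, j, hj⟩ := exists_isModel (fibreProduct fun i => (d i).cover)
  choose φ hφ using fun i => ((hM i).existsUnique_algHom (R := T)
    (w := j ≫ (Pi.π (fun i => (d i).cover) i).left) (by
      rw [Category.assoc, Over.w, hj.comp_hom])).exists
  have hcomp {R : Type u} [CommRing R] [Algebra C.scheme.functionField R]
      (ψ : T →ₐ[C.scheme.functionField] R) (i : ι) :
      (Spec.map (CommRingCat.ofHom ψ.toRingHom) ≫ j) ≫ (Pi.π (fun i => (d i).cover) i).left =
        Spec.map (CommRingCat.ofHom (ψ.comp (φ i)).toRingHom) ≫ (d i).genericFibre := by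
    rw [Category.assoc, ← hφ, ← Category.assoc, ← Spec.map_comp]
    rfl
  have hpt {R : Type u} [CommRing R] [Algebra C.scheme.functionField R] (i : ι)
      (ψ : (d i).Alg →ₐ[C.scheme.functionField] R) :
      (Spec.map (CommRingCat.ofHom ψ.toRingHom) ≫ (d i).genericFibre) ≫ (d i).cover.hom =
        genericMap C.scheme R := by
    rw [Category.assoc, (hM i).comp_hom, map_genericMap]
  refine ⟨T, inferInstance, inferInstance, j, fun i => φ i (AdjoinRoot.root _), φ, hj,
    ⟨fun i => (d i).map_root_pow (φ i), fun R _ _ r hr => ?_⟩, fun i => ⟨rfl, (hφ i).symm⟩⟩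
  let ψ (i) := (d i).liftRoot (r i) (hr i)
  let w : Over.mk (genericMap C.scheme R) ⟶ fibreProduct fun i => (d i).cover :=
    Pi.lift fun i => Over.homMk (Spec.map (CommRingCat.ofHom (ψ i).toRingHom) ≫ (d i).genericFibre)
      (hpt i (ψ i))
  have hwi (i) : w.left ≫ (Pi.π (fun i => (d i).cover) i).left =
      Spec.map (CommRingCat.ofHom (ψ i).toRingHom) ≫ (d i).genericFibre := by
    rw [← Over.comp_left, Pi.lift_π]
    rfl
  have hw : w.left ≫ (fibreProduct fun i => (d i).cover).hom = genericMap C.scheme R := Over.w w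
  have hiff (χ : T →ₐ[C.scheme.functionField] R) :
      Spec.map (CommRingCat.ofHom χ.toRingHom) ≫ j = w.left ↔
        ∀ i, χ (φ i (AdjoinRoot.root _)) = r i := by
    have h1 (i) : χ (φ i (AdjoinRoot.root _)) = r i ↔ χ.comp (φ i) = ψ i := by
      constructor
      · exact fun h => AdjoinRoot.algHom_ext (h.trans ((d i).liftRoot_root (r i) (hr i)).symm)
      · exact fun h => (DFunLike.congr_fun h _).trans ((d i).liftRoot_root (r i) (hr i))
    simp only [h1]
    constructor
    · intro h i
      have h2 := hcomp χ i
      rw [h, hwi] at h2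
      exact ((hM i).existsUnique_algHom (hpt i _)).unique h2.symm rfl
    · intro h
      have h3 : (Spec.map (CommRingCat.ofHom χ.toRingHom) ≫ j) ≫
          (fibreProduct fun i => (d i).cover).hom = genericMap C.scheme R := by
        rw [Category.assoc, hj.comp_hom, map_genericMap]
      refine congrArg (fun f => f.left) (show Over.homMk _ h3 = w from ?_)
      refine Pi.hom_ext _ _ fun i => Over.OverMorphism.ext ?_
      rw [Over.comp_left, Over.comp_left, hwi, ← h]
      exact hcomp χ i
  obtain ⟨χ, hχ, huniq⟩ := hj.existsUnique_algHom hw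
  exact ⟨χ, (hiff χ).mp hχ, fun χ' hχ' => huniq χ' ((hiff χ').mpr hχ')⟩

end

section
variable {k : Type u} [Field k] [IsAlgClosed k] {C : SmoothProjectiveCurve k}
  {m : ℕ} [NeZero m] {S : Finset (PrimeDivisor C.scheme)}

theorem isTypeT1_iff_independentModPowers {B : Finset (GenPic m S)} (hB : ∀ b ∈ B, addOrderOf b = m)
    {d : B → KummerDatum m S} (hd : ∀ b, (d b).toGenPic = b) :
    IsTypeT1 (B : Set (GenPic m S)) ↔ IndependentModPowers m fun b => (d b).f := by
  refine (isTypeT1_iff (A := GenPic m S) hB).trans (forall_congr' fun a => ?_)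
  rw [← KummerDatum.sum_toGenPic_eq_zero_iff]
  simp only [hd]

/-- Type T1 is independence of the `f b` modulo `m`-th powers, that is, the generic fibre of the
product is a domain; by flatness this is integrality of the whole product. -/
theorem isTypeT1_iff_mutuallyLinearlyDisjoint {μ : k} (hμ : IsPrimitiveRoot μ m) (hmk : (m : k) ≠ 0)
    {B : Finset (GenPic m S)} (hB : ∀ b ∈ B, addOrderOf b = m)
    {d : B → KummerDatum m S} (hd : ∀ b, (d b).toGenPic = b) :
    IsTypeT1 (B : Set (GenPic m S)) ↔ MutuallyLinearlyDisjoint fun b => (d b).cover := by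
  rw [isTypeT1_iff_independentModPowers hB hd]
  obtain ⟨T, _, _, j, z, φ, hj, hT, -⟩ := exists_isModel_fibreProduct d
  constructor
  · intro h
    have := hT.isDomain (KummerDatum.isPrimitiveRoot_const hμ) (KummerDatum.natCast_ne_zero hmk) h
      fun b => (d b).f_ne_zero
    exact hj.isIntegral
  · intro (h : AlgebraicGeometry.IsIntegral (fibreProduct fun b => (d b).cover).left)
    have := hj.isDomain
    exact hT.independent (KummerDatum.isPrimitiveRoot_const hμ) fun b => (d b).f_ne_zero

end

/-! ### Normalization of the fibre product -/

section
variable {Y : Scheme.{u}} [AlgebraicGeometry.IsIntegral Y] {P : Over Y}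

theorem IsModel.of_algEquiv {A A' : Type u} [CommRing A] [CommRing A'] [Algebra Y.functionField A]
    [Algebra Y.functionField A'] {j : Spec (.of A) ⟶ P.left} (h : IsModel P j)
    (θ : A ≃ₐ[Y.functionField] A') {j' : Spec (.of A') ⟶ P.left}
    (hj' : Spec.map (CommRingCat.ofHom θ.toAlgHom.toRingHom) ≫ j = j') : IsModel P j' := by
  have hc : j' ≫ P.hom = genericMap Y A' := by
    rw [← hj', Category.assoc, h.comp_hom, map_genericMap]
  have hp (U : Y.Opens) [Nonempty U] :
      pullSections j' (P.hom ⁻¹ᵁ U) (le_preimage_of_comp_eq hc U) = θ.toAlgHom.toRingHom.comp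
        (pullSections j (P.hom ⁻¹ᵁ U) (le_preimage_of_comp_eq h.comp_hom U)) := by
    subst hj'
    exact pullSections_map_comp _ _ _ _ _
  refine ⟨h.isIntegralHom, hc, fun U hU _ => ?_, fun U hU _ a => ?_⟩
  · rw [hp]
    exact θ.injective.comp (h.injective U hU)
  · obtain ⟨g, hg, b, hb⟩ := h.exists_mul U hU (θ.symm a)
    refine ⟨g, hg, b, ?_⟩
    rw [hp]
    refine (congrArg θ hb).trans ?_
    rw [map_mul, θ.commutes, θ.apply_symm_apply]

/-- Normalizing a model in its own generic fibre yields a normal model: an element integral over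
`Γ(Y, U)` is integral over the sections of `P`. -/
theorem IsModel.isNormalModel_normalization {A : Type u} [CommRing A] [Algebra Y.functionField A]
    {f : Spec (.of A) ⟶ P.left} [QuasiCompact f] [QuasiSeparated f] (h : IsModel P f) :
    IsNormalModel (Over.mk (f.fromNormalization ≫ P.hom)) f.toNormalization := by
  have := h.isIntegralHom
  let N := Over.mk (f.fromNormalization ≫ P.hom)
  have hc : f.toNormalization ≫ N.hom = genericMap Y A := by
    change f.toNormalization ≫ f.fromNormalization ≫ P.hom = _
    rw [Scheme.Hom.toNormalization_fromNormalization_assoc, h.comp_hom]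
  have hint : IsIntegralHom N.hom := by dsimp [N]; infer_instance
  have hcomp (U : Y.Opens) [Nonempty U] :
      (pullSections f.toNormalization (N.hom ⁻¹ᵁ U) (le_preimage_of_comp_eq hc U)).comp
        (f.fromNormalization.app (P.hom ⁻¹ᵁ U)).hom =
      pullSections f (P.hom ⁻¹ᵁ U) (le_preimage_of_comp_eq h.comp_hom U) := by
    have hle : ⊤ ≤ (f.toNormalization ≫ f.fromNormalization) ⁻¹ᵁ (P.hom ⁻¹ᵁ U) := by
      rw [Scheme.Hom.toNormalization_fromNormalization]
      exact le_preimage_of_comp_eq h.comp_hom U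
    refine (pullSections_comp f.toNormalization f.fromNormalization (P.hom ⁻¹ᵁ U) hle).symm.trans ?_
    congr 1
    exact f.toNormalization_fromNormalization
  refine ⟨⟨hint, hc, fun U hU _ => ?_, fun U hU _ a => ?_⟩, fun U hU _ a ha => ?_⟩
  · refine pullSections_injective _ _ _ ?_
    have h2 := congrArg (fun I => Scheme.IdealSheafData.ideal I ⟨N.hom ⁻¹ᵁ U, hU.preimage N.hom⟩)
      f.ker_toNormalization
    simp only [Scheme.Hom.ker_apply] at h2
    exact (RingHom.injective_iff_ker_eq_bot _).mpr h2
  · obtain ⟨g, hg, b, hb⟩ := h.exists_mul U hU a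
    exact ⟨g, hg, f.fromNormalization.app _ b, (congrArg (fun t => t b) (hcomp U)).trans hb⟩
  · set V := P.hom ⁻¹ᵁ U with hVdef
    have hV : IsAffineOpen V := h.isAffineOpen hU
    have hle : ⊤ ≤ f ⁻¹ᵁ V := le_preimage_of_comp_eq h.comp_hom U
    have hiso : IsIso (homOfLE hle) :=
      ⟨⟨homOfLE le_top, Subsingleton.elim _ _, Subsingleton.elim _ _⟩⟩
    let β := (Spec (.of A)).presheaf.map (homOfLE hle).op ≫ (Scheme.ΓSpecIso (.of A)).hom
    have hβ : Function.Bijective β := ConcreteCategory.bijective_of_isIso β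
    obtain ⟨x, rfl⟩ := hβ.2 a
    let := (f.app V).hom.toAlgebra
    -- The equation over `Γ(Y, U)` is pushed to the sections of `P`; `β` only identifies the global
    -- sections of `Spec A` with `A`.
    have hx : _root_.IsIntegral Γ(P.left, V) x := by
      obtain ⟨p, hp, hpx⟩ := ha
      refine ⟨p.map (P.hom.app U).hom, hp.map _, hβ.1 ?_⟩
      rw [Polynomial.eval₂_map, map_zero, ← hpx]
      refine (Polynomial.hom_eval₂ p _ β.hom x).trans ?_
      congr 1
      ext g
      exact pullSections_app h.comp_hom hU g
    refine ⟨(f.normalizationObjIso hV).inv ⟨x, hx⟩, ?_⟩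
    have h1 : CommRingCat.ofHom
        (pullSections f.toNormalization (N.hom ⁻¹ᵁ U) (le_preimage_of_comp_eq hc U)) =
        (f.normalizationObjIso hV).hom ≫
          CommRingCat.ofHom (Subalgebra.val (integralClosure _ _)).toRingHom ≫ β := by
      refine (ofHom_pullSections _ _ _).trans (Eq.trans ?_
        ((congrArg (· ≫ β) (f.normalizationObjIso_hom_val hV)).symm.trans (Category.assoc _ _ _)))
      exact (Scheme.Hom.appLE_map_assoc _ _ _ _).symm
    have h2 := congrArg (fun t => t.hom ((f.normalizationObjIso hV).inv ⟨x, hx⟩)) h1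
    refine h2.trans ?_
    have h3 := congrArg (fun t => t.hom ⟨x, hx⟩) (f.normalizationObjIso hV).inv_hom_id
    exact congrArg (fun t => β t.1) h3

theorem genericMap_apply {A : Type u} [CommRing A] [Algebra Y.functionField A] (t : Spec (.of A)) :
    genericMap Y A t = genericPoint Y := by
  have h : Spec.map (CommRingCat.ofHom (algebraMap Y.functionField A)) t =
      IsLocalRing.closedPoint Y.functionField := Subsingleton.elim (α := PrimeSpectrum _) _ _
  exact (congrArg (Y.fromSpecStalk (genericPoint Y)) h).trans Scheme.fromSpecStalk_closedPoint

theorem injective_of_isDomain {K A R : Type*} [Field K] [CommRing A] [IsDomain A] [Algebra K A]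
    [Algebra.IsIntegral K A] [CommRing R] [Nontrivial R] (f : A →+* R) : Function.Injective f := by
  let := (isField_of_isIntegral_of_isField' (Field.toIsField K) : IsField A).toField
  exact f.injective

/-- A domain integral over `K` is a field, so it maps injectively to `F`. Every element of `F` is a
fraction of sections, and the denominators are already invertible in `A`. The `K`-structure on `F`
is part of the conclusion. -/
theorem IsModel.exists_algEquiv_of_field {A : Type u} [CommRing A] [IsDomain A]
    [Algebra Y.functionField A] [Algebra.IsIntegral Y.functionField A] {j : Spec (.of A) ⟶ P.left}
    (h : IsModel P j) [AlgebraicGeometry.IsIntegral P.left] {F : Type u} [Field F]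
    {f : Spec (.of F) ⟶ P.left} (hf : ∀ t, f t = genericPoint P.left)
    (hfrac : ∀ (V : P.left.Opens) (_ : IsAffineOpen V) (hV : ⊤ ≤ f ⁻¹ᵁ V) (x : F),
      ∃ a b, pullSections f V hV b ≠ 0 ∧ pullSections f V hV b * x = pullSections f V hV a) :
    ∃ (_ : Algebra Y.functionField F) (θ : A ≃ₐ[Y.functionField] F),
      Spec.map (CommRingCat.ofHom θ.toAlgHom.toRingHom) ≫ j = f := by
  obtain ⟨t⟩ : Nonempty (Spec (.of A)) := inferInstanceAs (Nonempty (PrimeSpectrum A))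
  -- The generic point of `P` specializes to a point of the generic fibre, so its image both
  -- generizes and specializes from the generic point of `Y`.
  have hη : P.hom (genericPoint P.left) = genericPoint Y := by
    refine Inseparable.eq (Specializes.antisymm ?_
      (genericPoint_specializes (P.hom (genericPoint P.left))))
    have h1 := (genericPoint_specializes (j t)).map P.hom.continuous
    rwa [← Scheme.Hom.comp_apply, h.comp_hom, genericMap_apply] at h1
  obtain ⟨_, hK⟩ := exists_genericMap_eq (f ≫ P.hom) fun t => by
    rw [Scheme.Hom.comp_apply, hf, hη]
  obtain ⟨θ, rfl, -⟩ := h.existsUnique_algHom hK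
  refine ⟨inferInstance, AlgEquiv.ofBijective θ
    ⟨injective_of_isDomain (K := Y.functionField) θ.toRingHom, fun x => ?_⟩, rfl⟩
  obtain ⟨U, hU, hηU⟩ := exists_affineOpen_mem (genericPoint Y)
  have : Nonempty U := ⟨⟨_, hηU⟩⟩
  obtain ⟨a, b, hb, hx⟩ := hfrac _ (h.isAffineOpen hU) (le_preimage_of_comp_eq hK U) x
  rw [pullSections_map_comp j (P.hom ⁻¹ᵁ U) (le_preimage_of_comp_eq h.comp_hom U)] at hb hx
  change θ _ ≠ 0 at hb
  change θ _ * x = θ _ at hx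
  obtain ⟨c, hc⟩ := (isField_of_isIntegral_of_isField' (Field.toIsField Y.functionField) :
    IsField A).mul_inv_cancel (a := h.incl U b) fun h0 => hb (by
      rw [← map_zero θ, ← h0])
  refine ⟨h.incl U a * c, mul_left_cancel₀ hb ?_⟩
  rw [hx, map_mul, mul_left_comm, ← map_mul θ _ c, hc, map_one, mul_one]

theorem IsModel.exists_isNormalModel_normalizationMap {A : Type u} [CommRing A] [IsDomain A]
    [Algebra Y.functionField A] [Algebra.IsIntegral Y.functionField A] {j : Spec (.of A) ⟶ P.left}
    (h : IsModel P j) [AlgebraicGeometry.IsIntegral P.left] :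
    ∃ (F : Type u) (_ : Field F) (_ : Algebra Y.functionField F) (θ : A ≃ₐ[Y.functionField] F)
      (j' : Spec (.of F) ⟶ (P.left.fromSpecStalk (genericPoint P.left)).normalization),
      IsNormalModel (Over.mk (normalizationMap P.left ≫ P.hom)) j' ∧
        j' ≫ normalizationMap P.left =
          Spec.map (CommRingCat.ofHom θ.toAlgHom.toRingHom) ≫ j := by
  obtain ⟨hA, θ, hθ⟩ := h.exists_algEquiv_of_field (F := P.left.functionField)
    (f := P.left.fromSpecStalk (genericPoint P.left))
    (fun t => by
      have ht : t = IsLocalRing.closedPoint P.left.functionField :=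
        Subsingleton.elim (α := PrimeSpectrum _) _ _
      subst ht
      exact Scheme.fromSpecStalk_closedPoint) (fun V hV hle x => by
      have hV' : Nonempty V := ⟨⟨genericPoint P.left, by
        have := hle (show IsLocalRing.closedPoint P.left.functionField ∈ ⊤ from trivial)
        change P.left.fromSpecStalk _ _ ∈ V at this
        rwa [Scheme.fromSpecStalk_closedPoint] at this⟩⟩
      have h1 : genericMap P.left P.left.functionField =
          P.left.fromSpecStalk (genericPoint P.left) :=
        (congrArg (· ≫ _) (Spec.map_id _)).trans (Category.id_comp _)
      have h2 : pullSections (P.left.fromSpecStalk (genericPoint P.left)) V hle =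
          (P.left.germToFunctionField V).hom := by
        refine Eq.trans ?_ (pullSections_genericMap (R := P.left.functionField) hV)
        congr 1
        exact h1.symm
      have := functionField_isFractionRing_of_isAffineOpen P.left V hV
      obtain ⟨a, b, hb, rfl⟩ := IsFractionRing.div_surjective (A := Γ(P.left, V)) x
      have hb0 : P.left.germToFunctionField V b ≠ 0 :=
        (map_ne_zero_iff _ (Scheme.germToFunctionField_injective P.left V)).mpr
          (nonZeroDivisors.ne_zero hb)
      refine ⟨a, b, ?_, ?_⟩
      · exact fun h => hb0 ((congrArg (fun t => t b) h2).symm.trans h)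
      · refine (congrArg (fun t => t b * _) h2).trans (Eq.trans ?_ (congrArg (fun t =>
          t a) h2).symm)
        exact mul_div_cancel₀ _ hb0)
  have : QuasiCompact (P.left.fromSpecStalk (genericPoint P.left)) := inferInstance
  have : QuasiSeparated (P.left.fromSpecStalk (genericPoint P.left)) := inferInstance
  exact ⟨P.left.functionField, inferInstance, hA, θ,
    (P.left.fromSpecStalk (genericPoint P.left)).toNormalization,
    (h.of_algEquiv θ hθ).isNormalModel_normalization,
    (Scheme.Hom.toNormalization_fromNormalization _).trans hθ.symm⟩

end

/-! ### Radicals and roots of unity acting on a Kummer algebra -/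

namespace IsKummerAlgebra
variable {K : Type u} [Field K] {ι : Type u} {T : Type u} [CommRing T] [Algebra K T]
  {m : ℕ} {f : ι → K} {z : ι → T} (h : IsKummerAlgebra m f z)
include h

theorem isUnit [NeZero m] {i : ι} (hf : f i ≠ 0) : IsUnit (z i) :=
  isUnit_of_mul_isUnit_left (y := z i ^ (m - 1)) (by
    rw [← pow_succ', Nat.sub_add_cancel (NeZero.one_le), h.pow_eq]
    exact hf.isUnit.map _)

/-- The root is `g ∏ z_i ^ a_i`, where the `z_i` are units because the `f i` do not vanish. -/
theorem exists_pow_eq [NeZero m] [Fintype ι] (hf : ∀ i, f i ≠ 0) (a : ι → ℤ) (g : K) :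
    ∃ w : T, w ^ m = algebraMap K T (g ^ m * ∏ i, f i ^ a i) := by
  let u (i) : Tˣ := (h.isUnit (hf i)).unit
  have hu (i) : u i ^ m = Units.map (algebraMap K T).toMonoidHom (Units.mk0 (f i) (hf i)) :=
    Units.ext (h.pow_eq i)
  refine ⟨algebraMap K T g * (∏ i, u i ^ a i : Tˣ), ?_⟩
  rw [mul_pow, map_mul, map_pow]
  congr 1
  rw [← Units.val_pow_eq_pow_val, ← Finset.prod_pow]
  have h1 : ∏ i, (u i ^ a i) ^ m =
      Units.map (algebraMap K T).toMonoidHom (∏ i, (Units.mk0 (f i) (hf i)) ^ a i) := by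
    rw [map_prod]
    refine Finset.prod_congr rfl fun i _ => ?_
    rw [map_zpow, ← hu, ← zpow_natCast, ← zpow_natCast, zpow_comm]
  rw [h1]
  change algebraMap K T _ = _
  congr 1
  simp [Units.coe_prod]

/-- The roots of unity act on a Kummer algebra. -/
theorem exists_rootsOfUnity_action :
    ∃ Φ : (ι → rootsOfUnity m K) →* (T ≃ₐ[K] T),
      ∀ s i, Φ s (z i) = (((s i : rootsOfUnity m K) : Kˣ) : K) • z i := by
  choose φ hφ using fun s : ι → rootsOfUnity m K =>
    (h.existsUnique_smul (fun i => (((s i : rootsOfUnity m K) : Kˣ) : K)) fun i => by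
      rw [← Units.val_pow_eq_pow_val, (mem_rootsOfUnity m _).mp (s i).2, Units.val_one]).exists
  have hmul (s t) : (φ s).comp (φ t) = φ (s * t) := h.algHom_ext fun i => by
    rw [AlgHom.comp_apply, hφ, map_smul, hφ, hφ, smul_smul, mul_comm]
    rfl
  have hone : φ 1 = AlgHom.id K T := h.algHom_ext fun i => by
    rw [hφ]
    exact one_smul _ _
  refine ⟨{ toFun := fun s => AlgEquiv.ofAlgHom (φ s) (φ s⁻¹) ?_ ?_, map_one' := ?_, map_mul' :=
    ?_ },
    fun s i => hφ s i⟩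
  · rw [hmul, mul_inv_cancel, hone]
  · rw [hmul, inv_mul_cancel, hone]
  · ext x; exact DFunLike.congr_fun hone x
  · intro s t; ext x; exact (DFunLike.congr_fun (hmul s t) x).symm

end IsKummerAlgebra

section Coordinates
variable {A : Type*} [AddCommGroup A]

/-- The coordinates modulo `m` with respect to a set of type T1 of elements of order `m`. -/
theorem exists_coordinates {B : Finset A} {m : ℕ} (hB : ∀ b ∈ B, addOrderOf b = m)
    (hT : IsTypeT1 (B : Set A)) :
    ∃ κ : B → AddSubgroup.closure (B : Set A) →+ ZMod m, ∀ b : B,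
      κ b ⟨b, AddSubgroup.subset_closure b.2⟩ = 1 ∧
        ∀ c : B, c ≠ b → κ c ⟨b, AddSubgroup.subset_closure b.2⟩ = 0 := by
  classical
  rw [isTypeT1_iff hB] at hT
  choose a _ ha using fun x : AddSubgroup.closure (B : Set A) =>
    exists_sum_of_mem_closure (subset_refl (B : Set A)) x.2
  -- Type T1 makes the coefficients of any two expressions of `x` congruent modulo `m`; this gives
  -- additivity and the values on `B`.
  have key (x : AddSubgroup.closure (B : Set A)) (a' : B → ℤ) (h : ∑ b, a' b • b.1 = x.1) (b : B) :
      (a x b : ZMod m) = a' b := by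
    have := hT (a x - a') (by
      simp only [Pi.sub_apply, sub_smul, Finset.sum_sub_distrib, ha, h, sub_self]) b
    rw [← sub_eq_zero, ← Int.cast_sub]
    exact (ZMod.intCast_zmod_eq_zero_iff_dvd _ _).mpr this
  have hs (b c : B) : (a ⟨b, AddSubgroup.subset_closure b.2⟩ c : ZMod m) =
      (Pi.single b 1 : B → ℤ) c := key _ _ (by
    rw [Fintype.sum_eq_single b]
    · simp
    · intro c hc
      rw [Pi.single_apply, if_neg hc, zero_smul]) c
  refine ⟨fun b => AddMonoidHom.mk' (fun x => (a x b : ZMod m)) fun x y => ?_,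
    fun b => ⟨(hs b b).trans (by simp), fun c hc => (hs b c).trans (by simp [hc])⟩⟩
  rw [key (x + y) (a x + a y) (by
    simp only [Pi.add_apply, add_smul, Finset.sum_add_distrib, ha]; rfl) b]
  push_cast [Pi.add_apply]
  rfl

end Coordinates

section
variable {k : Type u} [Field k] {C : SmoothProjectiveCurve k}
  {m : ℕ} [NeZero m] {S : Finset (PrimeDivisor C.scheme)}

/-- The generic fibre of an integral product is a finite domain over `K`, hence equal to the
function field used for the normalization, so the Kummer presentation carries over. -/
theorem exists_isNormalModel_normalizedFibreProduct {ι : Type u} [Finite ι]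
    (d : ι → KummerDatum m S)
    [AlgebraicGeometry.IsIntegral (fibreProduct fun i => (d i).cover).left] :
    ∃ (F : Type u) (_ : Field F) (_ : Algebra C.scheme.functionField F)
      (j : Spec (.of F) ⟶ (normalizedFibreProduct fun i => (d i).cover).left) (z : ι → F)
      (φ : ∀ i, (d i).Alg →ₐ[C.scheme.functionField] F),
      IsNormalModel (normalizedFibreProduct fun i => (d i).cover) j ∧
      IsKummerAlgebra m (fun i => (d i).f) z ∧
      ∀ i, φ i (AdjoinRoot.root _) = z i ∧
        j ≫ (normalizedProj (fun i => (d i).cover) i).left =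
          Spec.map (CommRingCat.ofHom (φ i).toRingHom) ≫ (d i).genericFibre := by
  have := Fintype.ofFinite ι
  obtain ⟨T, _, _, j, z, φ, hj, hT, hz⟩ := exists_isModel_fibreProduct d
  have := hj.isDomain
  have := hT.moduleFinite
  obtain ⟨F, _, _, θ, j', hj', hθ⟩ := hj.exists_isNormalModel_normalizationMap
  refine ⟨F, inferInstance, inferInstance, j', fun i => θ (z i), fun i => θ.toAlgHom.comp (φ i),
    hj', ⟨fun i => ?_, fun R _ _ r hr => ?_⟩, fun i => ⟨?_, ?_⟩⟩
  · rw [← map_pow, hT.pow_eq, θ.commutes]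
  · obtain ⟨χ, hχ, huniq⟩ := hT.existsUnique_algHom R r hr
    refine ⟨χ.comp θ.symm.toAlgHom, fun i => ?_, fun χ' hχ' => ?_⟩
    · refine Eq.trans ?_ (hχ i)
      exact congrArg χ (θ.symm_apply_apply _)
    · have := huniq (χ'.comp θ.toAlgHom) hχ'
      rw [← this]
      ext x
      exact congrArg χ' (θ.apply_symm_apply x).symm
  · exact congrArg θ (hz i).1
  · change j' ≫ normalizationMap _ ≫ _ = _
    rw [← Category.assoc, hθ, Category.assoc, (hz i).2, ← Category.assoc, ← Spec.map_comp]
    rfl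

end

namespace IsModel

theorem algHom_eq {Y : Scheme.{u}} [AlgebraicGeometry.IsIntegral Y] {W : Over Y} {A R : Type u}
    [CommRing A] [CommRing R] [Algebra Y.functionField A] [Algebra Y.functionField R]
    {j : Spec (.of A) ⟶ W.left} (h : IsModel W j) {φ ψ : A →ₐ[Y.functionField] R}
    (e : Spec.map (CommRingCat.ofHom φ.toRingHom) ≫ j = Spec.map
      (CommRingCat.ofHom ψ.toRingHom) ≫ j) :
    φ = ψ :=
  (h.existsUnique_algHom (by rw [Category.assoc, h.comp_hom, map_genericMap])).unique e rfl

end IsModel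

/-! ### Domination of components -/

namespace KummerDatum
variable {k : Type u} [Field k] {C : SmoothProjectiveCurve k} {m : ℕ} [NeZero m]
  {S : Finset (PrimeDivisor C.scheme)} (e : KummerDatum m S)

/-- Every point of the generic fibre is the kernel of a homomorphism to a given field that contains
a root. -/
theorem exists_algHom_ker_eq {F : Type u} [Field F] [Algebra C.scheme.functionField F]
    [Algebra.IsAlgebraic C.scheme.functionField F] {μ : k} (hμ : IsPrimitiveRoot μ m)
    {w : F} (hw : w ^ m = algebraMap _ F e.f) (P : PrimeSpectrum e.Alg) :
    ∃ ψ : e.Alg →ₐ[C.scheme.functionField] F, RingHom.ker ψ = P.asIdeal := by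
  let K := C.scheme.functionField
  let Ω := AlgebraicClosure K
  have : Module.Finite K (e.Alg ⧸ P.asIdeal) := inferInstance
  have : Algebra.IsAlgebraic K (e.Alg ⧸ P.asIdeal) := inferInstance
  let l : (e.Alg ⧸ P.asIdeal) →ₐ[K] Ω := IsAlgClosed.lift
  let t : F →ₐ[K] Ω := IsAlgClosed.lift
  -- The root modulo `P` and the given root `w` are compared in an algebraic closure. They differ by
  -- a power of `μ`, so the former comes from `F`, and the evaluation there has kernel `P`.
  let r : Ω := l (Ideal.Quotient.mk _ (AdjoinRoot.root _))
  have hr : r ^ m = algebraMap K Ω e.f := e.map_root_pow (l.comp (Ideal.Quotient.mkₐ K P.asIdeal))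
  have ht : t w ^ m = algebraMap K Ω e.f := by rw [← map_pow, hw, t.commutes]
  have ht0 : t w ≠ 0 := fun h0 => by
    rw [h0, zero_pow (NeZero.ne m), eq_comm, map_eq_zero] at ht
    exact e.f_ne_zero ht
  obtain ⟨i, -, hi⟩ := ((isPrimitiveRoot_const (C := C) hμ).map_of_injective
    (algebraMap K Ω).injective).eq_pow_of_pow_eq_one
      (show (r / t w) ^ m = 1 by rw [div_pow, hr, ht, div_self (ht ▸ pow_ne_zero m ht0)])
  let v : F := algebraMap K F (C.const μ ^ i) * w
  have hv : v ^ m = algebraMap K F e.f := by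
    rw [mul_pow, hw, ← map_pow, ← pow_mul, mul_comm i, pow_mul,
      (isPrimitiveRoot_const (C := C) hμ).pow_eq_one, one_pow, map_one, one_mul]
  have hcomp : t.comp (e.liftRoot v hv) = l.comp (Ideal.Quotient.mkₐ K P.asIdeal) := by
    refine AdjoinRoot.algHom_ext ?_
    rw [AlgHom.comp_apply, liftRoot_root]
    change t v = r
    rw [map_mul, t.commutes, map_pow, hi, div_mul_cancel₀ _ ht0]
  refine ⟨e.liftRoot v hv, ?_⟩
  ext x
  have h1 := DFunLike.congr_fun hcomp x
  rw [RingHom.mem_ker, ← map_eq_zero_iff _ t.injective]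
  have hl : Function.Injective l := injective_of_isDomain (K := K) l.toRingHom
  refine (show _ ↔ l (Ideal.Quotient.mk _ x) = 0 from
    ⟨fun h => h1.symm.trans h, fun h => h1.trans h⟩).trans ?_
  rw [map_eq_zero_iff l hl, Ideal.Quotient.eq_zero_iff_mem]

/-- Every connected component is dominated by any normal curve whose function field has a root. -/
theorem exists_hom_range_eq_connectedComponent {W : Over C.scheme} {F : Type u} [Field F]
    [Algebra C.scheme.functionField F] [Algebra.IsAlgebraic C.scheme.functionField F]
    {j : Spec (.of F) ⟶ W.left} (h : IsNormalModel W j) {μ : k} (hμ : IsPrimitiveRoot μ m)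
    (hmk : (m : k) ≠ 0) {w : F} (hw : w ^ m = algebraMap _ F e.f) (v : e.cover.left) :
    ∃ p : W ⟶ e.cover, Set.range p.left = connectedComponent v := by
  have hN := e.isNormalModel_genericFibre hμ hmk
  have : IsArtinianRing e.Alg := IsArtinianRing.of_finite C.scheme.functionField _
  obtain ⟨P, hP⟩ := hN.exists_specializes v
  obtain ⟨ψ, hψ⟩ := e.exists_algHom_ker_eq hμ hw P
  let p := h.homOfAlgHom hN.toIsModel ψ
  have hp : j ≫ p.left = Spec.map (CommRingCat.ofHom ψ.toRingHom) ≫ e.genericFibre :=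
    h.comp_homOfAlgHom hN.toIsModel ψ
  have hpj (Q : PrimeSpectrum F) : p.left (j Q) = e.genericFibre P := by
    have hQ : PrimeSpectrum.comap ψ.toRingHom Q = P := by
      refine PrimeSpectrum.ext ?_
      rw [← hψ, PrimeSpectrum.comap_asIdeal, Subsingleton.elim Q ⊥]
      rfl
    have h1 := congrArg (fun g : Spec (.of F) ⟶ e.cover.left => g Q) hp
    exact h1.trans (congrArg e.genericFibre hQ)
  refine ⟨p, ?_⟩
  rw [hN.connectedComponent_eq hP]
  -- Integral morphisms are closed, so the image contains the closure of `genericFibre P`, which is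
  -- the whole component.
  have : IsIntegralHom p.left := by
    have h1 := h.isIntegralHom
    have h2 := hN.isIntegralHom
    have : IsIntegralHom (p.left ≫ e.cover.hom) := by rw [Over.w]; exact h1
    exact .of_comp _ e.cover.hom
  refine Set.Subset.antisymm ?_ ?_
  · rintro _ ⟨y, rfl⟩
    obtain ⟨Q, hQ⟩ := h.exists_specializes y
    rw [← hpj Q]
    exact (hQ.map p.left.continuous).mem_closure
  · refine closure_minimal (Set.singleton_subset_iff.mpr ⟨j (⊥ : PrimeSpectrum F), hpj ⊥⟩) ?_
    exact p.left.isClosedMap.isClosed_range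

end KummerDatum

section
variable {k : Type u} [Field k] [IsAlgClosed k] {C : SmoothProjectiveCurve k}
  {m : ℕ} [NeZero m] {S : Finset (PrimeDivisor C.scheme)} {B : Finset (GenPic m S)}
  {d : B → KummerDatum m S} (hd : ∀ b, (d b).toGenPic = b)
  [AlgebraicGeometry.IsIntegral (fibreProduct fun b => (d b).cover).left]
  {μ : k} (hμ : IsPrimitiveRoot μ m) (hmk : (m : k) ≠ 0)
include hd hμ hmk

/-- Writing `z` in terms of `B` shows that `e.f` is `g ^ m ∏ f_b ^ a_b`, which has a root in the
function field of `W`. -/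
theorem exists_hom_normalizedFibreProduct {z : GenPic m S}
    (hz : z ∈ AddSubgroup.closure (B : Set (GenPic m S))) {e : KummerDatum m S} (he : e.toGenPic =
      z)
    (v : e.cover.left) :
    ∃ h : normalizedFibreProduct (fun b => (d b).cover) ⟶ e.cover,
      Set.range h.left = connectedComponent v := by
  obtain ⟨F, _, _, j, r, φ, hj, hF, -⟩ := exists_isNormalModel_normalizedFibreProduct d
  obtain ⟨a, -, ha⟩ := exists_sum_of_mem_closure (A := GenPic m S)
    (subset_refl (B : Set (GenPic m S))) hz
  have h1 : ∑ b, a b • (d b).toGenPic = e.toGenPic := by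
    rw [he, ← ha]
    exact Finset.sum_congr rfl fun b _ => by rw [hd]
  obtain ⟨g, -, hg⟩ := KummerDatum.sum_toGenPic_eq_iff.mp h1
  obtain ⟨w, hw⟩ := hF.exists_pow_eq (fun b => (d b).f_ne_zero) a g
  rw [← hg] at hw
  have := hF.moduleFinite
  exact e.exists_hom_range_eq_connectedComponent hj hμ hmk hw v

end

/-! ### The action of the subgroup generated by `B` -/

section
variable {k : Type u} [Field k] {C : SmoothProjectiveCurve k}
  {m : ℕ} [NeZero m] {S : Finset (PrimeDivisor C.scheme)}

/-- The normalization is no longer a product, but its function field is generated by the roots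
`z_i`, on which an endomorphism is detected by the projections. -/
theorem hom_eq_of_normalizedProj {ι : Type u} [Finite ι] {d : ι → KummerDatum m S}
    [AlgebraicGeometry.IsIntegral (fibreProduct fun i => (d i).cover).left]
    {σ τ : normalizedFibreProduct (fun i => (d i).cover) ⟶
      normalizedFibreProduct (fun i => (d i).cover)}
    (h : ∀ i, σ ≫ normalizedProj (fun i => (d i).cover) i =
      τ ≫ normalizedProj (fun i => (d i).cover) i) : σ = τ := by
  cases nonempty_fintype ι
  obtain ⟨F, _, _, j, r, φ, hj, hF, hφ⟩ := exists_isNormalModel_normalizedFibreProduct d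
  have hM (b) := (d b).isModel_genericFibre
  have key (σ : normalizedFibreProduct (fun i => (d i).cover) ⟶
      normalizedFibreProduct (fun i => (d i).cover)) :
      ∃ s : F →ₐ[C.scheme.functionField] F,
        Spec.map (CommRingCat.ofHom s.toRingHom) ≫ j = j ≫ σ.left :=
    (hj.existsUnique_algHom (by rw [Category.assoc, Over.w, hj.comp_hom])).exists
  obtain ⟨s, hs⟩ := key σ
  obtain ⟨t, ht⟩ := key τ
  have hst : s = t := by
    refine hF.algHom_ext fun i => ?_
    have h1 : s.comp (φ i) = t.comp (φ i) := by
      refine (hM i).algHom_eq ?_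
      have h2 (s : F →ₐ[C.scheme.functionField] F) :
          Spec.map (CommRingCat.ofHom (s.comp (φ i)).toRingHom) ≫ (d i).genericFibre =
            (Spec.map (CommRingCat.ofHom s.toRingHom) ≫ j) ≫
              (normalizedProj (fun i => (d i).cover) i).left := by
        rw [Category.assoc, (hφ i).2, ← Category.assoc, ← Spec.map_comp]
        rfl
      rw [h2, h2, hs, ht, Category.assoc, Category.assoc, ← Over.comp_left, ← Over.comp_left, h i]
    rw [← (hφ i).1]
    exact DFunLike.congr_fun h1 _
  have : IsIntegralHom (normalizedFibreProduct fun i => (d i).cover).hom := hj.isIntegralHom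
  refine hj.hom_ext ?_
  rw [← hs, ← ht, hst]

/-- With `κ` the coordinates modulo `m`, an element `x` multiplies the root `z_b` by `μ ^ κ_b(x)`;
thus `b` itself scales `z_b` by `μ` and fixes the other roots. -/
theorem existsUnique_action {A : Type u} [AddCommGroup A] {B : Finset A} {d : B → KummerDatum m S}
    [AlgebraicGeometry.IsIntegral (fibreProduct fun b => (d b).cover).left]
    {μ : k} (hμ : IsPrimitiveRoot μ m) (hB : ∀ b ∈ B, addOrderOf b = m) (hT : IsTypeT1 (B :
      Set A)) :
    ∃! ρ : Multiplicative (AddSubgroup.closure (B : Set A)) →*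
        Aut (normalizedFibreProduct fun b => (d b).cover),
      ∀ b : B,
        (ρ (.ofAdd ⟨b, AddSubgroup.subset_closure b.2⟩)).hom ≫
            normalizedProj (fun b => (d b).cover) b =
          normalizedProj (fun b => (d b).cover) b ≫ muAut hμ (d b) ∧
        ∀ c : B, c ≠ b →
          (ρ (.ofAdd ⟨b, AddSubgroup.subset_closure b.2⟩)).hom ≫
              normalizedProj (fun b => (d b).cover) c =
            normalizedProj (fun b => (d b).cover) c := by
  classical
  obtain ⟨F, _, _, j, r, φ, hj, hF, hφ⟩ := exists_isNormalModel_normalizedFibreProduct d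
  have hM (b) := (d b).isModel_genericFibre
  have haff (b) := (hM b).isAffineHom
  obtain ⟨κ, hκ⟩ := exists_coordinates hB hT
  obtain ⟨Φ, hΦ⟩ := hF.exists_rootsOfUnity_action
  let χ : Multiplicative (AddSubgroup.closure (B : Set A)) →*
      (F ≃ₐ[C.scheme.functionField] F) :=
    Φ.comp (MonoidHom.mk' (fun x b => KummerDatum.rootsEquiv hμ (AddMonoidHom.toMultiplicative
      (κ b) x))
      fun x y => by ext b; simp)
  have hχ (b c : B) : χ (.ofAdd ⟨b, AddSubgroup.subset_closure b.2⟩) (r c) =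
      (if c = b then C.const μ else 1) • r c := by
    refine (hΦ _ c).trans (congrArg (fun t => t • r c) ?_)
    change ((KummerDatum.rootsEquiv (C := C) hμ (.ofAdd (κ c ⟨b, _⟩)) :
      rootsOfUnity m C.scheme.functionField) : (C.scheme.functionField)ˣ).1 = _
    split_ifs with h
    · subst h
      rw [(hκ c).1]
      exact KummerDatum.rootsEquiv_one hμ
    · rw [(hκ b).2 c h, ofAdd_zero, map_one]
      rfl
  refine existsUnique_of_exists_of_unique ⟨hj.autHom χ, fun b => ?_⟩ fun ρ ρ' h h' => ?_
  · have hσ := hj.comp_autHom χ (.ofAdd ⟨b, AddSubgroup.subset_closure b.2⟩)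
    refine ⟨?_, fun c hc => ?_⟩
    · refine ((d b).muAut_comp_eq_iff hμ hj (hφ b).2 hσ).mpr ?_
      rw [(hφ b).1]
      exact (hχ b b).trans (by rw [if_pos rfl])
    · refine hj.hom_ext ?_
      rw [IsNormalModel.comp_homOfAlgHom_comp hσ (hφ c).2, (hφ c).2]
      refine congrArg (fun ψ : (d c).Alg →ₐ[C.scheme.functionField] F =>
        Spec.map (CommRingCat.ofHom ψ.toRingHom) ≫ (d c).genericFibre) (AdjoinRoot.algHom_ext ?_)
      rw [AlgHom.comp_apply, (hφ c).1]
      exact (hχ b c).trans (by rw [if_neg hc, one_smul])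
  -- Two actions agree on the generators in `B`, where the prescribed projections determine the
  -- automorphism, and so on the closure.
  · refine MonoidHom.ext fun ⟨x, hx⟩ => ?_
    change ρ (.ofAdd ⟨x, hx⟩) = ρ' (.ofAdd ⟨x, hx⟩)
    induction hx using AddSubgroup.closure_induction with
    | mem x hx =>
      refine Iso.ext (hom_eq_of_normalizedProj fun c => ?_)
      obtain ⟨h1, h2⟩ := h ⟨x, hx⟩
      obtain ⟨h3, h4⟩ := h' ⟨x, hx⟩
      by_cases hc : c = ⟨x, hx⟩
      · subst hc
        exact h1.trans h3.symm
      · exact (h2 c hc).trans (h4 c hc).symm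
    | zero => exact (map_one ρ).trans (map_one ρ').symm
    | add x y hx hy ihx ihy =>
      exact (map_mul ρ (.ofAdd ⟨x, hx⟩) (.ofAdd ⟨y, hy⟩)).trans
        ((congrArg₂ (· * ·) ihx ihy).trans (map_mul ρ' (.ofAdd ⟨x, hx⟩) (.ofAdd ⟨y, hy⟩)).symm)
    | neg x hx ih =>
      exact (map_inv ρ (.ofAdd ⟨x, hx⟩)).trans
        ((congrArg (·⁻¹) ih).trans (map_inv ρ' (.ofAdd ⟨x, hx⟩)).symm)

end

/-! ### Classification of connected cyclic covers -/

section
variable {K F Ω G : Type*} [Field K] [Field F] [Algebra K F] [Group G] {σ : G →* (F ≃ₐ[K] F)}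

/-- Hilbert's theorem 90 for a character of a finite group. -/
theorem exists_ne_zero_forall_eq_smul [Finite G] (hσ : Function.Injective σ) (χ : G →* Kˣ) :
    ∃ z : F, z ≠ 0 ∧ ∀ g, σ g z = (χ g : K) • z := by
  cases nonempty_fintype G
  have hli := (linearIndependent_monoidHom F F).comp (fun g : G => ((σ g : F ≃ₐ[K] F) : F →* F))
    fun g h e => hσ (AlgEquiv.ext fun x => DFunLike.congr_fun e x)
  -- Dedekind's independence of the distinct automorphisms `σ g` provides `y` whose weighted trace
  -- is nonzero; that trace is the eigenvector.
  have h0 : ¬ ∀ y, ∑ g, (χ g⁻¹ : K) • σ g y = 0 := fun h => by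
    have h1 := Fintype.linearIndependent_iff.mp hli (fun g => algebraMap K F (χ g⁻¹ : K)) (by
      ext y
      simpa [Finset.sum_apply, Algebra.smul_def] using h y) 1
    exact (χ 1⁻¹).ne_zero ((map_eq_zero _).mp h1)
  push Not at h0
  obtain ⟨y, hy⟩ := h0
  refine ⟨_, hy, fun h => ?_⟩
  rw [map_sum, Finset.smul_sum]
  refine Fintype.sum_equiv (Equiv.mulLeft h) _ _ fun g => ?_
  rw [map_smul, Equiv.coe_mulLeft, map_mul, smul_smul, mul_inv_rev, map_mul, Units.val_mul,
    mul_comm (χ g⁻¹ : K), ← mul_assoc, ← Units.val_mul, ← map_mul, mul_inv_cancel, map_one,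
    Units.val_one, one_mul]
  rfl

variable [Field Ω] [Algebra K Ω] [IsAlgClosed Ω] [FiniteDimensional K F] [Algebra.IsSeparable K F]
  {l : F →ₐ[K] Ω} (h : Function.Bijective fun g => l.comp (σ g : F →ₐ[K] F))
include h

theorem finrank_eq_card_of_bijective : Module.finrank K F = Nat.card G := by
  rw [← AlgHom.card K F Ω, ← Nat.card_eq_fintype_card]
  exact (Nat.card_eq_of_bijective _ h).symm

/-- Simple transitivity on the embeddings in `Ω` makes `G` the full automorphism group and its order
the degree, so the extension is Galois. -/
theorem mem_range_of_forall_fixed {x : F} (hx : ∀ g, σ g x = x) :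
    x ∈ Set.range (algebraMap K F) := by
  have hinj : Function.Injective σ := fun g g' e => h.1 (by simp only [e])
  have hsurj : Function.Surjective σ := fun τ => by
    obtain ⟨g, hg⟩ := h.2 (l.comp (τ : F →ₐ[K] F))
    exact ⟨g, AlgEquiv.ext fun y => l.injective (DFunLike.congr_fun hg y)⟩
  have : IsGalois K F := .of_card_aut_eq_finrank _ _ (by
    rw [finrank_eq_card_of_bijective h]
    exact (Nat.card_eq_of_bijective _ ⟨hinj, hsurj⟩).symm)
  refine IntermediateField.mem_bot.mp ((IsGalois.mem_bot_iff_fixed x).mpr fun τ => ?_)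
  obtain ⟨g, rfl⟩ := hsurj τ
  exact hx g

end

theorem linearIndependent_pow_of_isPrimitiveRoot {K F : Type*} [Field K] [Field F] [Algebra K F]
    {m : ℕ} {ζ : K} (hζ : IsPrimitiveRoot ζ m) {s : F →ₐ[K] F} {z : F} (hz : z ≠ 0)
    (hs : s z = ζ • z) : LinearIndependent K fun i : Fin m => z ^ (i : ℕ) := by
  refine Module.End.eigenvectors_linearIndependent' s.toLinearMap (fun i : Fin m => ζ ^ (i : ℕ))
    (fun i j h => Fin.ext (hζ.pow_inj i.2 j.2 h)) _ fun i => ?_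
  refine Module.End.hasEigenvector_iff.mpr ⟨Module.End.mem_eigenspace_iff.mpr ?_, pow_ne_zero _ hz⟩
  change s (z ^ (i : ℕ)) = _
  rw [map_pow, hs, smul_pow]

/-- Comparing valuations in `z ^ m = u t ^ a` gives `m v(z) = a`. The argument is carried out in the
unit group of `F`, where a unit of `L` can be a power of `t` only with exponent zero. -/
theorem dvd_of_pow_eq_of_irreducible {L F : Type*} [CommRing L] [IsDomain L]
    [IsDiscreteValuationRing L] [Field F] [Algebra L F] [IsFractionRing L F] {t : L}
    (ht : Irreducible t) {z : F} (hz : z ≠ 0) {u : Lˣ} {m : ℕ} {a : ℤ}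
    (h : z ^ m = algebraMap L F u * algebraMap L F t ^ a) : (m : ℤ) ∣ a := by
  have hinj := IsFractionRing.injective L F
  have ht0 : algebraMap L F t ≠ 0 := (map_ne_zero_iff _ hinj).mpr ht.ne_zero
  have key (n : ℕ) (w : Lˣ) (h : algebraMap L F w = algebraMap L F t ^ n) : n = 0 := by
    by_contra hn
    rw [← map_pow] at h
    have h1 := w.isUnit
    rw [hinj h, isUnit_pow_iff hn] at h1
    exact ht.not_isUnit h1
  let T : Fˣ := Units.mk0 _ ht0
  let φ : Lˣ →* Fˣ := Units.map (algebraMap L F).toMonoidHom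
  have key' (e : ℤ) (w : Lˣ) (h : φ w = T ^ e) : e = 0 := by
    obtain ⟨n, rfl | rfl⟩ := e.eq_nat_or_neg
    · rw [key n w (by simpa [φ, T] using congrArg Units.val h), Nat.cast_zero]
    · rw [zpow_neg, zpow_natCast, ← inv_eq_iff_eq_inv, ← map_inv] at h
      rw [key n w⁻¹ (congrArg Units.val h),
        Nat.cast_zero, neg_zero]
  obtain ⟨x, y, hy, rfl⟩ := IsFractionRing.div_surjective (A := L) z
  have hx : x ≠ 0 := fun h0 => hz (by rw [h0, map_zero, zero_div])
  obtain ⟨n, v, rfl⟩ := IsDiscreteValuationRing.eq_unit_mul_pow_irreducible hx ht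
  obtain ⟨k, w, rfl⟩ :=
    IsDiscreteValuationRing.eq_unit_mul_pow_irreducible (nonZeroDivisors.ne_zero hy) ht
  have h1 : (φ v * T ^ n / (φ w * T ^ k)) ^ m = φ u * T ^ a := Units.ext (by
    simpa [φ, T] using h)
  have h2 : φ ((v / w) ^ m / u) = T ^ (a - m * (n - k : ℤ)) := by
    rw [zpow_sub, zpow_mul', zpow_sub, zpow_natCast, zpow_natCast, zpow_natCast, map_div, map_pow,
      map_div, div_eq_iff_eq_mul, mul_right_comm, eq_mul_inv_iff_mul_eq, ← mul_pow, mul_comm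
        (T ^ a),
      ← h1, ← div_eq_mul_inv, div_mul_div_comm]
  exact ⟨n - k, by have := key' _ _ h2; omega⟩

/-- Unramifiedness makes the generator `t` of `p` a uniformizer at `q`, so the exponent of `t` is
not multiplied by a ramification index. -/
theorem dvd_of_pow_eq_of_formallyUnramified {R B F : Type*} [CommRing R] [CommRing B]
    [IsDedekindDomain B] [Field F] [Algebra R B] [Algebra B F] [Algebra R F] [IsScalarTower R B F]
    [IsFractionRing B F] [Algebra.FormallyUnramified R B] [Algebra.EssFiniteType R B]
    {t : R} (p : Ideal R) [p.IsPrime] (hp : p = Ideal.span {t}) (q : Ideal B) [q.IsPrime]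
    [q.LiesOver p] (ht : algebraMap R B t ≠ 0) {z : F}
    (hz : z ≠ 0) {u : Rˣ} {m : ℕ} {a : ℤ}
    (h : z ^ m = algebraMap R F u * algebraMap R F t ^ a) : (m : ℤ) ∣ a := by
  have hun : Algebra.IsUnramifiedAt R q := inferInstance
  let := Localization.AtPrime.algebraOfLiesOver p q
  have h1 := ((Algebra.isUnramifiedAt_iff_map_eq R p q).mp hun).2
  have hq : q ≠ ⊥ := by
    rintro rfl
    refine ht ?_
    have : t ∈ (⊥ : Ideal B).under R := by
      rw [← Ideal.LiesOver.over (p := p) (P := (⊥ : Ideal B)), hp]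
      exact Ideal.mem_span_singleton_self t
    exact this
  have hdvr : IsDiscreteValuationRing (Localization.AtPrime q) :=
    IsLocalization.AtPrime.isDiscreteValuationRing_of_dedekind_domain B hq _
  have hle : q.primeCompl ≤ nonZeroDivisors B := q.primeCompl_le_nonZeroDivisors
  let : Algebra (Localization.AtPrime q) F :=
    IsLocalization.localizationAlgebraOfSubmonoidLe _ _ q.primeCompl (nonZeroDivisors B) hle
  have : IsScalarTower B (Localization.AtPrime q) F :=
    IsLocalization.localization_isScalarTower_of_submonoid_le _ _ q.primeCompl
      (nonZeroDivisors B) hle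
  have : IsFractionRing (Localization.AtPrime q) F :=
    IsFractionRing.isFractionRing_of_isDomain_of_isLocalization q.primeCompl _ _
  have h2 (r : R) : algebraMap (Localization.AtPrime q) F (algebraMap R _ r) = algebraMap R F r :=
    by
    rw [IsScalarTower.algebraMap_apply R B (Localization.AtPrime q),
      ← IsScalarTower.algebraMap_apply B, ← IsScalarTower.algebraMap_apply R B F]
  have hirr : Irreducible (algebraMap R (Localization.AtPrime q) t) := by
    rw [IsDiscreteValuationRing.irreducible_iff_uniformizer, ← h1, hp, Ideal.map_span,
      Set.image_singleton]
  refine dvd_of_pow_eq_of_irreducible (F := F) hirr hz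
    (u := Units.map (algebraMap R (Localization.AtPrime q)).toMonoidHom u) ?_
  rw [h2, h]
  exact congrArg (· * _) (h2 u).symm

section
variable {k : Type u} [Field k] {C : SmoothProjectiveCurve k} {W : Over C.scheme}

theorem app_ne_zero [AlgebraicGeometry.IsIntegral W.left] {w : W.left}
    (hw : W.hom w = genericPoint C.scheme) {U : C.scheme.Opens}
    {g : Γ(C.scheme, U)} (hg : g ≠ 0) : W.hom.app U g ≠ 0 := fun h => by
  have h1 : Nonempty (C.scheme.basicOpen g) := by
    by_contra hE
    rw [not_nonempty_iff] at hE
    refine hg ((basicOpen_eq_bot_iff g).mp ?_)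
    ext y
    exact ⟨fun hy => (hE.false ⟨y, hy⟩).elim, fun hy => hy.elim⟩
  have h2 : w ∈ W.hom ⁻¹ᵁ C.scheme.basicOpen g := by
    change W.hom w ∈ C.scheme.basicOpen g
    rw [hw]
    exact genericPoint_mem _
  rw [Scheme.preimage_basicOpen, h, Scheme.basicOpen_zero] at h2
  exact h2

theorem flat_of_isIntegral [AlgebraicGeometry.IsIntegral W.left] [IsAffineHom W.hom] {w : W.left}
    (hw : W.hom w = genericPoint C.scheme) : Flat W.hom := by
  refine of_forall_app @Flat.{u} _ fun x => ?_
  obtain ⟨V, hV, hxV⟩ := exists_affineOpen_mem x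
  have : Nonempty V := ⟨⟨_, hxV⟩⟩
  have : Nonempty (W.hom ⁻¹ᵁ V) := ⟨⟨w, show W.hom w ∈ V from hw ▸ genericPoint_mem V⟩⟩
  refine ⟨V, hV, hxV, ?_⟩
  let := (W.hom.app V).hom.toAlgebra
  have := isDedekindDomain C.str hV
  have : Module.IsTorsionFree Γ(C.scheme, V) Γ(W.left, W.hom ⁻¹ᵁ V) :=
    Module.isTorsionFree_iff_algebraMap_injective.mpr
      ((injective_iff_map_eq_zero _).mpr fun g hg => by
        by_contra h
        exact app_ne_zero hw h hg)
  change Module.Flat Γ(C.scheme, V) Γ(W.left, W.hom ⁻¹ᵁ V)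
  infer_instance

theorem IsModel.moduleFinite [IsFinite W.hom] {A : Type u} [CommRing A]
    [Algebra C.scheme.functionField A] {j : Spec (.of A) ⟶ W.left} (h : IsModel W j) :
    Module.Finite C.scheme.functionField A := by
  obtain ⟨U, hU, hη⟩ := exists_affineOpen_mem (genericPoint C.scheme)
  have : Nonempty U := ⟨⟨_, hη⟩⟩
  let := (W.hom.app U).hom.toAlgebra
  let := (h.incl U).toAlgebra
  let : Algebra Γ(C.scheme, U) A :=
    ((algebraMap C.scheme.functionField A).comp (C.scheme.germToFunctionField U).hom).toAlgebra
  have : IsScalarTower Γ(C.scheme, U) C.scheme.functionField A := .of_algebraMap_eq fun _ => rfl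
  have : IsScalarTower Γ(C.scheme, U) Γ(W.left, W.hom ⁻¹ᵁ U) A :=
    .of_algebraMap_eq fun g => (pullSections_app h.comp_hom hU g).symm
  have := functionField_isFractionRing_of_isAffineOpen C.scheme U hU
  have hloc := h.isLocalization hU
  have : IsLocalization (Algebra.algebraMapSubmonoid Γ(W.left, W.hom ⁻¹ᵁ U)
    (nonZeroDivisors Γ(C.scheme, U))) A := hloc
  have : Module.Finite Γ(C.scheme, U) Γ(W.left, W.hom ⁻¹ᵁ U) := W.hom.finite_app U hU
  exact Module.Finite.of_isLocalization Γ(C.scheme, U) Γ(W.left, W.hom ⁻¹ᵁ U)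
    (nonZeroDivisors Γ(C.scheme, U))

theorem IsModel.formallyUnramified {A : Type u} [CommRing A]
    [Algebra C.scheme.functionField A] {j : Spec (.of A) ⟶ W.left} (h : IsModel W j)
    {U : C.scheme.Opens} (hU : IsAffineOpen U) [Nonempty U] (hW : (W.hom.app U).hom.Etale) :
    Algebra.FormallyUnramified C.scheme.functionField A := by
  let := (W.hom.app U).hom.toAlgebra
  let := (h.incl U).toAlgebra
  let : Algebra Γ(C.scheme, U) A :=
    ((algebraMap C.scheme.functionField A).comp (C.scheme.germToFunctionField U).hom).toAlgebra
  have : IsScalarTower Γ(C.scheme, U) C.scheme.functionField A := .of_algebraMap_eq fun _ => rfl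
  have : IsScalarTower Γ(C.scheme, U) Γ(W.left, W.hom ⁻¹ᵁ U) A :=
    .of_algebraMap_eq fun g => (pullSections_app h.comp_hom hU g).symm
  have hloc := h.isLocalization hU
  have : Algebra.Etale Γ(C.scheme, U) Γ(W.left, W.hom ⁻¹ᵁ U) := hW
  have : Algebra.FormallyUnramified Γ(W.left, W.hom ⁻¹ᵁ U) A := .of_isLocalization
    ((nonZeroDivisors Γ(C.scheme, U)).map (W.hom.app U).hom)
  have : Algebra.FormallyUnramified Γ(C.scheme, U) A := .comp _ Γ(W.left, W.hom ⁻¹ᵁ U) _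
  exact .of_restrictScalars Γ(C.scheme, U) _ _

theorem IsModel.isFractionRing {A : Type u} [Field A]
    [Algebra C.scheme.functionField A] {j : Spec (.of A) ⟶ W.left} (h : IsModel W j)
    {U : C.scheme.Opens} (hU : IsAffineOpen U) [Nonempty U] [IsDomain Γ(W.left, W.hom ⁻¹ᵁ U)] :
    letI := (h.incl U).toAlgebra
    IsFractionRing Γ(W.left, W.hom ⁻¹ᵁ U) A := by
  let := (h.incl U).toAlgebra
  have : FaithfulSMul Γ(W.left, W.hom ⁻¹ᵁ U) A :=
    (faithfulSMul_iff_algebraMap_injective _ _).mpr (h.injective U hU)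
  refine IsFractionRing.of_field _ _ fun a => ?_
  obtain ⟨g, hg, b, hb⟩ := h.exists_mul U hU a
  refine ⟨b, W.hom.app U g, ?_⟩
  have h1 := (isUnit_algebraMap_germ (R := A) hg).ne_zero
  have h2 := pullSections_app h.comp_hom hU g
  exact eq_div_of_mul_eq (h2 ▸ h1) ((mul_comm _ _).trans ((congrArg (· * a) h2).trans hb.symm))

/-- An integral cover with a point over the generic point is flat, hence a model. It is normal
because smoothness makes its section rings Dedekind; generic étaleness makes the function field
separable. -/
theorem SmoothProjectiveCurve.IsCover.exists_isNormalModel (hW : C.IsCover W)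
    [AlgebraicGeometry.IsIntegral W.left]
    {w : W.left} (hw : W.hom w = genericPoint C.scheme) :
    ∃ (F : Type u) (_ : Field F) (_ : Algebra C.scheme.functionField F) (j : Spec (.of F) ⟶ W.left),
      IsNormalModel W j ∧ Module.Finite C.scheme.functionField F ∧
        Algebra.IsSeparable C.scheme.functionField F := by
  have := hW.finite
  have := hW.smooth
  have := flat_of_isIntegral hw
  obtain ⟨A, _, _, j, hj⟩ := exists_isModel W
  have := hj.isDomain
  have hfin := hj.moduleFinite
  let : Field A := (isField_of_isIntegral_of_isField' (R := C.scheme.functionField)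
    (Field.toIsField _)).toField
  have hloc : IsLocallyNoetherian W.left := LocallyOfFiniteType.isLocallyNoetherian W.hom
  refine ⟨A, inferInstance, inferInstance, j, ⟨hj, fun U hU _ a ha => ?_⟩, hfin, ?_⟩
  · have : Nonempty (W.hom ⁻¹ᵁ U) := ⟨⟨w, show W.hom w ∈ U from hw ▸ genericPoint_mem U⟩⟩
    have := isDedekindDomain (W.hom ≫ C.str) (hU.preimage W.hom)
    let := (hj.incl U).toAlgebra
    have := hj.isFractionRing hU
    refine IsIntegrallyClosed.isIntegral_iff.mp ?_
    obtain ⟨p, hp, hpx⟩ := ha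
    refine ⟨p.map (W.hom.app U).hom, hp.map _, ?_⟩
    rw [Polynomial.eval₂_map, ← hpx]
    congr 1
    ext g
    exact pullSections_app hj.comp_hom hU g
  · obtain ⟨U, ⟨x, hx⟩, hU⟩ := hW.generically_etale
    obtain ⟨_, ⟨V, hV, rfl⟩, hxV, hVU⟩ :=
      C.scheme.isBasis_affineOpens.exists_subset_of_mem_open hx U.isOpen
    have : Nonempty V := ⟨⟨x, hxV⟩⟩
    have := hj.formallyUnramified hV (app_of_morphismRestrict @Etale.{u} _ hU hVU hV)
    exact Algebra.FormallyUnramified.isSeparable _ _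

end

section
variable {k : Type u} [Field k] {C : SmoothProjectiveCurve k} {W : Over C.scheme}

theorem isSectionAt_germ {U : C.scheme.Opens} [Nonempty U] (g : Γ(C.scheme, U))
    {x : PrimeDivisor C.scheme} (hx : x.1 ∈ U) :
    IsSectionAt 0 x (C.scheme.germToFunctionField U g) :=
  isSectionAt_zero_iff.mpr ⟨_, Scheme.algebraMap_germ_eq_germToFunctionField _ hx g⟩

theorem mem_span_singleton_iff {U : C.scheme.Opens} (hU : IsAffineOpen U) [Nonempty U]
    {x : PrimeDivisor C.scheme} (hx : x.1 ∈ U) {t : Γ(C.scheme, U)} (ht : t ≠ 0)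
    (hord : ∀ y : PrimeDivisor C.scheme, y.1 ∈ U →
      Scheme.ord (C.scheme.germToFunctionField U t) y.1 = Finsupp.single x 1 y) (g : Γ(C.scheme,
        U)) :
    g ∈ Ideal.span {t} ↔ g = 0 ∨ 1 ≤ Scheme.ord (C.scheme.germToFunctionField U g) x.1 := by
  classical
  have h0 {g : Γ(C.scheme, U)} (hg : g ≠ 0) : C.scheme.germToFunctionField U g ≠ 0 := by
    rwa [map_ne_zero_iff _ (Scheme.germToFunctionField_injective C.scheme U)]
  have hnn {g : Γ(C.scheme, U)} (hg : g ≠ 0) {y : PrimeDivisor C.scheme} (hy : y.1 ∈ U) :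
      0 ≤ Scheme.ord (C.scheme.germToFunctionField U g) y.1 := by
    simpa using (isSectionAt_germ g hy).resolve_left (h0 hg)
  rw [Ideal.mem_span_singleton]
  constructor
  · rintro ⟨g', rfl⟩
    refine or_iff_not_imp_left.mpr fun h => ?_
    have hg' := right_ne_zero_of_mul h
    rw [map_mul, Scheme.ord_mul (h0 ht) (h0 hg'), hord x hx, Finsupp.single_eq_same]
    have := hnn hg' hx
    omega
  · rintro (rfl | h)
    · exact dvd_zero t
    rcases eq_or_ne g 0 with rfl | hg
    · exact dvd_zero t
    obtain ⟨g', hg'⟩ := C.mem_range_germ hU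
      (c := C.scheme.germToFunctionField U g / C.scheme.germToFunctionField U t) fun y hy => by
        right
        rw [div_eq_mul_inv, Scheme.ord_mul (h0 hg) (inv_ne_zero (h0 ht)), ord_inv (h0 ht),
          hord y hy]
        have := hnn hg hy
        rcases eq_or_ne y x with rfl | hne
        · rw [Finsupp.single_eq_same]
          simp only [Finsupp.coe_zero, Pi.zero_apply]
          omega
        · rw [Finsupp.single_eq_of_ne hne]
          simpa using this
    refine ⟨g', Scheme.germToFunctionField_injective C.scheme U ?_⟩
    rw [map_mul]
    exact ((mul_div_cancel₀ _ (h0 ht)).symm.trans (congrArg (_ * ·) hg'.symm))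

theorem exists_unit_germ_eq {U : C.scheme.Opens} (hU : IsAffineOpen U) [Nonempty U]
    {c : C.scheme.functionField} (hc : c ≠ 0)
    (hord : ∀ y : PrimeDivisor C.scheme, y.1 ∈ U → Scheme.ord c y.1 = 0) :
    ∃ u : Γ(C.scheme, U)ˣ, C.scheme.germToFunctionField U u = c := by
  obtain ⟨u, hu⟩ := C.mem_range_germ hU (c := c) fun y hy => .inr (by simp [hord y hy])
  obtain ⟨v, hv⟩ := C.mem_range_germ hU (c := c⁻¹) fun y hy =>
    .inr (by simp [ord_inv hc, hord y hy])
  have h : u * v = 1 := Scheme.germToFunctionField_injective C.scheme U (by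
    rw [map_mul, map_one]
    exact (congrArg₂ (· * ·) hu hv).trans (mul_inv_cancel₀ hc))
  exact ⟨.mkOfMulEqOne _ _ h, hu⟩

/-- The multiplicity of a divisor of an `m`-th power of a function on an unramified cover. -/
theorem dvd_ord_of_etale [IsFinite W.hom] [AlgebraicGeometry.IsIntegral W.left] 
    (hsm : SmoothOfRelativeDimension 1 (W.hom ≫ C.str)) {F : Type u} [Field F]
    [Algebra C.scheme.functionField F] {j : Spec (.of F) ⟶ W.left} (hj : IsModel W j)
    {S : Finset (PrimeDivisor C.scheme)} (hS : C.IsEtaleOutside S W) {m : ℕ} [NeZero m] {z : F}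
    {c : C.scheme.functionField} (hc : c ≠ 0) (hz : z ^ m = algebraMap _ F c)
    {x : PrimeDivisor C.scheme} (hx : x ∉ S) : (m : ℤ) ∣ Scheme.ord c x.1 := by
  have hfin := finite_ord_ne_zero c
  -- The open `U` is chosen with `x` as the only possible point of `S` or of the divisor of `c`. As
  -- `x ∉ S`, the cover is étale over `U`, and on `U` the function `c` is a unit times a power of
  -- the equation `t` of `x`.
  obtain ⟨U, hU, hxU, hUT, h, h0, hh⟩ := C.exists_local_equations x.1
    (fun _ : Unit => Finsupp.single x 1) (S ∪ {y | Scheme.ord c y.1 ≠ 0})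
    ((Finset.finite_toSet S).union hfin)
  have : Nonempty U := ⟨⟨_, hxU⟩⟩
  replace h0 := h0 ()
  replace hh := hh ()
  obtain ⟨t, ht⟩ := C.mem_range_germ hU (c := h ()) fun y hy => by
    right
    rw [hh y hy]
    classical
    rw [Finsupp.single_apply]
    split_ifs <;> simp
  obtain ⟨u, hu⟩ : ∃ u : Γ(C.scheme, U)ˣ,
      C.scheme.germToFunctionField U u * C.scheme.germToFunctionField U t ^ Scheme.ord c x.1 = c :=
        by
    have hpow : h () ^ Scheme.ord c x.1 ≠ 0 := zpow_ne_zero _ h0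
    obtain ⟨u, hu⟩ := exists_unit_germ_eq hU (c := c / h () ^ Scheme.ord c x.1)
      (div_ne_zero hc hpow) fun y hy => by
        rw [div_eq_mul_inv, Scheme.ord_mul hc (inv_ne_zero hpow), ord_inv hpow, ord_zpow h0,
          hh y hy]
        rcases eq_or_ne y x with rfl | hne
        · rw [Finsupp.single_eq_same]
          ring
        · have : Scheme.ord c y.1 = 0 := by
            by_contra hcy
            exact hne (Subtype.ext (hUT y (.inr hcy) hy))
          rw [Finsupp.single_eq_of_ne hne, this]
          simp
    refine ⟨u, ?_⟩
    rw [hu]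
    exact (congrArg (fun f => _ * f ^ _) ht).trans (div_mul_cancel₀ _ hpow)
  have ht0 : t ≠ 0 := by
    rintro rfl
    exact h0 (ht.symm.trans (map_zero _))
  have hspan := mem_span_singleton_iff hU hxU ht0 fun y hy => by
    rw [← hh y hy]
    exact congrArg (fun f => Scheme.ord f y.1) ht
  have hprime : (Ideal.span {t}).IsPrime := by
    refine ⟨(Ideal.ne_top_iff_one _).mpr fun h1 => ?_, fun {a b} hab => ?_⟩
    · have h2 := (hspan 1).mp h1
      rw [map_one, ord_one] at h2
      exact h2.elim one_ne_zero (by norm_num)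
    · rw [hspan] at hab ⊢
      rw [hspan]
      rcases eq_or_ne a 0 with ha | ha
      · exact .inl (.inl ha)
      rcases eq_or_ne b 0 with hb | hb
      · exact .inr (.inl hb)
      have hinj (g : Γ(C.scheme, U)) : C.scheme.germToFunctionField U g ≠ 0 ↔ g ≠ 0 :=
        map_ne_zero_iff _ (Scheme.germToFunctionField_injective C.scheme U)
      have h1 := hab.resolve_left (mul_ne_zero ha hb)
      rw [map_mul, Scheme.ord_mul ((hinj a).mpr ha) ((hinj b).mpr hb)] at h1
      by_contra hcon
      push Not at hcon
      obtain ⟨⟨-, h2⟩, -, h3⟩ := hcon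
      omega
  have hWU : Nonempty (W.hom ⁻¹ᵁ U) :=
    ⟨⟨j (⊥ : PrimeSpectrum F), le_preimage_of_comp_eq hj.comp_hom U trivial⟩⟩
  have hloc : IsLocallyNoetherian W.left := LocallyOfFiniteType.isLocallyNoetherian W.hom
  have := isDedekindDomain (W.hom ≫ C.str) (hU.preimage W.hom)
  let := (W.hom.app U).hom.toAlgebra
  let := (hj.incl U).toAlgebra
  let : Algebra Γ(C.scheme, U) F :=
    ((algebraMap C.scheme.functionField F).comp (C.scheme.germToFunctionField U).hom).toAlgebra
  have : IsScalarTower Γ(C.scheme, U) Γ(W.left, W.hom ⁻¹ᵁ U) F :=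
    .of_algebraMap_eq fun g => (pullSections_app hj.comp_hom hU g).symm
  have := hj.isFractionRing hU
  have hinj : Function.Injective (algebraMap Γ(C.scheme, U) Γ(W.left, W.hom ⁻¹ᵁ U)) := by
    refine Function.Injective.of_comp (f := algebraMap Γ(W.left, W.hom ⁻¹ᵁ U) F) ?_
    rw [← RingHom.coe_comp, ← IsScalarTower.algebraMap_eq]
    exact (algebraMap C.scheme.functionField F).injective.comp
      (Scheme.germToFunctionField_injective C.scheme U)
  have : Algebra.Etale Γ(C.scheme, U) Γ(W.left, W.hom ⁻¹ᵁ U) :=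
    app_of_morphismRestrict @Etale.{u} W.hom (hS U fun y hy hyU =>
      hx (Subtype.ext (hUT y (.inl hy) hyU) ▸ hy)) le_rfl hU
  have : Module.Finite Γ(C.scheme, U) Γ(W.left, W.hom ⁻¹ᵁ U) := W.hom.finite_app U hU
  obtain ⟨q, -, hq, hqt⟩ := Ideal.exists_ideal_over_prime_of_isIntegral (Ideal.span {t})
    (⊥ : Ideal Γ(W.left, W.hom ⁻¹ᵁ U)) (by
      rw [← RingHom.ker_eq_comap_bot, (RingHom.injective_iff_ker_eq_bot _).mp hinj]
      exact bot_le)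
  have : q.LiesOver (Ideal.span {t}) := ⟨hqt.symm⟩
  have hz0 : z ≠ 0 := fun h => by
    rw [h, zero_pow (NeZero.ne m), eq_comm, map_eq_zero] at hz
    exact hc hz
  refine dvd_of_pow_eq_of_formallyUnramified (F := F) (Ideal.span {t}) rfl q
    ((map_ne_zero_iff _ hinj).mpr ht0) hz0 (u := u) ?_
  refine hz.trans ((congrArg (algebraMap C.scheme.functionField F) hu.symm).trans ?_)
  rw [map_mul, map_zpow₀]
  rfl

theorem exists_algEquiv_action {G : Type*} {A : Type u} [CommGroup G] [CommRing A]
    [Algebra C.scheme.functionField A] {j : Spec (.of A) ⟶ W.left} (hj : IsModel W j) (ρ :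
      G →* Aut W) :
    ∃ σ : G →* (A ≃ₐ[C.scheme.functionField] A), ∀ g,
      j ≫ (ρ g).hom.left = Spec.map (CommRingCat.ofHom (σ g).toAlgHom.toRingHom) ≫ j := by
  have key (g : G) := hj.existsUnique_algHom (w := j ≫ (ρ g).hom.left)
    (by rw [Category.assoc, Over.w, hj.comp_hom])
  choose s hs using fun g => (key g).exists
  have hmul (g h : G) : (s g).comp (s h) = s (g * h) := hj.algHom_eq (by
    have h1 : j ≫ (ρ (g * h)).hom.left = j ≫ (ρ g).hom.left ≫ (ρ h).hom.left := by
      rw [mul_comm, map_mul]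
      rfl
    rw [hs, h1, ← Category.assoc, ← hs, Category.assoc, ← hs, ← Category.assoc, ← Spec.map_comp]
    rfl)
  have hone : s 1 = AlgHom.id _ _ := hj.algHom_eq (by
    rw [hs, map_one]
    refine (Category.comp_id j).trans (Eq.trans ?_ (congrArg (· ≫ j) (Spec.map_id (.of A)).symm))
    exact (Category.id_comp j).symm)
  let σ (g : G) : A ≃ₐ[C.scheme.functionField] A := .ofAlgHom (s g) (s g⁻¹)
    (by rw [hmul, mul_inv_cancel, hone]) (by rw [hmul, inv_mul_cancel, hone])
  refine ⟨MonoidHom.mk' σ fun g h => AlgEquiv.ext fun x => (DFunLike.congr_fun (hmul g h) x).symm,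
    fun g => (hs g).symm⟩

/-- Geometric points of `W` over the generic point are the `K`-embeddings of `F` in `Ω`, so this is
simple transitivity in algebraic terms. -/
theorem bijective_comp_of_isGaloisCover {G : Type*} {F : Type u} [CommGroup G] [Field F]
    [Algebra C.scheme.functionField F] {j : Spec (.of F) ⟶ W.left} (hj : IsModel W j) {ρ :
      G →* Aut W}
    (hρ : C.IsGaloisCover W ρ) {σ : G →* (F ≃ₐ[C.scheme.functionField] F)}
    (hσ : ∀ g, j ≫ (ρ g).hom.left = Spec.map (CommRingCat.ofHom (σ g).toAlgHom.toRingHom) ≫ j)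
    {Ω : Type u} [Field Ω] [IsAlgClosed Ω] [Algebra C.scheme.functionField Ω]
    (l : F →ₐ[C.scheme.functionField] Ω) :
    Function.Bijective fun g => l.comp (σ g : F →ₐ[C.scheme.functionField] F) := by
  have hpt (l : F →ₐ[C.scheme.functionField] Ω) :
      (Spec.map (CommRingCat.ofHom l.toRingHom) ≫ j) ≫ W.hom = genericMap C.scheme Ω := by
    rw [Category.assoc, hj.comp_hom, map_genericMap]
  have hcomp (g : G) : (Spec.map (CommRingCat.ofHom l.toRingHom) ≫ j) ≫ (ρ g).hom.left =
      Spec.map (CommRingCat.ofHom (l.comp (σ g : F →ₐ[C.scheme.functionField] F)).toRingHom) ≫ j :=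
        by
    rw [Category.assoc, hσ, ← Category.assoc, ← Spec.map_comp]
    rfl
  have h := fun l' => (hρ.simply_transitive Ω (genericMap C.scheme Ω) (genericMap_apply)).2 _ _
    (hpt l) (hpt l')
  refine ⟨fun g g' e => ?_, fun l' => ?_⟩
  · exact (h (l.comp (σ g : F →ₐ[C.scheme.functionField] F))).unique (hcomp g)
      ((hcomp g').trans (by simp only at e; rw [e]))
  · obtain ⟨g, hg, -⟩ := h l'
    exact ⟨g, hj.algHom_eq ((hcomp g).symm.trans hg)⟩

end

section
variable {k : Type u} [Field k] {C : SmoothProjectiveCurve k} {m : ℕ} [NeZero m]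
  {S : Finset (PrimeDivisor C.scheme)}

omit [NeZero m] in
-- The divisor of `f` is split at `S`: the part on `S` is `D`, the rest divided by `m` is `E`.
theorem KummerDatum.exists_f_eq {f : C.scheme.functionField} (hf : f ≠ 0)
    (h : ∀ x : PrimeDivisor C.scheme, x ∉ S → (m : ℤ) ∣ Scheme.ord f x.1) :
    ∃ d : KummerDatum m S, d.f = f := by
  classical
  let V : Divisor C.scheme := .onFinset (finite_ord_ne_zero f).toFinset (fun x => Scheme.ord f x.1)
    fun x hx => (finite_ord_ne_zero f).mem_toFinset.mpr hx
  exact ⟨{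
    E := (V.filter (· ∉ S)).mapRange (· / (m : ℤ)) (Int.zero_ediv _)
    D := V.filter (· ∈ S)
    support_subset := fun x hx => by
      rw [Finsupp.support_filter] at hx
      exact (Finset.mem_filter.mp hx).2
    f := f
    f_ne_zero := hf
    ord_f := fun x => by
      rw [Finsupp.mapRange_apply, Finsupp.filter_apply, Finsupp.filter_apply]
      by_cases hx : x ∈ S
      · simp [V, hx]
      · simp [V, hx, Int.mul_ediv_cancel' (h x hx)] }, rfl⟩

/-- The powers `1, z, …, z ^ (m - 1)` are eigenvectors with distinct eigenvalues, hence a basis of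
`F`; the map is then surjective between spaces of dimension `m`. -/
theorem KummerDatum.liftRoot_bijective (d : KummerDatum m S) {F : Type u} [Field F]
    [Algebra C.scheme.functionField F] {z : F} (hz : z ^ m = algebraMap _ F d.f)
    {s : F →ₐ[C.scheme.functionField] F} {ζ : C.scheme.functionField} (hζ : IsPrimitiveRoot ζ m)
    (hs : s z = ζ • z) (hF : Module.finrank C.scheme.functionField F = m) :
    Function.Bijective (d.liftRoot z hz) := by
  have hz0 : z ≠ 0 := fun h => by
    rw [h, zero_pow (NeZero.ne m), eq_comm, map_eq_zero] at hz
    exact d.f_ne_zero hz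
  have hspan := (linearIndependent_pow_of_isPrimitiveRoot hζ hz0 hs).span_eq_top_of_card_eq_finrank
    (by rw [Fintype.card_fin, hF])
  have hsurj : Function.Surjective (d.liftRoot z hz).toLinearMap := by
    rw [← LinearMap.range_eq_top, eq_top_iff, ← hspan, Submodule.span_le]
    rintro _ ⟨i, rfl⟩
    exact ⟨AdjoinRoot.root _ ^ (i : ℕ),
      (map_pow (d.liftRoot z hz) _ _).trans (congrArg (· ^ (i : ℕ)) (d.liftRoot_root _ _))⟩
  have hdim : Module.finrank C.scheme.functionField d.Alg = m := by
    have h0 : (Polynomial.X ^ m - Polynomial.C d.f) ≠ 0 :=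
      Polynomial.X_pow_sub_C_ne_zero (NeZero.pos m) _
    rw [(AdjoinRoot.powerBasis h0).finrank, AdjoinRoot.powerBasis_dim,
      Polynomial.natDegree_X_pow_sub_C]
  have : Module.Finite C.scheme.functionField F := Module.finite_of_finrank_pos (hF ▸ NeZero.pos m)
  exact ⟨(LinearMap.injective_iff_surjective_of_finrank_eq_finrank (hdim.trans hF.symm)).mpr hsurj,
    hsurj⟩

namespace SmoothProjectiveCurve

/-- By Hilbert 90 the function field contains `z ≠ 0` on which `ℤ/m` acts through the character
given by `μ`. Then `z ^ m` is invariant, so it is some `c ∈ K`; étaleness off `S` makes `c` part of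
a datum, and its cover and `W` are normalizations of `Y` in the same extension. -/
theorem exists_iso_cover [IsAlgClosed k] (hmk : (m : k) ≠ 0)
    {μ : k} (hμ : IsPrimitiveRoot μ m) {W : Over C.scheme} {ρ : Multiplicative (ZMod m) →* Aut W}
    (hρ : C.IsGaloisCover W ρ) (hS : C.IsEtaleOutside S W) [ConnectedSpace W.left] :
    ∃ d : KummerDatum m S, addOrderOf d.toGenPic = m ∧
      ∃ e : W ≅ d.cover, (ρ (.ofAdd 1)).hom ≫ e.hom = e.hom ≫ muAut hμ d := by
  let K := C.scheme.functionField
  have hfin := hρ.isCover.finite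
  have hsm := hρ.isCover.smooth
  have : IsNoetherian W.left :=
    { LocallyOfFiniteType.isLocallyNoetherian W.hom,
      QuasiCompact.compactSpace_of_compactSpace W.hom with }
  have := isIntegral_of_smooth_of_connected (W.hom ≫ C.str)
  -- The existence half of simple transitivity shows that `W` dominates `Y`, which connectedness
  -- alone does not give.
  obtain ⟨w, hw⟩ := (hρ.simply_transitive (AlgebraicClosure K) (genericMap C.scheme _)
    genericMap_apply).1
  have hw' : W.hom (w (⊥ : PrimeSpectrum (AlgebraicClosure K))) = genericPoint C.scheme :=
    (congrArg (fun g : Spec (.of (AlgebraicClosure K)) ⟶ C.scheme =>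
      g (⊥ : PrimeSpectrum (AlgebraicClosure K))) hw).trans (genericMap_apply _)
  obtain ⟨F, _, _, j, hj, _, _⟩ := hρ.isCover.exists_isNormalModel hw'
  obtain ⟨σ, hσ⟩ := exists_algEquiv_action hj.toIsModel ρ
  have hbij := bijective_comp_of_isGaloisCover hj.toIsModel hρ hσ
    (IsAlgClosed.lift : F →ₐ[K] AlgebraicClosure K)
  let χ : Multiplicative (ZMod m) →* Kˣ :=
    (rootsOfUnity m K).subtype.comp (KummerDatum.rootsEquiv hμ).toMonoidHom
  obtain ⟨z, hz0, hz⟩ := exists_ne_zero_forall_eq_smul (σ := σ)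
    (fun g g' e => hbij.1 (by simp only [e])) χ
  obtain ⟨c, hc⟩ := mem_range_of_forall_fixed hbij (x := z ^ m) fun g => by
    rw [map_pow, hz, smul_pow]
    have : (χ g : K) ^ m = 1 := congrArg Units.val
      ((mem_rootsOfUnity m _).mp (KummerDatum.rootsEquiv (C := C) hμ g).2)
    rw [this, one_smul]
  have hc0 : c ≠ 0 := by
    rintro rfl
    exact pow_ne_zero m hz0 (hc.symm.trans (map_zero _))
  obtain ⟨d, rfl⟩ := KummerDatum.exists_f_eq hc0 fun x hx =>
    dvd_ord_of_etale hsm hj.toIsModel hS hc0 hc.symm hx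
  have hz1 : σ (.ofAdd 1) z = C.const μ • z :=
    (hz _).trans (congrArg (· • z) (KummerDatum.rootsEquiv_one hμ))
  have hφ := d.liftRoot_bijective hc.symm (s := (σ (.ofAdd 1) : F →ₐ[K] F))
    (KummerDatum.isPrimitiveRoot_const hμ) hz1
    ((finrank_eq_card_of_bijective hbij).trans (by simp))
  have hN := d.isNormalModel_genericFibre hμ hmk
  let θ := AlgEquiv.ofBijective _ hφ
  let e := hj.isoOfAlgEquiv hN θ
  refine ⟨d, (d.addOrderOf_toGenPic_eq_iff_connectedSpace hμ hmk).mpr ?_, e,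
    (d.muAut_comp_eq_iff hμ hj (hj.comp_isoOfAlgEquiv hN θ) (hσ _)).mpr ?_⟩
  · have h1 : W.left ≃ₜ d.cover.left := (((Over.forget C.scheme).mapIso e).hom).homeomorph
    exact h1.surjective.connectedSpace h1.continuous
  · have h1 : θ.toAlgHom (AdjoinRoot.root _) = z := d.liftRoot_root _ hc.symm
    rw [h1]
    exact hz1

end SmoothProjectiveCurve
end
end CyclicCovers

/-! ### The theorem -/

theorem mainTheorem10 {k : Type u} [Field k] [IsAlgClosed k] (Y : SmoothProjectiveCurve k)
    (m : ℕ) [NeZero m] (hm : 1 < m) (hmk : (m : k) ≠ 0) (S : Finset (PrimeDivisor Y.scheme))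
    (μ : k) (hμ : IsPrimitiveRoot μ m) :
    -- Elements of `P_m` correspond to `m`-cyclic covers, those of order `m` to connected ones.
    ((∀ a : GenPic m S, ∃ d : KummerDatum m S, d.toGenPic = a ∧ ∀ x, 0 ≤ d.D x ∧ d.D x < m) ∧
      (∀ d : KummerDatum m S, Y.IsEtaleOutside S d.cover ∧
        ∃ ρ : Multiplicative (ZMod m) →* Aut d.cover,
          (ρ (.ofAdd 1)).hom = muAut hμ d ∧ Y.IsGaloisCover d.cover ρ) ∧
      (∀ d : KummerDatum m S, addOrderOf d.toGenPic = m ↔ ConnectedSpace d.cover.left) ∧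
      (∀ d d' : KummerDatum m S, d.toGenPic = d'.toGenPic ↔
        ∃ e : d.cover ≅ d'.cover, muAut hμ d ≫ e.hom = e.hom ≫ muAut hμ d') ∧
      (∀ (W : Over Y.scheme) (ρ : Multiplicative (ZMod m) →* Aut W),
        Y.IsGaloisCover W ρ → Y.IsEtaleOutside S W → ConnectedSpace W.left →
          ∃ d : KummerDatum m S, addOrderOf d.toGenPic = m ∧
            ∃ e : W ≅ d.cover, (ρ (.ofAdd 1)).hom ≫ e.hom = e.hom ≫ muAut hμ d)) ∧
    -- A set of elements of order `m`, with the corresponding covers.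
    (∀ B : Finset (GenPic m S), (∀ b ∈ B, addOrderOf b = m) →
      ∀ d : B → KummerDatum m S, (∀ b, (d b).toGenPic = b) →
        (IsTypeT1 (B : Set (GenPic m S)) ↔ MutuallyLinearlyDisjoint fun b => (d b).cover) ∧
        (IsTypeT1 (B : Set (GenPic m S)) →
          ∃ _ : AlgebraicGeometry.IsIntegral (fibreProduct fun b => (d b).cover).left,
            -- Domination of the components of the covers attached to elements of `⟨B⟩`.
            (∀ z ∈ AddSubgroup.closure (B : Set (GenPic m S)),
              ∀ e : KummerDatum m S, e.toGenPic = z → ∀ v : e.cover.left,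
                ∃ h : normalizedFibreProduct (fun b => (d b).cover) ⟶ e.cover,
                  Set.range h.left = connectedComponent v) ∧
            -- The action of `⟨B⟩`, extending the `μ ^ i`-actions.
            (∃! ρ : Multiplicative (AddSubgroup.closure (B : Set (GenPic m S))) →*
                Aut (normalizedFibreProduct fun b => (d b).cover),
              ∀ b : B,
                (ρ (.ofAdd ⟨b, AddSubgroup.subset_closure b.2⟩)).hom ≫
                    normalizedProj (fun b => (d b).cover) b =
                  normalizedProj (fun b => (d b).cover) b ≫ muAut hμ (d b) ∧
                ∀ c : B, c ≠ b →
                  (ρ (.ofAdd ⟨b, AddSubgroup.subset_closure b.2⟩)).hom ≫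
                      normalizedProj (fun b => (d b).cover) c =
                    normalizedProj (fun b => (d b).cover) c))) := by
  refine ⟨⟨KummerDatum.exists_reduced, fun d => ⟨d.isEtaleOutside hμ hmk, _, d.muAut_eq hμ hmk,
    d.isGaloisCover hμ hmk⟩, fun d => d.addOrderOf_toGenPic_eq_iff_connectedSpace hμ hmk,
    fun d d' => d.toGenPic_eq_iff_exists_iso hμ hmk hm d',
    fun W ρ hρ hS _ => exists_iso_cover hmk hμ hρ hS⟩, fun B hB d hd => ?_⟩
  have h := isTypeT1_iff_mutuallyLinearlyDisjoint hμ hmk hB hd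
  refine ⟨h, fun hT => ?_⟩
  have hI : AlgebraicGeometry.IsIntegral (fibreProduct fun b => (d b).cover).left := h.mp hT
  exact ⟨hI, fun z hz e he v => exists_hom_normalizedFibreProduct hd hμ hmk hz he v,
    existsUnique_action (A := GenPic m S) hμ hB hT⟩
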